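/- **Notation.** All varieties are over $\mathbb{C}$, and quotients carry the quotient Zariski topology and the invariant regular functions (the structure of geometric quotients). *Points on the line.* For positive integer weights $\mu=(\mu_1,\dots,\mu_n)$, a configuration $(p_1,\dots,p_n)\in(\mathbb{P}^1)^n$ is stable if for every $x\in\mathbb{P}^1$ the total weight $\sum_{p_i=x}\mu_i$ is less than $\tfrac12\sum_i\mu_i$. Let $DM(\mu)$ be the quotient of the stable locus by $SL_2(\mathbb{C})$, and let $DM_{\mathbb{Z}/2}(2^5,1^2)=DM(2^5,1^2)/(\mathbb{Z}/2)$, where $\mathbb{Z}/2$ interchanges the two points of weight $1$. The group $S_5$ acts by permuting the five points of weight $2$. The map $[p_1,\dots,p_6]\mapsto[p_1,\dots,p_5,\{p_6,p_6\}]$ sends $DM(2^6)$ to the locus in $DM_{\mathbb{Z}/2}(2^5,1^2)$ where the two points of weight $1$ coincide. *Points in the plane.* Let $\mathcal{M}^{sm}_{C,m}$ be the set of $SL_3(\mathbb{C})$-orbits of generic $6$-tuples $(m_1,\dots,m_6)$ in $\mathbb{P}^2$: no three are collinear, and not all six lie on a conic. The map $\phi^6_7:\mathcal{M}^{sm}_{C,m}\to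 DM_{\mathbb{Z}/2}(2^5,1^2)$ is defined as follows. Let $Q$ be the irreducible conic through $m_1,\dots,m_5$, and let $t_1,t_2\in Q$ be the two points whose tangent lines pass through $m_6$. Then $\phi^6_7$ sends $[m_1,\dots,m_6]$ to the class of the images of $m_1,\dots,m_5$ and of $\{t_1,t_2\}$ under projection from $m_6$ to a line $\mathbb{P}^1$. *The locus $\Delta_Q$.* Consider tuples consisting of six points $m_1,\dots,m_6\in\mathbb{P}^2$ and, for each pair $i\ne j$, a line $\ell_{ij}=\ell_{ji}$ through $m_i$ and $m_j$. If $m_i\neq m_j$, this is the line joining them; if $m_i=m_j$, it is a direction in which the two points are infinitely near. A generic $6$-tuple is regarded as such a tuple. Let $\Delta_Q$ be the locus, modulo $SL_3(\mathbb{C})$, of those tuples for which no three of the points coincide and there is an irreducible conic $Q$ that contains all the $m_i$ and is tangent to $\ell_{ij}$ at $m_i$ whenever $m_i=m_j$ with $i\ne j$. The union $\mathcal{M}^{sm}_{C,m}\cup\Delta_Q$ is the quotient by $SL_3(\mathbb{C})$ of a subspace of $(\mathbb{P}^2)^6\times(\mathbb{P}^{2*})^{15}$, with the induced structure, and $S_5$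 acts on it by permuting the first five labels. **Lemma.** The map $\phi^6_7$ extends to an $S_5$-equivariant morphism $$\Phi:\mathcal{M}^{sm}_{C,m}\cup\Delta_Q\longrightarrow DM_{\mathbb{Z}/2}(2^5,1^2).$$ The map $DM(2^6)\to DM_{\mathbb{Z}/2}(2^5,1^2)$ above is an isomorphism onto its image. The restriction of $\Phi$ to $\Delta_Q$ is an isomorphism onto its image, and this image is the sublocus $DM(2^6)\subset DM_{\mathbb{Z}/2}(2^5,1^2)$. -/

import Mathlib

open scoped LinearAlgebra.Projectivization Matrix Topology

namespace SixPoints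

/-- A space with functions over `ℂ` (a complex variety in the sense of Serre): a topology together
with, for every open set `U`, the functions regular on `U`. Functions are total for convenience;
only their values on `U` matter. -/
structure FunctionSpace (X : Type*) where
  top : TopologicalSpace X
  IsRegular : Set X → (X → ℂ) → Prop
  regular_const : ∀ (U : Set X) (a : ℂ), IsRegular U fun _ => a
  regular_add : ∀ (U : Set X) (f g : X → ℂ), IsRegular U f → IsRegular U g →
    IsRegular U fun x => f x + g x
  regular_mul : ∀ (U : Set X) (f g : X → ℂ), IsRegular U f → IsRegular U g →
    IsRegular U fun x => f x * g x
  regular_congr : ∀ (U : Set X) (f g : X → ℂ), (∀ x ∈ U, f x = g x) → IsRegular U f →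
    IsRegular U g
  regular_restrict : ∀ (U V : Set X) (f : X → ℂ), V ⊆ U → IsRegular U f → IsRegular V f
  regular_glue : ∀ (U : Set X) (f : X → ℂ),
    (∀ x ∈ U, ∃ V : Set X, IsOpen[top] V ∧ x ∈ V ∧ IsRegular (U ∩ V) f) → IsRegular U f

namespace FunctionSpace

variable {X Y : Type*}

/-- A morphism: a continuous map that pulls regular functions back to regular functions. -/
def IsMorphism (S : FunctionSpace X) (T : FunctionSpace Y) (f : X → Y) : Prop :=
  (∀ V : Set Y, IsOpen[T.top] V → IsOpen[S.top] (f ⁻¹' V)) ∧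
  ∀ (V : Set Y) (h : Y → ℂ), IsOpen[T.top] V → T.IsRegular V h → S.IsRegular (f ⁻¹' V) (h ∘ f)

/-- An isomorphism: a bijection such that it and its inverse are morphisms. -/
def IsIsomorphism (S : FunctionSpace X) (T : FunctionSpace Y) (f : X → Y) : Prop :=
  ∃ e : X ≃ Y, (∀ x, e x = f x) ∧ S.IsMorphism T e ∧ T.IsMorphism S e.symm

/-- The structure induced along a map `f : X → Y`: the coarsest topology making `f` continuous, and
the functions that locally are pulled back from `Y`. For the inclusion of a subset this is the
structure of a subspace. -/
def induced (T : FunctionSpace Y) (f : X → Y) : FunctionSpace X where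
  top := TopologicalSpace.induced f T.top
  IsRegular U g := ∀ x ∈ U, ∃ (V : Set Y) (h : Y → ℂ), IsOpen[T.top] V ∧ f x ∈ V ∧
    T.IsRegular V h ∧ ∀ y ∈ U, f y ∈ V → g y = h (f y)
  regular_const U a := fun x _ =>
    ⟨Set.univ, fun _ => a, T.top.isOpen_univ, trivial, T.regular_const _ a, fun _ _ _ => rfl⟩
  regular_add U f₁ f₂ h₁ h₂ := fun x hx => by
    obtain ⟨V, k, hV, hxV, hk, e⟩ := h₁ x hx
    obtain ⟨V', k', hV', hxV', hk', e'⟩ := h₂ x hx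
    refine ⟨V ∩ V', fun y => k y + k' y, T.top.isOpen_inter _ _ hV hV', ⟨hxV, hxV'⟩,
      T.regular_add _ _ _ (T.regular_restrict _ _ _ Set.inter_subset_left hk)
        (T.regular_restrict _ _ _ Set.inter_subset_right hk'), fun y hy hyV => ?_⟩
    simp only [e y hy hyV.1, e' y hy hyV.2]
  regular_mul U f₁ f₂ h₁ h₂ := fun x hx => by
    obtain ⟨V, k, hV, hxV, hk, e⟩ := h₁ x hx
    obtain ⟨V', k', hV', hxV', hk', e'⟩ := h₂ x hx
    refine ⟨V ∩ V', fun y => k y * k' y, T.top.isOpen_inter _ _ hV hV', ⟨hxV, hxV'⟩,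
      T.regular_mul _ _ _ (T.regular_restrict _ _ _ Set.inter_subset_left hk)
        (T.regular_restrict _ _ _ Set.inter_subset_right hk'), fun y hy hyV => ?_⟩
    simp only [e y hy hyV.1, e' y hy hyV.2]
  regular_congr U f₁ f₂ h h₁ := fun x hx => by
    obtain ⟨V, k, hV, hxV, hk, e⟩ := h₁ x hx
    exact ⟨V, k, hV, hxV, hk, fun y hy hyV => (h y hy).symm.trans (e y hy hyV)⟩
  regular_restrict U V g hVU h := fun x hx => by
    obtain ⟨W, k, hW, hxW, hk, e⟩ := h x (hVU hx)
    exact ⟨W, k, hW, hxW, hk, fun y hy hyW => e y (hVU hy) hyW⟩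
  regular_glue U g h := fun x hx => by
    obtain ⟨V, ⟨V', hV', rfl⟩, hxV, hV⟩ := h x hx
    obtain ⟨W, k, hW, hxW, hk, e⟩ := hV x ⟨hx, hxV⟩
    exact ⟨W ∩ V', k, T.top.isOpen_inter _ _ hW hV', ⟨hxW, hxV⟩,
      T.regular_restrict _ _ _ Set.inter_subset_left hk, fun y hy hyW => e y ⟨hy, hyW.2⟩ hyW.1⟩

/-- The structure coinduced along a map `f : X → Y`: the quotient topology, and the functions whose
pullback to `X` is regular. For the orbit map of a group action this is the quotient topology with
the invariant regular functions, i.e. the structure of a geometric quotient. -/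
def coinduced (S : FunctionSpace X) (f : X → Y) : FunctionSpace Y where
  top := TopologicalSpace.coinduced f S.top
  IsRegular U g := S.IsRegular (f ⁻¹' U) (g ∘ f)
  regular_const _ a := S.regular_const _ a
  regular_add _ _ _ h₁ h₂ := S.regular_add _ _ _ h₁ h₂
  regular_mul _ _ _ h₁ h₂ := S.regular_mul _ _ _ h₁ h₂
  regular_congr _ _ _ h h₁ := S.regular_congr _ _ _ (fun x hx => h (f x) hx) h₁
  regular_restrict _ _ _ hVU h := S.regular_restrict _ _ _ (Set.preimage_mono hVU) h
  regular_glue U g h := S.regular_glue _ _ fun x hx => by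
    obtain ⟨V, hV, hxV, hr⟩ := h (f x) hx
    exact ⟨f ⁻¹' V, hV, hxV, hr⟩

/-- `f` is an isomorphism of `X` onto its image, where the image carries the structure of a
subspace of `Y`. -/
def IsIsomorphismOntoImage (S : FunctionSpace X) (T : FunctionSpace Y) (f : X → Y) : Prop :=
  S.IsIsomorphism (T.induced (Subtype.val : Set.range f → Y)) (Set.rangeFactorization f)

end FunctionSpace

/-- Affine space `ℂ^ι` with the Zariski topology; regular functions are locally quotients of
polynomials. -/
def affineSpace (ι : Type*) : FunctionSpace (ι → ℂ) where
  top :=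
    { IsOpen := fun U => ∀ x ∈ U, ∃ k : MvPolynomial ι ℂ, MvPolynomial.eval x k ≠ 0 ∧
        ∀ y, MvPolynomial.eval y k ≠ 0 → y ∈ U
      isOpen_univ := fun _ _ => ⟨1, by simp, fun _ _ => trivial⟩
      isOpen_inter := fun U V hU hV x hx => by
        obtain ⟨k, hk, h⟩ := hU x hx.1
        obtain ⟨k', hk', h'⟩ := hV x hx.2
        refine ⟨k * k', by simp [hk, hk'], fun y hy => ?_⟩
        rw [map_mul] at hy
        exact ⟨h y (left_ne_zero_of_mul hy), h' y (right_ne_zero_of_mul hy)⟩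
      isOpen_sUnion := fun s hs x hx => by
        obtain ⟨U, hU, hxU⟩ := hx
        obtain ⟨k, hk, h⟩ := hs U hU x hxU
        exact ⟨k, hk, fun y hy => ⟨U, hU, h y hy⟩⟩ }
  IsRegular U f := ∀ x ∈ U, ∃ g h : MvPolynomial ι ℂ, MvPolynomial.eval x h ≠ 0 ∧
    ∀ y ∈ U, MvPolynomial.eval y h ≠ 0 → f y = MvPolynomial.eval y g / MvPolynomial.eval y h
  regular_const U a := fun x _ => ⟨MvPolynomial.C a, 1, by simp, by simp⟩
  regular_add U f₁ f₂ h₁ h₂ := fun x hx => by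
    obtain ⟨g, h, hh, e⟩ := h₁ x hx
    obtain ⟨g', h', hh', e'⟩ := h₂ x hx
    refine ⟨g * h' + h * g', h * h', by simp [hh, hh'], fun y hy hyh => ?_⟩
    rw [map_mul] at hyh
    have a := left_ne_zero_of_mul hyh
    have b := right_ne_zero_of_mul hyh
    simp only [e y hy a, e' y hy b, map_add, map_mul, div_add_div _ _ a b]
  regular_mul U f₁ f₂ h₁ h₂ := fun x hx => by
    obtain ⟨g, h, hh, e⟩ := h₁ x hx
    obtain ⟨g', h', hh', e'⟩ := h₂ x hx
    refine ⟨g * g', h * h', by simp [hh, hh'], fun y hy hyh => ?_⟩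
    rw [map_mul] at hyh
    have a := left_ne_zero_of_mul hyh
    have b := right_ne_zero_of_mul hyh
    simp only [e y hy a, e' y hy b, map_mul, div_mul_div_comm]
  regular_congr U f₁ f₂ h h₁ := fun x hx => by
    obtain ⟨g, k, hk, e⟩ := h₁ x hx
    exact ⟨g, k, hk, fun y hy hyk => (h y hy).symm.trans (e y hy hyk)⟩
  regular_restrict U V f hVU h := fun x hx => by
    obtain ⟨g, k, hk, e⟩ := h x (hVU hx)
    exact ⟨g, k, hk, fun y hy hyk => e y (hVU hy) hyk⟩
  regular_glue U f h := fun x hx => by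
    obtain ⟨V, hV, hxV, hf⟩ := h x hx
    obtain ⟨l, hl, hlV⟩ := hV x hxV
    obtain ⟨g, k, hk, e⟩ := hf x ⟨hx, hxV⟩
    refine ⟨g * l, k * l, by simp [hk, hl], fun y hy hyk => ?_⟩
    rw [map_mul] at hyk
    have a := left_ne_zero_of_mul hyk
    have b := right_ne_zero_of_mul hyk
    rw [e y ⟨hy, hlV y b⟩ a, map_mul, map_mul, mul_div_mul_right _ _ b]

/-- The map sending nonzero vectors, indexed by `ι`, to the points of `ℙ(ℂ^κ)` they span. -/
noncomputable def spanPoints (ι κ : Type*) (v : {v : ι × κ → ℂ // ∀ i, (fun k => v (i, k)) ≠ 0}) :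
    ι → ℙ ℂ (κ → ℂ) :=
  fun i => Projectivization.mk ℂ (fun k => v.1 (i, k)) (v.2 i)

/-- The product `∏_{i ∈ ι} ℙ(ℂ^κ)` of projective spaces as a variety: the quotient of the tuples of
nonzero vectors by rescaling each of them. -/
noncomputable def multiProjectiveSpace (ι κ : Type*) : FunctionSpace (ι → ℙ ℂ (κ → ℂ)) :=
  ((affineSpace (ι × κ)).induced Subtype.val).coinduced (spanPoints ι κ)


/-- The projective line over `ℂ`. -/
abbrev P1 := ℙ ℂ (Fin 2 → ℂ)

/-- The projective plane over `ℂ`. -/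
abbrev P2 := ℙ ℂ (Fin 3 → ℂ)

/-! ### Deligne-Mostow moduli spaces of weighted points on the projective line -/

open Classical in
/-- A configuration of points of weights `μ i` on the projective line is (GIT-)stable if the total
weight of the points that coincide at any one place is less than half of the total weight. -/
def IsStable {ι : Type*} [Fintype ι] (μ : ι → ℕ) (p : ι → P1) : Prop :=
  ∀ x : P1, 2 * ∑ i with p i = x, μ i < ∑ i, μ i

/-- Two configurations on the line are equivalent if an element of `SL₂(ℂ)` takes one to the
other. -/
def lineSetoid {ι : Type*} (s : Set (ι → P1)) : Setoid s where
  r p q := ∃ g : Matrix.SpecialLinearGroup (Fin 2) ℂ, ∀ i, q.1 i = g • p.1 i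
  iseqv :=
    { refl := fun p => ⟨1, fun i => (one_smul _ _).symm⟩
      symm := fun ⟨g, hg⟩ => ⟨g⁻¹, fun i => by rw [hg i, inv_smul_smul]⟩
      trans := fun ⟨g, hg⟩ ⟨h, hh⟩ => ⟨h * g, fun i => by rw [hh i, hg i, mul_smul]⟩ }

/-- The moduli space `DM(μ)` of stable configurations of points of weights `μ` on the projective
line, modulo `SL₂(ℂ)`. -/
def DM {ι : Type*} [Fintype ι] (μ : ι → ℕ) := Quotient (lineSetoid {p | IsStable μ p})

/-- The class of a stable configuration. -/
def DM.mk {ι : Type*} [Fintype ι] (μ : ι → ℕ) (p : {p // IsStable μ p}) : DM μ := Quotient.mk (lineSetoid {p | IsStable μ p}) p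

/-- `DM(μ)` as a variety: the geometric quotient of the stable locus in `(ℙ¹)^ι` by `SL₂(ℂ)`. -/
noncomputable def DM.space {ι : Type*} [Fintype ι] (μ : ι → ℕ) : FunctionSpace (DM μ) :=
  ((multiProjectiveSpace ι (Fin 2)).induced
    (Subtype.val : {p : ι → P1 // IsStable μ p} → ι → P1)).coinduced (DM.mk μ)

theorem IsStable.perm {ι : Type*} [Fintype ι] {μ : ι → ℕ} {p : ι → P1} (hp : IsStable μ p) (τ : Equiv.Perm ι)
    (hτ : ∀ i, μ (τ i) = μ i) : IsStable μ fun i => p (τ⁻¹ i) := by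
  intro x
  refine lt_of_eq_of_lt ?_ (hp x)
  congr 1
  refine Finset.sum_bij (fun i _ => τ⁻¹ i) (by simp) (by simp) (fun i hi => ⟨τ i, by simpa using hi, by simp⟩) ?_
  intro i _
  simpa using hτ (τ⁻¹ i)

/-- A weight-preserving permutation of the points acts on `DM(μ)`. -/
def DM.perm {ι : Type*} [Fintype ι] (μ : ι → ℕ) (τ : Equiv.Perm ι) (hτ : ∀ i, μ (τ i) = μ i) : DM μ → DM μ :=
  Quotient.map (fun p => ⟨fun i => p.1 (τ⁻¹ i), p.2.perm τ hτ⟩)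
    fun _ _ ⟨g, hg⟩ => ⟨g, fun i => hg (τ⁻¹ i)⟩

/-- Labels of six points: five and a last one. -/
abbrev Six := Fin 5 ⊕ Fin 1

/-- Labels of seven points: five and a last pair. -/
abbrev Seven := Fin 5 ⊕ Fin 2

/-- The weights `(2,2,2,2,2,2)`. -/
def weight26 : Six → ℕ := fun _ => 2

/-- The weights `(2,2,2,2,2,1,1)`. -/
def weight2511 : Seven → ℕ := Sum.elim (fun _ => 2) (fun _ => 1)

/-- The interchange of the two points of weight `1`. -/
def swapLast : Equiv.Perm Seven := Equiv.sumCongr (Equiv.refl _) (Equiv.swap 0 1)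

/-- A permutation of the first five labels, acting on all seven. -/
def permSeven (σ : Equiv.Perm (Fin 5)) : Equiv.Perm Seven := Equiv.sumCongr σ (Equiv.refl _)

/-- A permutation of the first five labels, acting on all six. -/
def permSix (σ : Equiv.Perm (Fin 5)) : Equiv.Perm Six := Equiv.sumCongr σ (Equiv.refl _)

theorem weight_swapLast (i : Seven) : weight2511 (swapLast i) = weight2511 i := by
  rcases i with i | i <;> rfl

theorem weight_permSeven (σ : Equiv.Perm (Fin 5)) (i : Seven) :
    weight2511 (permSeven σ i) = weight2511 i := by
  rcases i with i | i <;> rfl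

/-- The action of `ℤ/2` on `DM(2⁵,1²)` interchanging the two points of weight `1`. -/
def DM.swap : DM weight2511 → DM weight2511 := DM.perm weight2511 swapLast weight_swapLast

theorem DM.swap_swap (x : DM weight2511) : DM.swap (DM.swap x) = x := by
  induction x using Quotient.inductionOn with
  | h p =>
    refine Quotient.sound ⟨1, fun i => ?_⟩
    rcases i with i | i
    · simp [swapLast]
    · fin_cases i <;> simp [swapLast]

/-- Two points of `DM(2⁵,1²)` are equivalent if they are equal or interchanged by `ℤ/2`. -/
def swapSetoid : Setoid (DM weight2511) where
  r x y := y = x ∨ y = DM.swap x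
  iseqv :=
    { refl := fun _ => Or.inl rfl
      symm := by
        rintro x y (rfl | rfl)
        · exact Or.inl rfl
        · exact Or.inr (DM.swap_swap x).symm
      trans := by
        rintro x y z (rfl | rfl) (rfl | rfl)
        · exact Or.inl rfl
        · exact Or.inr rfl
        · exact Or.inr rfl
        · exact Or.inl (DM.swap_swap x) }

/-- The moduli space `DM_{ℤ/2}(2⁵,1²) = DM(2⁵,1²)/(ℤ/2)`. -/
def DMZ2 := Quotient swapSetoid

/-- The quotient map `DM(2⁵,1²) → DM_{ℤ/2}(2⁵,1²)`. -/
def DMZ2.mk (x : DM weight2511) : DMZ2 := Quotient.mk swapSetoid x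

/-- `DM_{ℤ/2}(2⁵,1²)` as a variety. -/
noncomputable def DMZ2.space : FunctionSpace DMZ2 := (DM.space weight2511).coinduced DMZ2.mk

/-- The action of `S₅` on `DM_{ℤ/2}(2⁵,1²)` permuting the five points of weight `2`. -/
def DMZ2.perm (σ : Equiv.Perm (Fin 5)) : DMZ2 → DMZ2 :=
  Quotient.map (DM.perm weight2511 (permSeven σ) (weight_permSeven σ)) <| by
    rintro x y (rfl | rfl)
    · exact Or.inl rfl
    · refine Or.inr ?_
      induction x using Quotient.inductionOn with
      | h p =>
        refine Quotient.sound ⟨1, fun i => ?_⟩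
        rcases i with i | i
        · exact (one_smul _ _).symm
        · fin_cases i <;> simp [swapLast, permSeven]

/-- The map of labels under which both points of weight `1` become the sixth point. -/
def collapse : Seven → Six := Sum.map id fun _ => 0

open Classical in
theorem IsStable.collapse {p : Six → P1} (hp : IsStable weight26 p) :
    IsStable weight2511 (p ∘ SixPoints.collapse) := by
  intro x
  have h := hp x
  rw [Finset.sum_filter, Fintype.sum_sum_type, Fintype.sum_sum_type] at h ⊢
  rw [Fin.sum_univ_one, Fin.sum_univ_one] at h
  rw [Fin.sum_univ_two, Fin.sum_univ_two]
  change 2 * ((∑ i : Fin 5, if p (Sum.inl i) = x then 2 else 0) +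
    ((if p (Sum.inr 0) = x then 1 else 0) + (if p (Sum.inr 0) = x then 1 else 0))) <
    ∑ _ : Fin 5, 2 + (1 + 1)
  change 2 * ((∑ i : Fin 5, if p (Sum.inl i) = x then 2 else 0) +
    (if p (Sum.inr 0) = x then 2 else 0)) < ∑ _ : Fin 5, 2 + 2 at h
  split_ifs at h ⊢ <;> omega

/-- The inclusion `DM(2⁶) → DM_{ℤ/2}(2⁵,1²)` of the locus where the two points of weight `1`
coincide: the sixth point of weight `2` is regarded as two coinciding points of weight `1`. -/
def descend : DM weight26 → DMZ2 := fun x =>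
  DMZ2.mk (Quotient.map (sa := lineSetoid {p | IsStable weight26 p})
    (sb := lineSetoid {p | IsStable weight2511 p}) (fun p => ⟨p.1 ∘ collapse, p.2.collapse⟩)
    (fun _ _ ⟨g, hg⟩ => ⟨g, fun i => hg (collapse i)⟩) x)

/-! ### Conics and configurations of six points in the plane -/

/-- The point `x` lies on the conic `{v | vᵀ A v = 0}`. -/
def OnConic (A : Matrix (Fin 3) (Fin 3) ℂ) (x : P2) : Prop :=
  ∀ v ∈ x.submodule, v ⬝ᵥ A *ᵥ v = 0

/-- The symmetric matrix `A` defines an irreducible (equivalently, over `ℂ`, nondegenerate)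
conic. -/
def IsIrreducibleConic (A : Matrix (Fin 3) (Fin 3) ℂ) : Prop := A.IsSymm ∧ A.det ≠ 0

/-- The line with coordinates `l`, i.e. the line of all points orthogonal to `l`, is the tangent line
at the point `x` of the irreducible conic defined by `A`. -/
def IsTangentLine (A : Matrix (Fin 3) (Fin 3) ℂ) (x l : P2) : Prop :=
  ∀ v ∈ x.submodule, A *ᵥ v ∈ l.submodule

/-- Six points in the plane are generic if no three of them are collinear (in particular, no two
coincide) and they do not all lie on a conic, reducible or not. -/
def IsGeneric (m : Six → P2) : Prop :=
  (∀ i j k, i ≠ j → i ≠ k → j ≠ k → Projectivization.Independent ![m i, m j, m k]) ∧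
  ¬ ∃ A : Matrix (Fin 3) (Fin 3) ℂ, A.IsSymm ∧ A ≠ 0 ∧ ∀ i, OnConic A (m i)

/-- The seven points `p` on the line arise from the six points `m` in the plane by projection: `A`
defines an irreducible conic through the first five points, the points `t 0` and `t 1` are the two
points of this conic whose tangent lines pass through the sixth point, the linear map `π` is a
projection from the sixth point to a projective line, and `p` consists of the images of the first
five points and of the two points of tangency. -/
structure IsProjection (m : Six → P2) (p : Seven → P1) (A : Matrix (Fin 3) (Fin 3) ℂ)
    (t : Fin 2 → P2) (π : (Fin 3 → ℂ) →ₗ[ℂ] (Fin 2 → ℂ)) : Prop where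
  conic : IsIrreducibleConic A
  onConic : ∀ i, OnConic A (m (Sum.inl i))
  tangency_ne : t 0 ≠ t 1
  tangency_onConic : ∀ j, OnConic A (t j)
  tangency : ∀ j, ∃ l, IsTangentLine A (t j) l ∧ l.orthogonal (m (Sum.inr 0))
  ker_eq : LinearMap.ker π = (m (Sum.inr 0)).submodule
  map_point : ∀ i, (m (Sum.inl i)).submodule.map π = (p (Sum.inl i)).submodule
  map_tangency : ∀ j, (t j).submodule.map π = (p (Sum.inr j)).submodule

theorem onConic_mk {A : Matrix (Fin 3) (Fin 3) ℂ} {v : Fin 3 → ℂ} (hv : v ≠ 0) :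
    OnConic A (.mk ℂ v hv) ↔ v ⬝ᵥ A *ᵥ v = 0 := by
  refine ⟨fun h => h v (by simp [Projectivization.submodule_mk, Submodule.mem_span_singleton_self]),
    fun h w hw => ?_⟩
  rw [Projectivization.submodule_mk, Submodule.mem_span_singleton] at hw
  obtain ⟨a, rfl⟩ := hw
  simp [Matrix.mulVec_smul, h]

theorem tangent_mk {A : Matrix (Fin 3) (Fin 3) ℂ} (hA : A.det ≠ 0) {v w : Fin 3 → ℂ} (hv : v ≠ 0)
    (hw : w ≠ 0) :
    (∃ l, IsTangentLine A (.mk ℂ v hv) l ∧ l.orthogonal (.mk ℂ w hw)) ↔ (A *ᵥ v) ⬝ᵥ w = 0 := by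
  have hAv : A *ᵥ v ≠ 0 := fun h => hv (Matrix.eq_zero_of_mulVec_eq_zero hA h)
  constructor
  · rintro ⟨l, hl, hlw⟩
    induction l using Projectivization.ind with | h u hu =>
    have := hl v (by simp [Projectivization.submodule_mk, Submodule.mem_span_singleton_self])
    rw [Projectivization.submodule_mk, Submodule.mem_span_singleton] at this
    obtain ⟨a, ha⟩ := this
    rw [Projectivization.orthogonal_mk] at hlw
    rw [← ha, smul_dotProduct, hlw, smul_zero]
  · intro h
    refine ⟨.mk ℂ _ hAv, fun u hu => ?_, (Projectivization.orthogonal_mk _ _).2 h⟩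
    rw [Projectivization.submodule_mk, Submodule.mem_span_singleton] at hu ⊢
    obtain ⟨a, rfl⟩ := hu
    exact ⟨a, by rw [Matrix.mulVec_smul]⟩

theorem independent_det {x y z : P2} (h : Projectivization.Independent ![x, y, z]) :
    (Matrix.of ![x.rep, y.rep, z.rep]).det ≠ 0 := by
  rw [Projectivization.independent_iff] at h
  have h2 : LinearIndependent ℂ (Matrix.of ![x.rep, y.rep, z.rep]).row := by
    have e : (Matrix.of ![x.rep, y.rep, z.rep]).row = Projectivization.rep ∘ ![x, y, z] := by
      funext i
      fin_cases i <;> rfl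
    rw [e]
    exact h
  rw [Matrix.linearIndependent_rows_iff_isUnit, Matrix.isUnit_iff_isUnit_det] at h2
  exact h2.ne_zero

/-- Coordinates with respect to three independent vectors. -/
theorem exists_coords {P : Matrix (Fin 3) (Fin 3) ℂ} (hP : P.det ≠ 0) (v : Fin 3 → ℂ) :
    ∃ x : Fin 3 → ℂ, v = x ᵥ* P :=
  ⟨v ᵥ* P⁻¹, by
    rw [Matrix.vecMul_vecMul, Matrix.nonsing_inv_mul _ (isUnit_iff_ne_zero.2 hP),
      Matrix.vecMul_one]⟩

section FivePoints

variable {v : Fin 5 → Fin 3 → ℂ}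

/-- The coefficients, in the coordinates given by the first three points, of the conic through five
points; `x` and `y` are the coordinates of the last two points. -/
theorem coords_ne_zero
    (hv : ∀ i j k, i ≠ j → i ≠ k → j ≠ k → (Matrix.of ![v i, v j, v k]).det ≠ 0)
    {x y : Fin 3 → ℂ} (hx : v 3 = x ᵥ* Matrix.of ![v 0, v 1, v 2])
    (hy : v 4 = y ᵥ* Matrix.of ![v 0, v 1, v 2]) :
    (x 0 * y 0 * (x 2 * y 1 - x 1 * y 2) ≠ 0 ∧ x 1 * y 1 * (x 0 * y 2 - x 2 * y 0) ≠ 0) ∧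
      x 2 * y 2 * (x 1 * y 0 - x 0 * y 1) ≠ 0 := by
  have e : ∀ z : Fin 3 → ℂ, z ᵥ* Matrix.of ![v 0, v 1, v 2] =
      fun k => z 0 * v 0 k + z 1 * v 1 k + z 2 * v 2 k := by
    intro z
    ext k
    simp [Matrix.vecMul, dotProduct, Fin.sum_univ_three]
  rw [e] at hx hy
  have hx0 : x 0 ≠ 0 := fun h => hv 3 1 2 (by decide) (by decide) (by decide) (by
    rw [hx, h, Matrix.det_fin_three]; simp; ring)
  have hx1 : x 1 ≠ 0 := fun h => hv 3 0 2 (by decide) (by decide) (by decide) (by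
    rw [hx, h, Matrix.det_fin_three]; simp; ring)
  have hx2 : x 2 ≠ 0 := fun h => hv 3 0 1 (by decide) (by decide) (by decide) (by
    rw [hx, h, Matrix.det_fin_three]; simp; ring)
  have hy0 : y 0 ≠ 0 := fun h => hv 4 1 2 (by decide) (by decide) (by decide) (by
    rw [hy, h, Matrix.det_fin_three]; simp; ring)
  have hy1 : y 1 ≠ 0 := fun h => hv 4 0 2 (by decide) (by decide) (by decide) (by
    rw [hy, h, Matrix.det_fin_three]; simp; ring)
  have hy2 : y 2 ≠ 0 := fun h => hv 4 0 1 (by decide) (by decide) (by decide) (by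
    rw [hy, h, Matrix.det_fin_three]; simp; ring)
  have h0 : x 2 * y 1 - x 1 * y 2 ≠ 0 := fun h => hv 0 3 4 (by decide) (by decide) (by decide) (by
    rw [hx, hy, Matrix.det_fin_three]; simp
    linear_combination (-1) * (v 0 0 * v 1 1 * v 2 2 - v 0 0 * v 1 2 * v 2 1
      - v 0 1 * v 1 0 * v 2 2 + v 0 1 * v 1 2 * v 2 0 + v 0 2 * v 1 0 * v 2 1
      - v 0 2 * v 1 1 * v 2 0) * h)
  have h1 : x 0 * y 2 - x 2 * y 0 ≠ 0 := fun h => hv 1 3 4 (by decide) (by decide) (by decide) (by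
    rw [hx, hy, Matrix.det_fin_three]; simp
    linear_combination (-1) * (v 0 0 * v 1 1 * v 2 2 - v 0 0 * v 1 2 * v 2 1
      - v 0 1 * v 1 0 * v 2 2 + v 0 1 * v 1 2 * v 2 0 + v 0 2 * v 1 0 * v 2 1
      - v 0 2 * v 1 1 * v 2 0) * h)
  have h2 : x 1 * y 0 - x 0 * y 1 ≠ 0 := fun h => hv 2 3 4 (by decide) (by decide) (by decide) (by
    rw [hx, hy, Matrix.det_fin_three]; simp
    linear_combination (-1) * (v 0 0 * v 1 1 * v 2 2 - v 0 0 * v 1 2 * v 2 1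
      - v 0 1 * v 1 0 * v 2 2 + v 0 1 * v 1 2 * v 2 0 + v 0 2 * v 1 0 * v 2 1
      - v 0 2 * v 1 1 * v 2 0) * h)
  exact ⟨⟨mul_ne_zero (mul_ne_zero hx0 hy0) h0, mul_ne_zero (mul_ne_zero hx1 hy1) h1⟩,
    mul_ne_zero (mul_ne_zero hx2 hy2) h2⟩

theorem exists_conic
    (hv : ∀ i j k, i ≠ j → i ≠ k → j ≠ k → (Matrix.of ![v i, v j, v k]).det ≠ 0) :
    ∃ A, IsIrreducibleConic A ∧ ∀ i, v i ⬝ᵥ A *ᵥ v i = 0 := by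
  have hP := hv 0 1 2 (by decide) (by decide) (by decide)
  set P := Matrix.of ![v 0, v 1, v 2] with hPdef
  obtain ⟨x, hx⟩ := exists_coords hP (v 3)
  obtain ⟨y, hy⟩ := exists_coords hP (v 4)
  obtain ⟨⟨ha, hb⟩, hc⟩ := coords_ne_zero hv hx hy
  set a := x 0 * y 0 * (x 2 * y 1 - x 1 * y 2) with hadef
  set b := x 1 * y 1 * (x 0 * y 2 - x 2 * y 0) with hbdef
  set c := x 2 * y 2 * (x 1 * y 0 - x 0 * y 1) with hcdef
  set B : Matrix (Fin 3) (Fin 3) ℂ := !![0, c, b; c, 0, a; b, a, 0] with hBdef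
  have hPu := isUnit_iff_ne_zero.2 hP
  refine ⟨P⁻¹ * B * P⁻¹ᵀ, ⟨?_, ?_⟩, ?_⟩
  · have hB : Bᵀ = B := by
      ext i j
      fin_cases i <;> fin_cases j <;> rfl
    simp only [Matrix.IsSymm, Matrix.transpose_mul, Matrix.transpose_transpose, hB, Matrix.mul_assoc]
  · have hB : B.det = 2 * a * b * c := by
      rw [Matrix.det_fin_three]
      simp [hBdef]
      ring
    rw [Matrix.det_mul, Matrix.det_mul, Matrix.det_transpose, hB]
    have : P⁻¹.det ≠ 0 := (Matrix.isUnit_nonsing_inv_det _ hPu).ne_zero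
    exact mul_ne_zero (mul_ne_zero this (mul_ne_zero (mul_ne_zero (mul_ne_zero two_ne_zero ha) hb) hc)) this
  · have key : ∀ z : Fin 3 → ℂ, (z ᵥ* P) ⬝ᵥ (P⁻¹ * B * P⁻¹ᵀ) *ᵥ (z ᵥ* P) =
        2 * (c * z 0 * z 1 + b * z 0 * z 2 + a * z 1 * z 2) := by
      intro z
      have e1 : P⁻¹ᵀ *ᵥ (z ᵥ* P) = z := by
        rw [Matrix.mulVec_transpose, Matrix.vecMul_vecMul, Matrix.mul_nonsing_inv _ hPu,
          Matrix.vecMul_one]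
      rw [← Matrix.mulVec_mulVec, e1, ← Matrix.mulVec_mulVec, ← Matrix.dotProduct_mulVec,
        Matrix.mulVec_mulVec, Matrix.mul_nonsing_inv _ hPu, Matrix.one_mulVec]
      simp [hBdef, Matrix.mulVec, dotProduct, Fin.sum_univ_three]
      ring
    have e0 : v 0 = ![1, 0, 0] ᵥ* P := by
      ext k; simp [Matrix.vecMul, dotProduct, Fin.sum_univ_three, hPdef]
    have e1 : v 1 = ![0, 1, 0] ᵥ* P := by
      ext k; simp [Matrix.vecMul, dotProduct, Fin.sum_univ_three, hPdef]
    have e2 : v 2 = ![0, 0, 1] ᵥ* P := by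
      ext k; simp [Matrix.vecMul, dotProduct, Fin.sum_univ_three, hPdef]
    intro i
    fin_cases i
    · change v 0 ⬝ᵥ _ *ᵥ v 0 = 0
      rw [e0, key]; simp
    · change v 1 ⬝ᵥ _ *ᵥ v 1 = 0
      rw [e1, key]; simp
    · change v 2 ⬝ᵥ _ *ᵥ v 2 = 0
      rw [e2, key]; simp
    · change v 3 ⬝ᵥ _ *ᵥ v 3 = 0
      rw [hx, key, hadef, hbdef, hcdef]; ring
    · change v 4 ⬝ᵥ _ *ᵥ v 4 = 0
      rw [hy, key, hadef, hbdef, hcdef]; ring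

theorem conic_unique
    (hv : ∀ i j k, i ≠ j → i ≠ k → j ≠ k → (Matrix.of ![v i, v j, v k]).det ≠ 0)
    {A A' : Matrix (Fin 3) (Fin 3) ℂ} (hA : IsIrreducibleConic A) (hA' : IsIrreducibleConic A')
    (h : ∀ i, v i ⬝ᵥ A *ᵥ v i = 0) (h' : ∀ i, v i ⬝ᵥ A' *ᵥ v i = 0) :
    ∃ s : ℂ, s ≠ 0 ∧ A' = s • A := by
  have hP := hv 0 1 2 (by decide) (by decide) (by decide)
  set P := Matrix.of ![v 0, v 1, v 2] with hPdef
  have hPu := isUnit_iff_ne_zero.2 hP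
  obtain ⟨x, hx⟩ := exists_coords hP (v 3)
  obtain ⟨y, hy⟩ := exists_coords hP (v 4)
  obtain ⟨⟨ha, hb⟩, hc⟩ := coords_ne_zero hv hx hy
  have key : ∀ A : Matrix (Fin 3) (Fin 3) ℂ, IsIrreducibleConic A →
      (∀ i, v i ⬝ᵥ A *ᵥ v i = 0) → ∃ r : ℂ, P * A * Pᵀ = r • !![0, x 2 * y 2 * (x 1 * y 0 - x 0 * y 1), x 1 * y 1 * (x 0 * y 2 - x 2 * y 0); x 2 * y 2 * (x 1 * y 0 - x 0 * y 1), 0, x 0 * y 0 * (x 2 * y 1 - x 1 * y 2); x 1 * y 1 * (x 0 * y 2 - x 2 * y 0), x 0 * y 0 * (x 2 * y 1 - x 1 * y 2), 0] := by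
    intro A hA h
    have hS : ∀ i j, (P * A * Pᵀ) i j = (P * A * Pᵀ) j i := by
      have : (P * A * Pᵀ)ᵀ = P * A * Pᵀ := by
        simp only [Matrix.transpose_mul, Matrix.transpose_transpose, hA.1.eq, Matrix.mul_assoc]
      intro i j
      rw [← Matrix.transpose_apply (P * A * Pᵀ), this]
    have hD : ∀ z : Fin 3 → ℂ, (z ᵥ* P) ⬝ᵥ A *ᵥ (z ᵥ* P) = z ⬝ᵥ (P * A * Pᵀ) *ᵥ z := by
      intro z
      rw [← Matrix.mulVec_mulVec, ← Matrix.mulVec_mulVec, Matrix.mulVec_transpose,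
        Matrix.dotProduct_mulVec z]
    have e0 : v 0 = ![1, 0, 0] ᵥ* P := by
      ext k; simp [Matrix.vecMul, dotProduct, Fin.sum_univ_three, hPdef]
    have e1 : v 1 = ![0, 1, 0] ᵥ* P := by
      ext k; simp [Matrix.vecMul, dotProduct, Fin.sum_univ_three, hPdef]
    have e2 : v 2 = ![0, 0, 1] ᵥ* P := by
      ext k; simp [Matrix.vecMul, dotProduct, Fin.sum_univ_three, hPdef]
    have q0 := h 0
    have q1 := h 1
    have q2 := h 2
    have q3 := h 3
    have q4 := h 4
    rw [e0, hD] at q0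
    rw [e1, hD] at q1
    rw [e2, hD] at q2
    rw [hx, hD] at q3
    rw [hy, hD] at q4
    generalize P * A * Pᵀ = B at *
    simp [Matrix.mulVec, dotProduct, Fin.sum_univ_three] at q0 q1 q2 q3 q4
    rw [hS 1 0, hS 2 0, hS 2 1, q0, q1, q2] at q3 q4
    refine ⟨B 1 2 / (x 0 * y 0 * (x 2 * y 1 - x 1 * y 2)), ?_⟩
    have f1 : B 0 2 = B 1 2 / (x 0 * y 0 * (x 2 * y 1 - x 1 * y 2)) *
        (x 1 * y 1 * (x 0 * y 2 - x 2 * y 0)) := by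
      rw [div_mul_eq_mul_div, eq_div_iff ha]
      linear_combination (y 0 * y 1 / 2) * q3 - (x 0 * x 1 / 2) * q4
    have f2 : B 0 1 = B 1 2 / (x 0 * y 0 * (x 2 * y 1 - x 1 * y 2)) *
        (x 2 * y 2 * (x 1 * y 0 - x 0 * y 1)) := by
      rw [div_mul_eq_mul_div, eq_div_iff ha]
      linear_combination (-(y 0 * y 2) / 2) * q3 + (x 0 * x 2 / 2) * q4
    have f3 : B 1 2 = B 1 2 / (x 0 * y 0 * (x 2 * y 1 - x 1 * y 2)) *
        (x 0 * y 0 * (x 2 * y 1 - x 1 * y 2)) := by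
      rw [div_mul_cancel₀ _ ha]
    ext i j
    fin_cases i <;> fin_cases j
    · simpa using q0
    · simpa using f2
    · simpa using f1
    · simpa [hS 1 0] using f2
    · simpa using q1
    · simpa using f3
    · simpa [hS 2 0] using f1
    · simpa [hS 2 1] using f3
    · simpa using q2
  obtain ⟨r, hr⟩ := key A hA h
  obtain ⟨r', hr'⟩ := key A' hA' h'
  have inv : ∀ A : Matrix (Fin 3) (Fin 3) ℂ, A = P⁻¹ * (P * A * Pᵀ) * Pᵀ⁻¹ := by
    intro A
    have hPt : IsUnit Pᵀ.det := by rwa [Matrix.det_transpose]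
    rw [Matrix.mul_assoc P, ← Matrix.mul_assoc P⁻¹, Matrix.nonsing_inv_mul _ hPu, Matrix.one_mul,
      Matrix.mul_assoc, Matrix.mul_nonsing_inv _ hPt, Matrix.mul_one]
  have hA0 : ∀ A : Matrix (Fin 3) (Fin 3) ℂ, IsIrreducibleConic A → P * A * Pᵀ ≠ 0 := by
    intro A hA h0
    apply hA.2
    rw [inv A, h0]
    simp
  have hr0 : r ≠ 0 := by
    rintro rfl
    exact hA0 A hA (by rw [hr, zero_smul])
  have hr0' : r' ≠ 0 := by
    rintro rfl
    exact hA0 A' hA' (by rw [hr', zero_smul])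
  refine ⟨r' / r, div_ne_zero hr0' hr0, ?_⟩
  have : P * A' * Pᵀ = (r' / r) • (P * A * Pᵀ) := by
    rw [hr, hr', smul_smul, div_mul_cancel₀ _ hr0]
  rw [inv A', this]
  simp only [Matrix.mul_smul, Matrix.smul_mul]
  rw [← inv A]

end FivePoints

section Polarity

variable {A : Matrix (Fin 3) (Fin 3) ℂ}

theorem polar_comm (hA : A.IsSymm) (x y : Fin 3 → ℂ) : x ⬝ᵥ A *ᵥ y = y ⬝ᵥ A *ᵥ x := by
  rw [Matrix.dotProduct_mulVec, ← Matrix.mulVec_transpose, hA.eq, dotProduct_comm]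

theorem exists_tangencies (hA : IsIrreducibleConic A) {c : Fin 3 → ℂ} (hc : c ⬝ᵥ A *ᵥ c ≠ 0) :
    ∃ t t' : Fin 3 → ℂ, t ≠ 0 ∧ (∀ k : ℂ, k • t' ≠ t) ∧ t' ≠ 0 ∧ t ⬝ᵥ A *ᵥ t = 0 ∧
      t' ⬝ᵥ A *ᵥ t' = 0 ∧ c ⬝ᵥ A *ᵥ t = 0 ∧ c ⬝ᵥ A *ᵥ t' = 0 := by
  have comm := polar_comm hA.1
  have nondeg : ∀ d : Fin 3 → ℂ, (∀ x : Fin 3 → ℂ, x ⬝ᵥ A *ᵥ d = 0) → d = 0 := fun d hd =>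
    Matrix.eq_zero_of_mulVec_eq_zero hA.2 (dotProduct_eq_zero _ fun x => by
      rw [dotProduct_comm]; exact hd x)
  obtain ⟨a, hca, haa⟩ : ∃ a : Fin 3 → ℂ, c ⬝ᵥ A *ᵥ a = 0 ∧ a ⬝ᵥ A *ᵥ a ≠ 0 := by
    by_contra! H
    obtain ⟨d, hd0, hd⟩ := Matrix.exists_mulVec_eq_zero_iff.2
      (show (Matrix.of ![A *ᵥ c, 0, 0]).det = 0 by simp [Matrix.det_fin_three])
    have hcd : c ⬝ᵥ A *ᵥ d = 0 := by
      rw [comm, dotProduct_comm]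
      exact congrFun hd 0
    refine hd0 (nondeg d fun x => ?_)
    set k := (c ⬝ᵥ A *ᵥ x) / (c ⬝ᵥ A *ᵥ c) with hk
    have hx : c ⬝ᵥ A *ᵥ (x - k • c) = 0 := by
      rw [Matrix.mulVec_sub, Matrix.mulVec_smul, dotProduct_sub, dotProduct_smul, smul_eq_mul, hk,
        div_mul_cancel₀ _ hc, sub_self]
    have h1 := H _ hx
    have h2 := H d hcd
    have h3 := H (x - k • c + d) (by rw [Matrix.mulVec_add, dotProduct_add, hx, hcd, add_zero])
    rw [Matrix.mulVec_add, dotProduct_add, add_dotProduct, add_dotProduct, h1, h2,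
      comm d (x - k • c)] at h3
    have h4 : (x - k • c) ⬝ᵥ A *ᵥ d = 0 := by linear_combination h3 / 2
    rw [sub_dotProduct, smul_dotProduct, hcd, smul_zero, sub_zero] at h4
    exact h4
  obtain ⟨b, hb0, hb⟩ := Matrix.exists_mulVec_eq_zero_iff.2
    (show (Matrix.of ![A *ᵥ c, A *ᵥ a, 0]).det = 0 by simp [Matrix.det_fin_three])
  have hcb : c ⬝ᵥ A *ᵥ b = 0 := by
    rw [comm, dotProduct_comm]
    exact congrFun hb 0
  have hab : a ⬝ᵥ A *ᵥ b = 0 := by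
    rw [comm, dotProduct_comm]
    exact congrFun hb 1
  have hbb : b ⬝ᵥ A *ᵥ b ≠ 0 := by
    intro hbb
    obtain ⟨u, hu0, hu⟩ := Matrix.exists_vecMul_eq_zero_iff.2
      (Matrix.exists_mulVec_eq_zero_iff.1 ⟨b, hb0, show Matrix.of ![A *ᵥ c, A *ᵥ a, A *ᵥ b] *ᵥ b = 0 by
        funext i
        fin_cases i
        · exact congrFun hb 0
        · exact congrFun hb 1
        · change (A *ᵥ b) ⬝ᵥ b = 0
          rw [dotProduct_comm, hbb]⟩)
    have hu' : A *ᵥ (u 0 • c + u 1 • a + u 2 • b) = 0 := by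
      rw [← hu]
      funext i
      simp [Matrix.mulVec_add, Matrix.mulVec_smul, Matrix.vecMul, dotProduct, Fin.sum_univ_three]
    have h1 : c ⬝ᵥ A *ᵥ (u 0 • c + u 1 • a + u 2 • b) = 0 := by rw [hu', dotProduct_zero]
    have h2 : a ⬝ᵥ A *ᵥ (u 0 • c + u 1 • a + u 2 • b) = 0 := by rw [hu', dotProduct_zero]
    have h3 := Matrix.eq_zero_of_mulVec_eq_zero hA.2 hu'
    simp only [Matrix.mulVec_add, Matrix.mulVec_smul, dotProduct_add, dotProduct_smul, hca, hcb,
      comm a c, hab, smul_eq_mul, mul_zero, add_zero, zero_add] at h1 h2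
    have e0 : u 0 = 0 := (mul_eq_zero.1 h1).resolve_right hc
    have e1 : u 1 = 0 := (mul_eq_zero.1 h2).resolve_right haa
    rw [e0, e1, zero_smul, zero_smul, zero_add, zero_add] at h3
    have e2 : u 2 = 0 := (smul_eq_zero.1 h3).resolve_right hb0
    exact hu0 (by funext i; fin_cases i <;> assumption)
  obtain ⟨s, hs⟩ := IsAlgClosed.exists_pow_nat_eq (-(a ⬝ᵥ A *ᵥ a) / (b ⬝ᵥ A *ᵥ b)) two_pos
  have hs' : s ^ 2 * (b ⬝ᵥ A *ᵥ b) = -(a ⬝ᵥ A *ᵥ a) := by rw [hs, div_mul_cancel₀ _ hbb]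
  have hs0 : s ≠ 0 := by
    rintro rfl
    exact haa (by linear_combination hs')
  have ha1 : ∀ r : ℂ, a ⬝ᵥ A *ᵥ (a + r • b) = a ⬝ᵥ A *ᵥ a := fun r => by
    rw [Matrix.mulVec_add, Matrix.mulVec_smul, dotProduct_add, dotProduct_smul, hab, smul_zero,
      add_zero]
  have hb1 : ∀ r : ℂ, b ⬝ᵥ A *ᵥ (a + r • b) = r * (b ⬝ᵥ A *ᵥ b) := fun r => by
    rw [Matrix.mulVec_add, Matrix.mulVec_smul, dotProduct_add, dotProduct_smul, comm b a, hab,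
      smul_eq_mul, zero_add]
  have ne : ∀ r : ℂ, a + r • b ≠ 0 := fun r h => haa (by rw [← ha1 r, h]; simp)
  have q : ∀ r : ℂ, r ^ 2 = s ^ 2 → (a + r • b) ⬝ᵥ A *ᵥ (a + r • b) = 0 := fun r hr => by
    rw [add_dotProduct, smul_dotProduct, ha1, hb1, smul_eq_mul]
    linear_combination hs' + (b ⬝ᵥ A *ᵥ b) * hr
  have hc1 : ∀ r : ℂ, c ⬝ᵥ A *ᵥ (a + r • b) = 0 := fun r => by
    rw [Matrix.mulVec_add, Matrix.mulVec_smul, dotProduct_add, dotProduct_smul, hca, hcb, smul_zero,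
      add_zero]
  refine ⟨a + s • b, a + (-s) • b, ne _, fun k hk => ?_, ne _, q _ rfl, q _ (by ring), hc1 _, hc1 _⟩
  have h1 := congrArg (fun x => a ⬝ᵥ A *ᵥ x) hk
  have h2 := congrArg (fun x => b ⬝ᵥ A *ᵥ x) hk
  simp only [Matrix.mulVec_smul, dotProduct_smul, ha1, hb1, smul_eq_mul] at h1 h2
  have hk1 : k = 1 := mul_right_cancel₀ haa (by rw [h1, one_mul])
  rw [hk1] at h2
  exact hs0 (mul_right_cancel₀ hbb (by linear_combination -h2 / 2))

theorem tangency_unique (hA : IsIrreducibleConic A) {c : Fin 3 → ℂ} (hc : c ⬝ᵥ A *ᵥ c ≠ 0)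
    {t₀ t₁ t : Fin 3 → ℂ} (h₀ : t₀ ≠ 0) (h₁ : t₁ ≠ 0) (h : t ≠ 0)
    (hne : Projectivization.mk ℂ t₀ h₀ ≠ .mk ℂ t₁ h₁)
    (q₀ : t₀ ⬝ᵥ A *ᵥ t₀ = 0) (q₁ : t₁ ⬝ᵥ A *ᵥ t₁ = 0) (q : t ⬝ᵥ A *ᵥ t = 0)
    (c₀ : (A *ᵥ t₀) ⬝ᵥ c = 0) (c₁ : (A *ᵥ t₁) ⬝ᵥ c = 0) (ct : (A *ᵥ t) ⬝ᵥ c = 0) :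
    Projectivization.mk ℂ t h = .mk ℂ t₀ h₀ ∨ Projectivization.mk ℂ t h = .mk ℂ t₁ h₁ := by
  have comm := polar_comm hA.1
  have hc0 : c ≠ 0 := by rintro rfl; simp at hc
  rw [dotProduct_comm, comm] at c₀ c₁ ct
  have indep : ∀ a b : ℂ, a • t₀ + b • t₁ = 0 → a = 0 ∧ b = 0 := by
    intro a b hab
    have ha : a = 0 := by
      by_contra ha
      refine hne ((Projectivization.mk_eq_mk_iff' ℂ _ _ _ _).2 ⟨-(a⁻¹ * b), ?_⟩)
      have : a⁻¹ • (a • t₀ + b • t₁) = 0 := by rw [hab, smul_zero]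
      rw [smul_add, smul_smul, smul_smul, inv_mul_cancel₀ ha, one_smul] at this
      rw [neg_smul, eq_comm]
      exact eq_neg_of_add_eq_zero_left this
    subst ha
    rw [zero_smul, zero_add] at hab
    exact ⟨rfl, (smul_eq_zero.1 hab).resolve_right h₁⟩
  have comb : ∀ x y z w : Fin 3 → ℂ, w ≠ 0 → x ⬝ᵥ w = 0 → y ⬝ᵥ w = 0 → z ⬝ᵥ w = 0 →
      ∃ u : Fin 3 → ℂ, u ≠ 0 ∧ u 0 • x + u 1 • y + u 2 • z = 0 := by
    intro x y z w hw hx hy hz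
    obtain ⟨u, hu0, hu⟩ := Matrix.exists_vecMul_eq_zero_iff.2
      (Matrix.exists_mulVec_eq_zero_iff.1 ⟨w, hw, show Matrix.of ![x, y, z] *ᵥ w = 0 by
        funext i
        fin_cases i <;> assumption⟩)
    refine ⟨u, hu0, ?_⟩
    rw [← hu]
    funext i
    simp [Matrix.vecMul, dotProduct, Fin.sum_univ_three]
  have h01 : t₀ ⬝ᵥ A *ᵥ t₁ ≠ 0 := by
    intro h01
    obtain ⟨u, hu0, hu⟩ := comb t₀ t₁ c (A *ᵥ t₀)
      (fun e => h₀ (Matrix.eq_zero_of_mulVec_eq_zero hA.2 e)) q₀ (by rw [comm, h01])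
      (by rw [comm, c₀])
    have e := congrArg (fun x => x ⬝ᵥ A *ᵥ c) hu
    simp only [add_dotProduct, smul_dotProduct, c₀, c₁, smul_eq_mul, mul_zero, zero_add,
      zero_dotProduct] at e
    have e2 : u 2 = 0 := (mul_eq_zero.1 e).resolve_right hc
    rw [e2, zero_smul, add_zero] at hu
    obtain ⟨e0, e1⟩ := indep _ _ hu
    exact hu0 (by funext i; fin_cases i <;> assumption)
  obtain ⟨u, hu0, hu⟩ := comb t t₀ t₁ (A *ᵥ c)
    (fun e => hc0 (Matrix.eq_zero_of_mulVec_eq_zero hA.2 e)) ct c₀ c₁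
  have hu1 : u 0 ≠ 0 := by
    intro e0
    rw [e0, zero_smul, zero_add] at hu
    obtain ⟨e1, e2⟩ := indep _ _ hu
    exact hu0 (by funext i; fin_cases i <;> assumption)
  have ht : t = (-(u 1) / u 0) • t₀ + (-(u 2) / u 0) • t₁ := by
    funext i
    have hi := congrFun hu i
    simp only [Pi.add_apply, Pi.smul_apply, smul_eq_mul, Pi.zero_apply] at hi ⊢
    field_simp
    linear_combination hi
  have e : (-(u 1) / u 0) * (-(u 2) / u 0) = 0 := by
    rw [ht] at q
    simp only [Matrix.mulVec_add, Matrix.mulVec_smul, dotProduct_add, dotProduct_smul,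
      add_dotProduct, smul_dotProduct, smul_eq_mul, q₀, q₁, comm t₁ t₀] at q
    refine (mul_eq_zero.1 ?_).resolve_right h01
    linear_combination q / 2
  rcases mul_eq_zero.1 e with e | e
  · right
    rw [e, zero_smul, zero_add] at ht
    exact (Projectivization.mk_eq_mk_iff' ℂ _ _ _ _).2 ⟨_, ht.symm⟩
  · left
    rw [e, zero_smul, add_zero] at ht
    exact (Projectivization.mk_eq_mk_iff' ℂ _ _ _ _).2 ⟨_, ht.symm⟩

end Polarity

theorem sixth_off_conic {m : Six → P2} (hm : IsGeneric m) {A : Matrix (Fin 3) (Fin 3) ℂ}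
    (hA : IsIrreducibleConic A) (h : ∀ i, OnConic A (m (Sum.inl i))) :
    (m (Sum.inr 0)).rep ⬝ᵥ A *ᵥ (m (Sum.inr 0)).rep ≠ 0 := by
  intro h0
  refine hm.2 ⟨A, hA.1, fun e => hA.2 (by rw [e]; simp), ?_⟩
  rintro (i | j)
  · exact h i
  · rw [Subsingleton.elim j 0, ← (m (Sum.inr 0)).mk_rep, onConic_mk]
    exact h0

/-- The tangent construction of the seven points: existence. -/
theorem exists_isProjection {m : Six → P2} (hm : IsGeneric m) :
    ∃ p A t π, IsProjection m p A t π := by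
  have hdet : ∀ i j k : Fin 5, i ≠ j → i ≠ k → j ≠ k → (Matrix.of ![(m (Sum.inl i)).rep,
      (m (Sum.inl j)).rep, (m (Sum.inl k)).rep]).det ≠ 0 := fun i j k h1 h2 h3 =>
    independent_det (hm.1 _ _ _ (by simpa using h1) (by simpa using h2) (by simpa using h3))
  obtain ⟨A, hA, hAi⟩ := exists_conic (v := fun i => (m (Sum.inl i)).rep) hdet
  have hon : ∀ i : Fin 5, OnConic A (m (Sum.inl i)) := fun i => by
    rw [← (m (Sum.inl i)).mk_rep, onConic_mk]
    exact hAi i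
  have hc := sixth_off_conic hm hA hon
  obtain ⟨t, t', ht, htt', ht', q, q', ct, ct'⟩ := exists_tangencies hA hc
  set c := (m (Sum.inr 0)).rep with hcdef
  have hc0 : c ≠ 0 := (m (Sum.inr 0)).rep_nonzero
  have hker : (m (Sum.inr 0)).submodule = ℂ ∙ c := Projectivization.submodule_eq _
  let e : ((Fin 3 → ℂ) ⧸ (ℂ ∙ c)) ≃ₗ[ℂ] (Fin 2 → ℂ) := LinearEquiv.ofFinrankEq _ _ (by
    have := Submodule.finrank_quotient_add_finrank (ℂ ∙ c)
    rw [finrank_span_singleton hc0] at this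
    simp at this ⊢
    omega)
  let π : (Fin 3 → ℂ) →ₗ[ℂ] (Fin 2 → ℂ) := e.toLinearMap ∘ₗ (ℂ ∙ c).mkQ
  have hπ : LinearMap.ker π = ℂ ∙ c := by
    rw [LinearMap.ker_comp, LinearEquiv.ker, Submodule.comap_bot, Submodule.ker_mkQ]
  have hne : ∀ v : Fin 3 → ℂ, (∀ k : ℂ, k • c ≠ v) → π v ≠ 0 := by
    intro v hv h0
    have : v ∈ LinearMap.ker π := h0
    rw [hπ, Submodule.mem_span_singleton] at this
    obtain ⟨k, hk⟩ := this
    exact hv k hk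
  have hpt : ∀ i : Fin 5, π (m (Sum.inl i)).rep ≠ 0 := by
    intro i
    refine hne _ fun k hk => ?_
    have hij : i ≠ i + 1 := by clear hk; revert i; decide
    refine independent_det (hm.1 (Sum.inl i) (Sum.inl (i + 1)) (Sum.inr 0)
      (fun e => hij (Sum.inl_injective e)) (by simp) (by simp)) ?_
    rw [← hk, Matrix.det_fin_three]
    simp [hcdef]
    ring
  have htne : ∀ s : Fin 3 → ℂ, s ≠ 0 → s ⬝ᵥ A *ᵥ s = 0 → π s ≠ 0 := by
    intro s hs hq
    refine hne _ fun k hk => ?_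
    rw [← hk, Matrix.mulVec_smul, dotProduct_smul, smul_dotProduct, smul_eq_mul, smul_eq_mul,
      ← mul_assoc] at hq
    have hkk := (mul_eq_zero.1 hq).resolve_right hc
    rw [mul_self_eq_zero] at hkk
    rw [hkk, zero_smul] at hk
    exact hs hk.symm
  have hmap : ∀ (v : Fin 3 → ℂ) (h : π v ≠ 0),
      (ℂ ∙ v).map π = (Projectivization.mk ℂ (π v) h).submodule := by
    intro v h
    rw [Projectivization.submodule_mk, Submodule.map_span, Set.image_singleton]
  refine ⟨Sum.elim (fun i => .mk ℂ _ (hpt i)) ![.mk ℂ _ (htne t ht q), .mk ℂ _ (htne t' ht' q')], A,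
    ![.mk ℂ t ht, .mk ℂ t' ht'], π, hA, hon, ?_, ?_, ?_, by rw [hπ, hker], ?_, ?_⟩
  · intro h
    obtain ⟨k, hk⟩ := (Projectivization.mk_eq_mk_iff' ℂ _ _ _ _).1 h
    exact htt' k hk
  · intro j
    fin_cases j
    · exact (onConic_mk ht).2 q
    · exact (onConic_mk ht').2 q'
  · intro j
    rw [← (m (Sum.inr 0)).mk_rep]
    fin_cases j
    · exact (tangent_mk hA.2 ht hc0).2 (by rw [dotProduct_comm, ct])
    · exact (tangent_mk hA.2 ht' hc0).2 (by rw [dotProduct_comm, ct'])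
  · intro i
    rw [Projectivization.submodule_eq (m (Sum.inl i))]
    exact hmap _ (hpt i)
  · intro j
    fin_cases j
    · exact (congrArg _ (Projectivization.submodule_mk t ht)).trans (hmap _ (htne t ht q))
    · exact (congrArg _ (Projectivization.submodule_mk t' ht')).trans (hmap _ (htne t' ht' q'))

open Classical in
theorem IsProjection.isStable {m : Six → P2} (hm : IsGeneric m) {p A t π}
    (h : IsProjection m p A t π) : IsStable weight2511 p := by
  have hinj : ∀ i j : Fin 5, p (Sum.inl i) = p (Sum.inl j) → i = j := by
    intro i j hij
    by_contra hne
    have h1 : (m (Sum.inl i)).submodule.map π = (m (Sum.inl j)).submodule.map π := by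
      rw [h.map_point, h.map_point, hij]
    have h2 : π (m (Sum.inl i)).rep ∈ (m (Sum.inl j)).submodule.map π := by
      rw [← h1, Projectivization.submodule_eq (m (Sum.inl i))]
      exact Submodule.mem_map_of_mem (Submodule.mem_span_singleton_self _)
    obtain ⟨w, hw, hw2⟩ := h2
    rw [Projectivization.submodule_eq (m (Sum.inl j))] at hw
    obtain ⟨a, rfl⟩ := Submodule.mem_span_singleton.1 hw
    have h3 : (m (Sum.inl i)).rep - a • (m (Sum.inl j)).rep ∈ LinearMap.ker π := by
      rw [LinearMap.mem_ker, map_sub, hw2, sub_self]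
    rw [h.ker_eq, Projectivization.submodule_eq (m (Sum.inr 0)),
      Submodule.mem_span_singleton] at h3
    obtain ⟨b, hb⟩ := h3
    refine independent_det (hm.1 (Sum.inl i) (Sum.inl j) (Sum.inr 0) (by simpa using hne)
      (by simp) (by simp)) ?_
    rw [show (m (Sum.inl i)).rep = a • (m (Sum.inl j)).rep + b • (m (Sum.inr 0)).rep by
      rw [hb]; abel, Matrix.det_fin_three]
    simp
    ring
  intro x
  rw [Finset.sum_filter, Fintype.sum_sum_type, Fintype.sum_sum_type, Fin.sum_univ_two,
    Fin.sum_univ_two]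
  have h5 : (∑ i : Fin 5, if p (Sum.inl i) = x then 2 else 0) ≤ 2 := by
    rw [← Finset.sum_filter, Finset.sum_const, smul_eq_mul]
    have : (Finset.univ.filter fun i : Fin 5 => p (Sum.inl i) = x).card ≤ 1 := by
      refine Finset.card_le_one.2 fun a ha b hb => hinj a b ?_
      rw [(Finset.mem_filter.1 ha).2, (Finset.mem_filter.1 hb).2]
    omega
  change 2 * ((∑ i : Fin 5, if p (Sum.inl i) = x then 2 else 0) +
    ((if p (Sum.inr 0) = x then 1 else 0) + (if p (Sum.inr 1) = x then 1 else 0))) <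
    ∑ _ : Fin 5, 2 + (1 + 1)
  have h6 : ∑ _ : Fin 5, 2 = 10 := by simp
  split_ifs <;> omega

/-- Two linear projections of the plane from the same point differ by an element of `SL₂(ℂ)`, up to
a scalar. -/
theorem exists_sl_of_ker_eq {c : P2} {π π' : (Fin 3 → ℂ) →ₗ[ℂ] (Fin 2 → ℂ)}
    (h : LinearMap.ker π = c.submodule) (h' : LinearMap.ker π' = c.submodule) :
    ∃ g : Matrix.SpecialLinearGroup (Fin 2) ℂ, ∀ (x : P2) (p p' : P1),
      x.submodule.map π = p.submodule → x.submodule.map π' = p'.submodule → p' = g • p := by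
  have surj : ∀ ρ : (Fin 3 → ℂ) →ₗ[ℂ] (Fin 2 → ℂ), LinearMap.ker ρ = c.submodule →
      LinearMap.range ρ = ⊤ := by
    intro ρ hρ
    apply Submodule.eq_top_of_finrank_eq
    have := LinearMap.finrank_range_add_finrank_ker ρ
    rw [hρ, c.finrank_submodule] at this
    simp at this ⊢
    omega
  obtain ⟨s, hs⟩ := LinearMap.exists_rightInverse_of_surjective π (surj π h)
  have hs' : ∀ w, π (s w) = w := fun w => LinearMap.congr_fun hs w
  have hf : ∀ v, π' (s (π v)) = π' v := by
    intro v
    have : s (π v) - v ∈ LinearMap.ker π := by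
      rw [LinearMap.mem_ker, map_sub, hs', sub_self]
    rw [h, ← h', LinearMap.mem_ker, map_sub, sub_eq_zero] at this
    exact this
  have hinj : ∀ w, π' (s w) = 0 → w = 0 := by
    intro w hw
    have : s w ∈ LinearMap.ker π' := hw
    rw [h', ← h, LinearMap.mem_ker, hs'] at this
    exact this
  set M := LinearMap.toMatrix' (π' ∘ₗ s) with hM
  have hMv : ∀ w, M *ᵥ w = π' (s w) := fun w => by
    rw [hM, LinearMap.toMatrix'_mulVec, LinearMap.comp_apply]
  have hdet : M.det ≠ 0 := by
    intro h0
    obtain ⟨w, hw0, hw⟩ := Matrix.exists_mulVec_eq_zero_iff.2 h0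
    exact hw0 (hinj w (by rw [← hMv, hw]))
  obtain ⟨r, hr⟩ := IsAlgClosed.exists_pow_nat_eq (M.det)⁻¹ two_pos
  have hr0 : r ≠ 0 := by
    rintro rfl
    rw [zero_pow two_ne_zero, eq_comm, inv_eq_zero] at hr
    exact hdet hr
  obtain ⟨g, hg⟩ : ∃ g : Matrix.SpecialLinearGroup (Fin 2) ℂ, g.1 = r • M :=
    ⟨⟨r • M, by rw [Matrix.det_smul, Fintype.card_fin, hr, inv_mul_cancel₀ hdet]⟩, rfl⟩
  refine ⟨g, ?_⟩
  intro x p p' hp hp'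
  apply Projectivization.submodule_injective
  induction p using Projectivization.ind with | h u hu =>
  rw [Projectivization.smul_mk, Projectivization.submodule_mk, ← hp']
  have e : x.submodule.map π' = (x.submodule.map π).map (π' ∘ₗ s) := by
    rw [← Submodule.map_comp]
    have e' : π' = (π' ∘ₗ s) ∘ₗ π := LinearMap.ext fun v => (hf v).symm
    rw [← e']
  rw [e, hp, Projectivization.submodule_mk, Submodule.map_span, Set.image_singleton]
  have e2 : g • u = r • (π' ∘ₗ s) u := by
    change g.1 *ᵥ u = _
    rw [hg, Matrix.smul_mulVec, hMv]
    rfl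
  rw [e2]
  exact (Submodule.span_singleton_smul_eq (isUnit_iff_ne_zero.2 hr0) _).symm

/-- The tangent construction of the seven points: uniqueness. -/
theorem IsProjection.unique {m : Six → P2} (hm : IsGeneric m) {p p' A A' t t' π π'}
    (h : IsProjection m p A t π) (h' : IsProjection m p' A' t' π') :
    DMZ2.mk (DM.mk _ ⟨p, h.isStable hm⟩) = DMZ2.mk (DM.mk _ ⟨p', h'.isStable hm⟩) := by
  have hdet : ∀ i j k : Fin 5, i ≠ j → i ≠ k → j ≠ k → (Matrix.of ![(m (Sum.inl i)).rep,
      (m (Sum.inl j)).rep, (m (Sum.inl k)).rep]).det ≠ 0 := fun i j k h1 h2 h3 =>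
    independent_det (hm.1 _ _ _ (by simpa using h1) (by simpa using h2) (by simpa using h3))
  have rep : ∀ {B x}, OnConic B x → x.rep ⬝ᵥ B *ᵥ x.rep = 0 := fun {B x} hx => by
    rw [← x.mk_rep, onConic_mk] at hx
    exact hx
  have tang : ∀ {B x}, B.det ≠ 0 → (∃ l, IsTangentLine B x l ∧ l.orthogonal (m (Sum.inr 0))) →
      (B *ᵥ x.rep) ⬝ᵥ (m (Sum.inr 0)).rep = 0 := fun {B x} hB hx => by
    rw [← x.mk_rep, ← (m (Sum.inr 0)).mk_rep, tangent_mk hB] at hx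
    exact hx
  obtain ⟨s, hs0, hs⟩ := conic_unique (v := fun i => (m (Sum.inl i)).rep) hdet h.conic h'.conic
    (fun i => rep (h.onConic i)) (fun i => rep (h'.onConic i))
  have hc := sixth_off_conic hm h.conic h.onConic
  have ht : ∀ j, t' j = t 0 ∨ t' j = t 1 := by
    intro j
    have q := rep (h'.tangency_onConic j)
    have c := tang h'.conic.2 (h'.tangency j)
    rw [hs, Matrix.smul_mulVec] at q c
    rw [dotProduct_smul, smul_eq_mul] at q
    rw [smul_dotProduct, smul_eq_mul] at c
    have := tangency_unique h.conic hc (t 0).rep_nonzero (t 1).rep_nonzero (t' j).rep_nonzero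
      (by simpa only [Projectivization.mk_rep] using h.tangency_ne)
      (rep (h.tangency_onConic 0)) (rep (h.tangency_onConic 1))
      ((mul_eq_zero.1 q).resolve_left hs0) (tang h.conic.2 (h.tangency 0))
      (tang h.conic.2 (h.tangency 1)) ((mul_eq_zero.1 c).resolve_left hs0)
    simpa only [Projectivization.mk_rep] using this
  obtain ⟨g, hg⟩ := exists_sl_of_ker_eq h.ker_eq h'.ker_eq
  have hp : ∀ i, p' (Sum.inl i) = g • p (Sum.inl i) := fun i =>
    hg _ _ _ (h.map_point i) (h'.map_point i)
  have hne := h'.tangency_ne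
  refine Quotient.sound ?_
  rcases ht 0 with e0 | e0 <;> rcases ht 1 with e1 | e1
  · exact absurd (e0.trans e1.symm) hne
  · left
    refine (Quotient.sound ⟨g, ?_⟩ : DM.mk _ _ = DM.mk _ _).symm
    rintro (i | j)
    · exact hp i
    · fin_cases j
      · exact hg _ _ _ (h.map_tangency 0) (e0 ▸ h'.map_tangency 0)
      · exact hg _ _ _ (h.map_tangency 1) (e1 ▸ h'.map_tangency 1)
  · right
    refine (Quotient.sound ⟨g, ?_⟩ : DM.mk _ _ = DM.mk _ _).symm
    rintro (i | j)
    · exact hp i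
    · fin_cases j
      · exact hg _ _ _ (h.map_tangency 1) (e0 ▸ h'.map_tangency 0)
      · exact hg _ _ _ (h.map_tangency 0) (e1 ▸ h'.map_tangency 1)
  · exact absurd (e0.trans e1.symm) hne

theorem mulVec_mem_smul (g : Matrix.SpecialLinearGroup (Fin 3) ℂ) (x : P2) {v : Fin 3 → ℂ}
    (hv : v ∈ x.submodule) : g.1 *ᵥ v ∈ (g • x).submodule := by
  induction x using Projectivization.ind with | h u hu =>
  rw [Projectivization.smul_mk, Projectivization.submodule_mk]
  rw [Projectivization.submodule_mk, Submodule.mem_span_singleton] at hv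
  obtain ⟨a, rfl⟩ := hv
  rw [Matrix.mulVec_smul]
  exact Submodule.smul_mem _ _ (Submodule.mem_span_singleton_self _)

theorem submodule_smul (g : Matrix.SpecialLinearGroup (Fin 3) ℂ) (x : P2) :
    (g • x).submodule = x.submodule.map (Matrix.mulVecLin g.1) := by
  induction x using Projectivization.ind with | h u hu =>
  rw [Projectivization.smul_mk, Projectivization.submodule_mk, Projectivization.submodule_mk,
    Submodule.map_span, Set.image_singleton]
  rfl

theorem OnConic.of_smul {g : Matrix.SpecialLinearGroup (Fin 3) ℂ} {A x} (h : OnConic A (g • x)) :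
    OnConic (g.1ᵀ * A * g.1) x := by
  intro v hv
  have := h _ (mulVec_mem_smul g x hv)
  rw [← Matrix.mulVec_mulVec, ← Matrix.mulVec_mulVec, Matrix.mulVec_transpose,
    dotProduct_comm v, ← Matrix.dotProduct_mulVec, dotProduct_comm]
  rw [dotProduct_comm] at this
  first
  | exact this
  | (rw [dotProduct_comm]; exact this)

theorem IsIrreducibleConic.of_smul {g : Matrix.SpecialLinearGroup (Fin 3) ℂ} {A}
    (h : IsIrreducibleConic A) : IsIrreducibleConic (g.1ᵀ * A * g.1) := by
  refine ⟨?_, ?_⟩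
  · simp only [Matrix.IsSymm, Matrix.transpose_mul, Matrix.transpose_transpose, h.1.eq,
      Matrix.mul_assoc]
  · rw [Matrix.det_mul, Matrix.det_mul, Matrix.det_transpose, g.2, one_mul, mul_one]
    exact h.2

/-- The tangent construction of the seven points: invariance under `SL₃(ℂ)`. -/
theorem IsProjection.of_smul {g : Matrix.SpecialLinearGroup (Fin 3) ℂ} {m : Six → P2} {p A t π}
    (h : IsProjection (fun i => g • m i) p A t π) :
    IsProjection m p (g.1ᵀ * A * g.1) (fun j => g⁻¹ • t j) (π ∘ₗ Matrix.mulVecLin g.1) where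
  conic := h.conic.of_smul
  onConic i := (h.onConic i).of_smul
  tangency_ne e := h.tangency_ne (smul_left_cancel _ e)
  tangency_onConic j := OnConic.of_smul (by rw [smul_inv_smul]; exact h.tangency_onConic j)
  tangency j := by
    have hj := h.tangency j
    obtain ⟨x, hx⟩ : ∃ x, x = g⁻¹ • t j := ⟨_, rfl⟩
    rw [← hx]
    rw [show t j = g • x by rw [hx, smul_inv_smul]] at hj
    generalize m (Sum.inr 0) = c at hj ⊢
    induction x using Projectivization.ind with | h v hv =>
    induction c using Projectivization.ind with | h w hw =>
    rw [Projectivization.smul_mk, Projectivization.smul_mk, tangent_mk h.conic.2] at hj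
    refine (tangent_mk h.conic.of_smul.2 hv hw).2 ?_
    have hj' : (A *ᵥ (g.1 *ᵥ v)) ⬝ᵥ (g.1 *ᵥ w) = 0 := hj
    rw [← Matrix.mulVec_mulVec, ← Matrix.mulVec_mulVec, Matrix.mulVec_transpose,
      ← Matrix.dotProduct_mulVec]
    exact hj'
  ker_eq := by
    ext v
    have h1 : v ∈ LinearMap.ker (π ∘ₗ Matrix.mulVecLin g.1) ↔
        g.1 *ᵥ v ∈ (g • m (Sum.inr 0)).submodule := by
      rw [← h.ker_eq]
      rfl
    rw [h1]
    refine ⟨fun hv => ?_, mulVec_mem_smul g _⟩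
    have := mulVec_mem_smul g⁻¹ _ hv
    rw [inv_smul_smul, Matrix.mulVec_mulVec, ← Matrix.SpecialLinearGroup.coe_mul, inv_mul_cancel,
      Matrix.SpecialLinearGroup.coe_one, Matrix.one_mulVec] at this
    exact this
  map_point i := by
    rw [Submodule.map_comp, ← submodule_smul]
    exact h.map_point i
  map_tangency j := by
    rw [Submodule.map_comp, ← submodule_smul, smul_inv_smul]
    exact h.map_tangency j

/-- Two generic configurations are equivalent if an element of `SL₃(ℂ)` takes one to the other. -/
def planeSetoid : Setoid {m : Six → P2 // IsGeneric m} where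
  r m m' := ∃ g : Matrix.SpecialLinearGroup (Fin 3) ℂ, ∀ i, m'.1 i = g • m.1 i
  iseqv :=
    { refl := fun m => ⟨1, fun i => (one_smul _ _).symm⟩
      symm := fun ⟨g, hg⟩ => ⟨g⁻¹, fun i => by rw [hg i, inv_smul_smul]⟩
      trans := fun ⟨g, hg⟩ ⟨h, hh⟩ => ⟨h * g, fun i => by rw [hh i, hg i, mul_smul]⟩ }

/-- The moduli space of smooth marked cubic surfaces: generic configurations of six points in the
plane modulo `SL₃(ℂ)`. -/
def MSm := Quotient planeSetoid

/-- The configuration of seven points on the line obtained from a generic configuration of six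
points in the plane, as a point of `DM_{ℤ/2}(2⁵,1²)`. -/
noncomputable def sevenPoints (m : {m : Six → P2 // IsGeneric m}) : DMZ2 :=
  DMZ2.mk (DM.mk weight2511 ⟨(exists_isProjection m.2).choose,
    (exists_isProjection m.2).choose_spec.choose_spec.choose_spec.choose_spec.isStable m.2⟩)

theorem sevenPoints_eq (m : {m : Six → P2 // IsGeneric m}) {p A t π}
    (h : IsProjection m.1 p A t π) :
    sevenPoints m = DMZ2.mk (DM.mk weight2511 ⟨p, h.isStable m.2⟩) :=
  IsProjection.unique m.2
    (exists_isProjection m.2).choose_spec.choose_spec.choose_spec.choose_spec h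

/-- The map `φ⁶₇ : M^sm → DM_{ℤ/2}(2⁵,1²)`, sending the class of six generic points to the class of
the seven points obtained from them by projection. -/
noncomputable def phi67 : MSm → DMZ2 :=
  Quotient.lift sevenPoints fun m m' ⟨g, hg⟩ => by
    obtain ⟨p, A, t, π, h⟩ := exists_isProjection m'.2
    rw [sevenPoints_eq m' h]
    rw [show m'.1 = fun i => g • m.1 i from funext hg] at h
    exact sevenPoints_eq m h.of_smul

/-! ### Configurations with infinitely near points -/

/-- Unordered pairs of distinct labels. -/
abbrev Pair := {e : Sym2 Six // ¬ e.IsDiag}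

/-- Six points in the plane, and for every pair of them a line (given by its coordinates). -/
abbrev Config := Six ⊕ Pair → P2

/-- The six points of a configuration. -/
def Config.points (c : Config) : Six → P2 := fun i => c (Sum.inl i)

/-- The line belonging to a pair of points of a configuration. -/
def Config.line (c : Config) : Pair → P2 := fun e => c (Sum.inr e)

/-- The line belonging to a pair passes through both points. So it is the line joining them if they
are distinct; if they coincide it is a tangent direction at this point, which makes one of the
points infinitely near to the other. Away from triple coincidences, these configurations form the
blow-up of `(ℙ²)⁶` along all the diagonals `m i = m j`. -/
def Config.IsIncident (c : Config) : Prop :=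
  ∀ e : Pair, ∀ i ∈ e.1, (c.line e).orthogonal (c.points i)

/-- The locus `Δ_Q`: the six points lie on an irreducible conic, at most two of them coincide at any
place, and points that coincide are infinitely near along the conic. -/
def Config.IsDeltaQ (c : Config) : Prop :=
  c.IsIncident ∧
  (∀ i j k, i ≠ j → i ≠ k → j ≠ k → ¬ (c.points i = c.points j ∧ c.points i = c.points k)) ∧
  ∃ A : Matrix (Fin 3) (Fin 3) ℂ, IsIrreducibleConic A ∧ (∀ i, OnConic A (c.points i)) ∧
    ∀ e : Pair, (∀ i ∈ e.1, ∀ j ∈ e.1, c.points i = c.points j) →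
      ∀ i ∈ e.1, IsTangentLine A (c.points i) (c.line e)

/-- The configuration is generic or belongs to `Δ_Q`. -/
def Config.IsExtended (c : Config) : Prop :=
  (c.IsIncident ∧ IsGeneric c.points) ∨ c.IsDeltaQ

/-- The action of `SL₃(ℂ)` on points and lines in the plane. -/
noncomputable def Config.act (g : Matrix.SpecialLinearGroup (Fin 3) ℂ) (c : Config) : Config :=
  Sum.elim (fun i => g • c.points i) (fun e => (g⁻¹).transpose • c.line e)

theorem Config.act_one (c : Config) : c.act 1 = c := by
  have h : ((1 : Matrix.SpecialLinearGroup (Fin 3) ℂ)⁻¹).transpose = 1 := by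
    apply Subtype.ext
    rw [inv_one, Matrix.SpecialLinearGroup.coe_transpose, Matrix.SpecialLinearGroup.coe_one,
      Matrix.transpose_one]
  funext x
  rcases x with i | e
  · exact one_smul _ _
  · change (1⁻¹ : Matrix.SpecialLinearGroup (Fin 3) ℂ).transpose • c.line e = c.line e
    rw [h, one_smul]

theorem Config.act_mul (g h : Matrix.SpecialLinearGroup (Fin 3) ℂ) (c : Config) :
    c.act (g * h) = (c.act h).act g := by
  have e' : ((g * h)⁻¹).transpose = (g⁻¹).transpose * (h⁻¹).transpose := by
    apply Subtype.ext
    rw [mul_inv_rev, Matrix.SpecialLinearGroup.coe_mul, Matrix.SpecialLinearGroup.coe_transpose,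
      Matrix.SpecialLinearGroup.coe_transpose, Matrix.SpecialLinearGroup.coe_transpose,
      Matrix.SpecialLinearGroup.coe_mul, Matrix.transpose_mul]
  funext x
  rcases x with i | e
  · exact mul_smul _ _ _
  · change ((g * h)⁻¹).transpose • c.line e = (g⁻¹).transpose • (h⁻¹).transpose • c.line e
    rw [e', mul_smul]

/-- Two configurations are equivalent if an element of `SL₃(ℂ)` takes one to the other. -/
def configSetoid (S : Config → Prop) : Setoid {c : Config // S c} where
  r c c' := ∃ g, c'.1 = c.1.act g
  iseqv :=
    { refl := fun c => ⟨1, c.1.act_one.symm⟩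
      symm := fun ⟨g, hg⟩ => ⟨g⁻¹, by rw [hg, ← Config.act_mul, inv_mul_cancel, Config.act_one]⟩
      trans := fun ⟨g, hg⟩ ⟨h, hh⟩ => ⟨h * g, by rw [hh, hg, Config.act_mul]⟩ }

/-- The moduli space of the configurations with the property `S`, modulo `SL₃(ℂ)`. -/
def ConfigModuli (S : Config → Prop) := Quotient (configSetoid S)

/-- The moduli space of the configurations with the property `S` as a variety: the quotient by
`SL₃(ℂ)` of a subspace of a product of projective planes. -/
noncomputable def ConfigModuli.space (S : Config → Prop) : FunctionSpace (ConfigModuli S) :=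
  ((multiProjectiveSpace (Six ⊕ Pair) (Fin 3)).induced
    (Subtype.val : {c : Config // S c} → Config)).coinduced (Quotient.mk (configSetoid S))

/-- The locus `Δ_Q`, modulo `SL₃(ℂ)`. -/
abbrev DeltaQ := ConfigModuli Config.IsDeltaQ

/-- The union of `M^sm` and `Δ_Q`. -/
abbrev ExtendedModuli := ConfigModuli Config.IsExtended

/-- The inclusion of `Δ_Q` in the union of `M^sm` and `Δ_Q`. -/
def DeltaQ.incl : DeltaQ → ExtendedModuli :=
  Quotient.map (sa := configSetoid _) (sb := configSetoid _) (fun c => ⟨c.1, Or.inr c.2⟩)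
    fun _ _ h => h

/-- The lines joining the points of a generic configuration. -/
noncomputable def joins (m : Six → P2) : Pair → P2 := fun e =>
  Sym2.lift ⟨fun i j => Projectivization.cross (m i) (m j),
    fun _ _ => Projectivization.cross_comm _ _⟩ e.1

theorem IsGeneric.ne {m : Six → P2} (hm : IsGeneric m) {i j : Six} (hij : i ≠ j) :
    m i ≠ m j := by
  intro h
  obtain ⟨k, hk, hk'⟩ : ∃ k : Six, i ≠ k ∧ j ≠ k := by clear h; revert i j; decide
  refine independent_det (hm.1 i j k hij hk hk') ?_
  rw [h, Matrix.det_fin_three]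
  simp
  ring

theorem joins_incident {m : Six → P2} (hm : IsGeneric m) :
    Config.IsIncident (Sum.elim m (joins m)) := by
  rintro ⟨e, he⟩ i hi
  induction e using Sym2.inductionOn with | hf a b =>
  rw [Sym2.mk_isDiag_iff] at he
  rcases Sym2.mem_iff.1 hi with rfl | rfl
  · exact Projectivization.cross_orthogonal_left (hm.ne he)
  · exact Projectivization.cross_orthogonal_right (hm.ne he)

theorem cross_smul (g : Matrix.SpecialLinearGroup (Fin 3) ℂ) {x y : P2} (h : x ≠ y) :
    Projectivization.cross (g • x) (g • y) =
      (g⁻¹).transpose • Projectivization.cross x y := by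
  have h' : g • x ≠ g • y := fun e => h (smul_left_cancel _ e)
  induction x using Projectivization.ind with | h v hv =>
  induction y using Projectivization.ind with | h w hw =>
  rw [Projectivization.smul_mk, Projectivization.smul_mk] at h' ⊢
  rw [Projectivization.cross_mk_of_ne _ _ h, Projectivization.cross_mk_of_ne _ _ h',
    Projectivization.smul_mk, Projectivization.mk_eq_mk_iff']
  refine ⟨1, ?_⟩
  rw [one_smul]
  have key : g.1ᵀ *ᵥ (crossProduct (g.1 *ᵥ v) (g.1 *ᵥ w)) = g.1.det • crossProduct v w := by
    rw [Matrix.det_fin_three]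
    ext i
    fin_cases i <;>
    · simp [cross_apply, Matrix.mulVec, dotProduct, Fin.sum_univ_three]
      ring
  rw [g.2, one_smul] at key
  change (g⁻¹).transpose.1 *ᵥ crossProduct v w = crossProduct (g.1 *ᵥ v) (g.1 *ᵥ w)
  rw [← key, Matrix.mulVec_mulVec, Matrix.SpecialLinearGroup.coe_transpose, ← Matrix.transpose_mul,
    ← Matrix.SpecialLinearGroup.coe_mul, mul_inv_cancel, Matrix.SpecialLinearGroup.coe_one,
    Matrix.transpose_one, Matrix.one_mulVec]

/-- The inclusion of `M^sm` in the union of `M^sm` and `Δ_Q`. -/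
noncomputable def MSm.incl : MSm → ExtendedModuli :=
  Quotient.map (sa := planeSetoid) (sb := configSetoid _)
    (fun m => ⟨Sum.elim m.1 (joins m.1), Or.inl ⟨joins_incident m.2, m.2⟩⟩) fun m m' ⟨g, hg⟩ => by
      refine ⟨g, funext fun x => ?_⟩
      rcases x with i | ⟨e, he⟩
      · exact hg i
      · induction e using Sym2.inductionOn with | hf a b =>
        rw [Sym2.mk_isDiag_iff] at he
        change Projectivization.cross (m'.1 a) (m'.1 b) =
          (g⁻¹).transpose • Projectivization.cross (m.1 a) (m.1 b)
        rw [hg, hg, cross_smul g (m.2.ne he)]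

/-! ### The action of the symmetric group -/

/-- The action of a permutation of labels on pairs of labels. -/
def permPair (τ : Equiv.Perm Six) (e : Pair) : Pair :=
  ⟨e.1.map τ, fun h => e.2 ((Sym2.isDiag_map τ.injective).1 h)⟩

/-- The configuration relabelled by `τ`. -/
def Config.relabel (τ : Equiv.Perm Six) (c : Config) : Config :=
  Sum.elim (fun i => c.points (τ i)) (fun e => c.line (permPair τ e))

theorem IsGeneric.relabel {m : Six → P2} (hm : IsGeneric m) (τ : Equiv.Perm Six) :
    IsGeneric fun i => m (τ i) := by
  refine ⟨fun i j k h1 h2 h3 => hm.1 _ _ _ (τ.injective.ne h1) (τ.injective.ne h2)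
    (τ.injective.ne h3), fun ⟨A, hA, hA0, h⟩ => hm.2 ⟨A, hA, hA0, fun i => ?_⟩⟩
  rw [← τ.apply_symm_apply i]
  exact h _

theorem Config.IsIncident.relabel {c : Config} (h : c.IsIncident) (τ : Equiv.Perm Six) :
    (c.relabel τ).IsIncident :=
  fun e i hi => h (permPair τ e) (τ i) (Sym2.mem_map.2 ⟨i, hi, rfl⟩)

theorem Config.IsDeltaQ.relabel {c : Config} (h : c.IsDeltaQ) (τ : Equiv.Perm Six) :
    (c.relabel τ).IsDeltaQ := by
  obtain ⟨h1, h2, A, hA, h3, h4⟩ := h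
  refine ⟨h1.relabel τ, fun i j k e1 e2 e3 => h2 _ _ _ (τ.injective.ne e1) (τ.injective.ne e2)
    (τ.injective.ne e3), A, hA, fun i => h3 _, fun e he i hi => ?_⟩
  refine h4 (permPair τ e) ?_ (τ i) (Sym2.mem_map.2 ⟨i, hi, rfl⟩)
  intro a ha b hb
  obtain ⟨a', ha', rfl⟩ := Sym2.mem_map.1 ha
  obtain ⟨b', hb', rfl⟩ := Sym2.mem_map.1 hb
  exact he a' ha' b' hb'

theorem Config.IsExtended.relabel {c : Config} (h : c.IsExtended) (τ : Equiv.Perm Six) :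
    (c.relabel τ).IsExtended :=
  h.imp (fun h => ⟨h.1.relabel τ, h.2.relabel τ⟩) fun h => h.relabel τ

/-- The action of `S₅` on the union of `M^sm` and `Δ_Q` permuting the first five points. -/
noncomputable def ExtendedModuli.perm (σ : Equiv.Perm (Fin 5)) : ExtendedModuli → ExtendedModuli :=
  Quotient.map (sa := configSetoid _) (sb := configSetoid _)
    (fun c => ⟨c.1.relabel (permSix σ)⁻¹, c.2.relabel _⟩) fun c c' ⟨g, hg⟩ => ⟨g, by
      change c'.1.relabel _ = (c.1.relabel _).act g
      rw [hg]
      funext x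
      rcases x with i | e <;> rfl⟩

end SixPoints

/-!
All spaces in the statement are quotients of spaces of tuples of vectors
(`multiProjectiveSpace_induced`, `DM.space_eq`, `ConfigModuli.space_eq`), so morphisms can be
checked on local lifts to vectors with regular coordinates (`FunctionSpace.isMorphismOn_coinduced`).

*The extension.* Let the points `m i` and lines `ℓ i j` be generic or in `Δ_Q`. There is a unique
irreducible conic `A` through the first five points that is tangent to `ℓ i j` where `m i` and `m j`
coincide (`IsFiveConic.eq_smul`: restricted to a parametrized conic, another quadratic form is a
quartic polynomial with five roots). In the pencil of lines through the sixth point, the five lines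
joining it with the other points are the `ℓ i 6`, and the two tangents to the conic are the zeros of
the quadratic form `y ↦ A(m₆, m₆) A(y, y) - A(m₆, y)²`. These seven points of the pencil
(`IsTangentProjection`) define the extension. For a generic configuration they are those in the
definition of `phi67`. On `Δ_Q` the quadratic form is the negative of a square, so the last two
points coincide with the tangent at `m₆`; since projection from a point of a conic parametrizes the
conic, the seven points are then the parameters of the six points on the conic, the sixth taken
twice (`IsTangentProjection.ofVec_eq_descend`).

*It is a morphism.* The conditions on `A` can be written as linear equations whose coefficients are
polynomial in the configuration, also where points coincide (`IsSecantConic`). By uniqueness their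
solution is locally a regular function (`exists_regular_conic`). The two tangents are then the roots
of a quadratic equation with regular coefficients. The roots themselves need not be regular, but
their unordered pair is a morphism to the quotient by `ℤ/2` (`DMZ2.isMorphism_of_roots`), because
functions on the target can be averaged over the two roots.

*Embeddings.* `descend` is an embedding since locally it has a retraction: the pair of the last two
points is replaced by the harmonic conjugate of one of the others with respect to it
(`descend_isEmb`). Regarding the line as a conic gives a surjective morphism `DM.toDeltaQ` from
`DM(2⁶)` to `Δ_Q`, whose composite with the extension is `descend`. So the restriction of the
extension to `Δ_Q` is an embedding with the same image as `descend`
(`FunctionSpace.IsEmb.of_comp`).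
-/

namespace SixPoints

/-! ### Spaces with functions -/

namespace FunctionSpace

variable {X Y Z : Type*}

theorem ext_of_iff {S T : FunctionSpace X} (h : ∀ U : Set X, IsOpen[S.top] U ↔ IsOpen[T.top] U)
    (h' : ∀ U f, S.IsRegular U f ↔ T.IsRegular U f) : S = T := by
  have h1 : S.top = T.top := TopologicalSpace.ext_iff.2 h
  have h2 : S.IsRegular = T.IsRegular := funext fun U => funext fun f => propext (h' U f)
  cases S
  cases T
  cases h1
  cases h2
  rfl

theorem isOpen_of_forall (S : FunctionSpace X) {U : Set X}
    (h : ∀ x ∈ U, ∃ V : Set X, IsOpen[S.top] V ∧ x ∈ V ∧ V ⊆ U) : IsOpen[S.top] U :=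
  (@isOpen_iff_forall_mem_open X S.top U).2 fun x hx =>
    let ⟨V, h1, h2, h3⟩ := h x hx
    ⟨V, h3, h1, h2⟩

theorem isOpen_inter (S : FunctionSpace X) {U V : Set X} (hU : IsOpen[S.top] U)
    (hV : IsOpen[S.top] V) : IsOpen[S.top] (U ∩ V) := S.top.isOpen_inter _ _ hU hV

theorem isOpen_univ (S : FunctionSpace X) : IsOpen[S.top] (Set.univ : Set X) := S.top.isOpen_univ

theorem regular_sum (S : FunctionSpace X) {ι : Type*} (s : Finset ι) {U : Set X}
    {f : ι → X → ℂ} (h : ∀ i ∈ s, S.IsRegular U (f i)) :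
    S.IsRegular U fun x => ∑ i ∈ s, f i x := by
  classical
  induction s using Finset.induction_on with
  | empty => simpa using S.regular_const U 0
  | insert a s ha ih =>
    simp only [Finset.sum_insert ha]
    exact S.regular_add _ _ _ (h a (Finset.mem_insert_self _ _))
      (ih fun i hi => h i (Finset.mem_insert_of_mem hi))

theorem regular_prod (S : FunctionSpace X) {ι : Type*} (s : Finset ι) {U : Set X}
    {f : ι → X → ℂ} (h : ∀ i ∈ s, S.IsRegular U (f i)) :
    S.IsRegular U fun x => ∏ i ∈ s, f i x := by
  classical
  induction s using Finset.induction_on with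
  | empty => simpa using S.regular_const U 1
  | insert a s ha ih =>
    simp only [Finset.prod_insert ha]
    exact S.regular_mul _ _ _ (h a (Finset.mem_insert_self _ _))
      (ih fun i hi => h i (Finset.mem_insert_of_mem hi))

theorem regular_neg (S : FunctionSpace X) {U : Set X} {f : X → ℂ} (h : S.IsRegular U f) :
    S.IsRegular U fun x => -f x := by
  simpa using S.regular_mul U _ _ (S.regular_const U (-1)) h

theorem regular_sub (S : FunctionSpace X) {U : Set X} {f g : X → ℂ} (h : S.IsRegular U f)
    (h' : S.IsRegular U g) : S.IsRegular U fun x => f x - g x := by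
  simpa [sub_eq_add_neg] using S.regular_add U _ _ h (S.regular_neg h')

theorem regular_eval (S : FunctionSpace X) {ι : Type*} {U : Set X} {F : X → ι → ℂ}
    (h : ∀ i, S.IsRegular U fun x => F x i) (p : MvPolynomial ι ℂ) :
    S.IsRegular U fun x => MvPolynomial.eval (F x) p := by
  induction p using MvPolynomial.induction_on with
  | C a => simpa using S.regular_const U a
  | add p q hp hq => simpa using S.regular_add U _ _ hp hq
  | mul_X p i hp => simpa using S.regular_mul U _ _ hp (h i)

theorem regular_det (S : FunctionSpace X) {ι : Type*} [Fintype ι] [DecidableEq ι] {U : Set X}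
    {M : X → Matrix ι ι ℂ} (h : ∀ i j, S.IsRegular U fun x => M x i j) :
    S.IsRegular U fun x => (M x).det := by
  simp only [Matrix.det_apply']
  exact S.regular_sum _ fun σ _ => S.regular_mul _ _ _ (S.regular_const _ _)
    (S.regular_prod _ fun i _ => h _ _)

/-- Regular functions can be inverted where they do not vanish, and do not vanish on open sets. -/
structure IsLocal (S : FunctionSpace X) : Prop where
  inv : ∀ (U : Set X) (f : X → ℂ), S.IsRegular U f → (∀ x ∈ U, f x ≠ 0) →
    S.IsRegular U fun x => (f x)⁻¹
  isOpen_ne : ∀ (U : Set X) (f : X → ℂ), IsOpen[S.top] U → S.IsRegular U f →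
    IsOpen[S.top] (U ∩ {x | f x ≠ 0})

theorem IsLocal.div {S : FunctionSpace X} (hS : S.IsLocal) {U : Set X} {f g : X → ℂ}
    (hf : S.IsRegular U f) (hg : S.IsRegular U g) (h : ∀ x ∈ U, g x ≠ 0) :
    S.IsRegular U fun x => f x / g x := by
  simpa [div_eq_mul_inv] using S.regular_mul U _ _ hf (hS.inv _ _ hg h)

theorem isLocal_affineSpace (ι : Type*) : (affineSpace ι).IsLocal where
  inv U f hf h0 := fun x hx => by
    obtain ⟨g, h, hh, e⟩ := hf x hx
    refine ⟨h * h, g * h, ?_, fun y hy hyg => ?_⟩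
    · have := h0 x hx
      rw [e x hx hh] at this
      rw [map_mul]
      exact mul_ne_zero (fun h0 => this (by rw [h0, zero_div])) hh
    · rw [map_mul] at hyg
      change (f y)⁻¹ = _
      rw [e y hy (right_ne_zero_of_mul hyg), inv_div, map_mul, map_mul,
        mul_div_mul_right _ _ (right_ne_zero_of_mul hyg)]
  isOpen_ne U f hU hf := by
    rintro x ⟨hx, hx0⟩
    obtain ⟨g, h, hh, e⟩ := hf x hx
    obtain ⟨k, hk, hkU⟩ := hU x hx
    refine ⟨g * h * k, ?_, fun y hy => ?_⟩
    · change f x ≠ 0 at hx0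
      rw [e x hx hh] at hx0
      rw [map_mul, map_mul]
      exact mul_ne_zero (mul_ne_zero (fun h0 => hx0 (by rw [h0, zero_div])) hh) hk
    · rw [map_mul, map_mul] at hy
      have hyU := hkU y (right_ne_zero_of_mul hy)
      have h1 := left_ne_zero_of_mul hy
      refine ⟨hyU, ?_⟩
      change f y ≠ 0
      rw [e y hyU (right_ne_zero_of_mul h1)]
      exact div_ne_zero (left_ne_zero_of_mul h1) (right_ne_zero_of_mul h1)

theorem IsLocal.induced {T : FunctionSpace Y} (hT : T.IsLocal) (f : X → Y) :
    (T.induced f).IsLocal where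
  inv U g hg h0 := fun x hx => by
    obtain ⟨V, h, hV, hxV, hh, e⟩ := hg x hx
    have hn : h (f x) ≠ 0 := by rw [← e x hx hxV]; exact h0 x hx
    exact ⟨V ∩ {y | h y ≠ 0}, fun y => (h y)⁻¹, hT.isOpen_ne _ _ hV hh, ⟨hxV, hn⟩,
      hT.inv _ _ (T.regular_restrict _ _ _ Set.inter_subset_left hh) fun y hy => hy.2,
      fun y hy hyV => congrArg _ (e y hy hyV.1)⟩
  isOpen_ne U g hU hg := by
    refine isOpen_of_forall _ ?_
    rintro x ⟨hx, hx0⟩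
    obtain ⟨V, h, hV, hxV, hh, e⟩ := hg x hx
    obtain ⟨W, hW, rfl⟩ := hU
    refine ⟨f ⁻¹' (W ∩ (V ∩ {y | h y ≠ 0})),
      ⟨_, T.isOpen_inter hW (hT.isOpen_ne _ _ hV hh), rfl⟩, ⟨hx, hxV, ?_⟩, ?_⟩
    · change h (f x) ≠ 0
      rw [← e x hx hxV]
      exact hx0
    · rintro y ⟨hyW, hyV, hy0⟩
      refine ⟨hyW, ?_⟩
      change g y ≠ 0
      rw [e y hyW hyV]
      exact hy0

theorem isMorphism_coinduced_iff {S : FunctionSpace X} {T : FunctionSpace Z} {q : X → Y}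
    {f : Y → Z} : (S.coinduced q).IsMorphism T f ↔ S.IsMorphism T (f ∘ q) := Iff.rfl

/-- A map that restricts to a morphism on the open set `O`; its values elsewhere are irrelevant. -/
def IsMorphismOn (S : FunctionSpace X) (O : Set X) (T : FunctionSpace Y) (f : X → Y) : Prop :=
  (∀ V : Set Y, IsOpen[T.top] V → IsOpen[S.top] (O ∩ f ⁻¹' V)) ∧
  ∀ (V : Set Y) (h : Y → ℂ), IsOpen[T.top] V → T.IsRegular V h →
    S.IsRegular (O ∩ f ⁻¹' V) (h ∘ f)

theorem IsMorphismOn.isMorphism {S : FunctionSpace X} {T : FunctionSpace Y} {f : X → Y}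
    (h : S.IsMorphismOn Set.univ T f) : S.IsMorphism T f := by
  simpa only [IsMorphismOn, IsMorphism, Set.univ_inter] using h

/-- A map to a subquotient of affine space is a morphism if it locally lifts to a map to affine
space with regular coordinates. -/
theorem isMorphismOn_coinduced {S : FunctionSpace X} (hS : S.IsLocal) {κ : Type*}
    {s : Type*} {j : s → κ → ℂ} {q : s → Y} {f : X → Y} {O : Set X}
    (h : ∀ x ∈ O, ∃ (U : Set X) (F : X → κ → ℂ), IsOpen[S.top] U ∧ x ∈ U ∧ U ⊆ O ∧
      (∀ k, S.IsRegular U fun x => F x k) ∧ ∀ y ∈ U, ∃ w : s, j w = F y ∧ q w = f y) :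
    S.IsMorphismOn O (((affineSpace κ).induced j).coinduced q) f := by
  constructor
  · rintro V ⟨W, hW, hWV⟩
    refine isOpen_of_forall _ ?_
    rintro x ⟨hx, hxV⟩
    obtain ⟨U, F, hU, hxU, hUO, hF, hl⟩ := h x hx
    have key : ∀ y ∈ U, f y ∈ V ↔ F y ∈ W := by
      intro y hy
      obtain ⟨w, hw, hw'⟩ := hl y hy
      rw [← hw, ← hw']
      change w ∈ q ⁻¹' V ↔ w ∈ j ⁻¹' W
      rw [hWV]
    obtain ⟨k, hk, hkW⟩ := hW _ ((key x hxU).1 hxV)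
    refine ⟨_, hS.isOpen_ne U _ hU (S.regular_eval hF k), ⟨hxU, hk⟩, ?_⟩
    rintro y ⟨hyU, hyk⟩
    exact ⟨hUO hyU, (key y hyU).2 (hkW _ hyk)⟩
  · rintro V g ⟨W, hW, hWV⟩ hg
    refine S.regular_glue _ _ ?_
    rintro x ⟨hx, hxV⟩
    obtain ⟨U, F, hU, hxU, hUO, hF, hl⟩ := h x hx
    obtain ⟨w, hw, hw'⟩ := hl x hxU
    obtain ⟨V', g', hV', hxV', hg', e⟩ := hg w (by change q w ∈ V; rw [hw']; exact hxV)
    obtain ⟨a, b, hb, e'⟩ := hg' _ hxV'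
    obtain ⟨k, hk, hkV'⟩ := hV' _ hxV'
    rw [hw] at hb hk
    refine ⟨U ∩ {y | MvPolynomial.eval (F y) (b * k) ≠ 0},
      hS.isOpen_ne U _ hU (S.regular_eval hF _), ⟨hxU, ?_⟩, ?_⟩
    · rw [Set.mem_ofPred_eq, map_mul]
      exact mul_ne_zero hb hk
    · refine S.regular_congr _ (fun y => MvPolynomial.eval (F y) a / MvPolynomial.eval (F y) b) _ ?_
        (hS.div (S.regular_restrict _ _ _ (fun y hy => hy.2.1) (S.regular_eval hF a))
          (S.regular_restrict _ _ _ (fun y hy => hy.2.1) (S.regular_eval hF b)) fun y hy => ?_)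
      · rintro y ⟨⟨hyO, hyV⟩, hyU, hyk⟩
        rw [Set.mem_ofPred_eq, map_mul] at hyk
        obtain ⟨w', h1, h2⟩ := hl y hyU
        have hwV : j w' ∈ V' := hkV' _ (by rw [h1]; exact right_ne_zero_of_mul hyk)
        have h3 := e w' (by change q w' ∈ V; rw [h2]; exact hyV) hwV
        have h4 := e' _ hwV (by rw [h1]; exact left_ne_zero_of_mul hyk)
        rw [h1] at h3 h4
        rw [← h4, ← h3, Function.comp_apply, Function.comp_apply, h2]
      · have := hy.2.2
        rw [Set.mem_ofPred_eq, map_mul] at this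
        exact left_ne_zero_of_mul this

theorem affineSpace_eq (κ : Type*) :
    affineSpace κ = ((affineSpace κ).induced id).coinduced id := by
  refine ext_of_iff (fun U => ?_) fun U f => ⟨fun h x hx => ?_, fun h => ?_⟩
  · refine ⟨fun h => ⟨U, h, rfl⟩, ?_⟩
    rintro ⟨V, hV, e⟩
    rwa [show U = V from e.symm]
  · obtain ⟨g, k, hk, e⟩ := h x hx
    refine ⟨{y | MvPolynomial.eval y k ≠ 0},
      fun y => MvPolynomial.eval y g / MvPolynomial.eval y k, fun y hy => ⟨k, hy, fun _ h => h⟩, hk,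
      fun y hy => ⟨g, k, hy, fun _ _ _ => rfl⟩, fun y hy hyk => e y hy hyk⟩
  · refine regular_glue _ _ _ fun x hx => ?_
    obtain ⟨V, k, hV, hxV, hk, e⟩ := h x hx
    exact ⟨V, hV, hxV, (affineSpace κ).regular_congr _ _ _ (fun y hy => (e y hy.1 hy.2).symm)
      ((affineSpace κ).regular_restrict _ _ _ Set.inter_subset_right hk)⟩

theorem isMorphismOn_affineSpace {S : FunctionSpace X} (hS : S.IsLocal) {κ : Type*}
    {O : Set X} (hO : IsOpen[S.top] O) {F : X → κ → ℂ} (hF : ∀ k, S.IsRegular O fun x => F x k) :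
    S.IsMorphismOn O (affineSpace κ) F := by
  rw [affineSpace_eq]
  exact isMorphismOn_coinduced hS fun x hx => ⟨O, F, hO, hx, subset_rfl, hF, fun y _ => ⟨_, rfl, rfl⟩⟩

theorem regular_coord {κ : Type*} (U : Set (κ → ℂ)) (k : κ) :
    (affineSpace κ).IsRegular U fun x => x k :=
  fun _ _ => ⟨MvPolynomial.X k, 1, by simp, by simp⟩

theorem regular_coord_induced {κ : Type*} (j : X → κ → ℂ) (U : Set X) (k : κ) :
    ((affineSpace κ).induced j).IsRegular U fun x => j x k :=
  fun _ _ => ⟨Set.univ, fun y => y k, isOpen_univ _, trivial, regular_coord _ k, fun _ _ _ => rfl⟩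

/-- An embedding: an injective morphism such that, locally on the source, open sets and regular
functions come from the target. -/
structure IsEmb (S : FunctionSpace X) (T : FunctionSpace Y) (f : X → Y) : Prop where
  inj : Function.Injective f
  mor : S.IsMorphism T f
  isOpen : ∀ V : Set X, IsOpen[S.top] V → ∃ U : Set Y, IsOpen[T.top] U ∧ f ⁻¹' U = V
  regular : ∀ (V : Set X) (h : X → ℂ), IsOpen[S.top] V → S.IsRegular V h → ∀ x ∈ V,
    ∃ (U : Set Y) (k : Y → ℂ), IsOpen[T.top] U ∧ f x ∈ U ∧ T.IsRegular U k ∧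
      ∀ y ∈ V, f y ∈ U → h y = k (f y)

theorem IsEmb.isIsomorphismOntoImage {S : FunctionSpace X} {T : FunctionSpace Y} {f : X → Y}
    (h : S.IsEmb T f) : S.IsIsomorphismOntoImage T f := by
  have hsymm : ∀ x, (Equiv.ofInjective f h.inj).symm ⟨f x, x, rfl⟩ = x := fun x =>
    Equiv.ofInjective_symm_apply h.inj x
  refine ⟨Equiv.ofInjective f h.inj, fun x => rfl, ⟨?_, ?_⟩, ?_, ?_⟩
  · rintro V ⟨W, hW, rfl⟩
    exact h.mor.1 W hW
  · rintro V g ⟨W, hW, rfl⟩ hg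
    refine S.regular_glue _ _ fun x hx => ?_
    obtain ⟨U, k, hU, hxU, hk, e⟩ := hg _ hx
    refine ⟨f ⁻¹' U, h.mor.1 U hU, hxU, ?_⟩
    refine S.regular_congr _ (k ∘ f) _ ?_
      (S.regular_restrict _ _ _ Set.inter_subset_right (h.mor.2 U k hU hk))
    rintro y ⟨hy, hyU⟩
    exact (e _ hy hyU).symm
  · intro V hV
    obtain ⟨U, hU, e⟩ := h.isOpen V hV
    refine ⟨U, hU, ?_⟩
    ext ⟨_, x, rfl⟩
    change f x ∈ U ↔ (Equiv.ofInjective f h.inj).symm ⟨f x, x, rfl⟩ ∈ V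
    rw [hsymm, ← e]
    rfl
  · rintro V g hV hg ⟨_, x, rfl⟩ hx
    have hx' : x ∈ V := by
      have : (Equiv.ofInjective f h.inj).symm ⟨f x, x, rfl⟩ ∈ V := hx
      rwa [hsymm] at this
    obtain ⟨U, k, hU, hxU, hk, e⟩ := h.regular V g hV hg x hx'
    refine ⟨U, k, hU, hxU, hk, ?_⟩
    rintro ⟨_, y, rfl⟩ hy hyU
    have hy' : (Equiv.ofInjective f h.inj).symm ⟨f y, y, rfl⟩ ∈ V := hy
    rw [hsymm] at hy'
    rw [Function.comp_apply, hsymm]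
    exact e y hy' hyU

/-- An injective morphism is an embedding if it has local retractions. -/
theorem isEmb_of_retraction {S : FunctionSpace X} {T : FunctionSpace Y} {f : X → Y}
    (mor : S.IsMorphism T f)
    (h : ∀ x, ∃ (O : Set Y) (r : Y → X), IsOpen[T.top] O ∧ f x ∈ O ∧ T.IsMorphismOn O S r ∧
      ∀ y, f y ∈ O → r (f y) = y) : S.IsEmb T f where
  inj x y e := by
    obtain ⟨O, r, _, hx, _, hr⟩ := h x
    rw [← hr x hx, e, hr y (e ▸ hx)]
  mor := mor
  isOpen V hV := by
    choose O r hO hx hm hr using h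
    refine ⟨⋃ x, O x ∩ r x ⁻¹' V, @isOpen_iUnion _ _ T.top _ fun x => (hm x).1 V hV, ?_⟩
    ext y
    simp only [Set.mem_preimage, Set.mem_iUnion, Set.mem_inter_iff]
    constructor
    · rintro ⟨x, h1, h2⟩
      rwa [hr x y h1] at h2
    · intro hy
      exact ⟨y, hx y, by rwa [hr y y (hx y)]⟩
  regular V g hV hg x hx := by
    obtain ⟨O, r, hO, hxO, hm, hr⟩ := h x
    refine ⟨O ∩ r ⁻¹' V, g ∘ r, hm.1 V hV, ⟨hxO, by rw [Set.mem_preimage, hr x hxO]; exact hx⟩,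
      hm.2 V g hV hg, fun y _ hyO => ?_⟩
    rw [Function.comp_apply, hr y hyO.1]

/-- If `f ∘ e` is an embedding and `e` is a surjective morphism, then the morphism `f` is an
embedding. -/
theorem IsEmb.of_comp {S : FunctionSpace X} {S' : FunctionSpace Y} {T : FunctionSpace Z}
    {e : X → Y} {f : Y → Z} (h : S.IsEmb T (f ∘ e)) (he : S.IsMorphism S' e)
    (hs : Function.Surjective e) (hf : S'.IsMorphism T f) : S'.IsEmb T f where
  inj := by
    intro y y' hy
    obtain ⟨x, rfl⟩ := hs y
    obtain ⟨x', rfl⟩ := hs y'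
    rw [h.inj hy]
  mor := hf
  isOpen V hV := by
    obtain ⟨U, hU, hUV⟩ := h.isOpen _ (he.1 V hV)
    refine ⟨U, hU, hs.preimage_injective ?_⟩
    rw [← hUV]
    rfl
  regular V g hV hg y hy := by
    obtain ⟨x, rfl⟩ := hs y
    obtain ⟨U, k, hU, hxU, hk, h'⟩ := h.regular _ _ (he.1 V hV) (he.2 V g hV hg) x hy
    refine ⟨U, k, hU, hxU, hk, fun z hz hzU => ?_⟩
    obtain ⟨w, rfl⟩ := hs z
    exact h' w hz hzU

end FunctionSpace

/-! ### Subspaces of products of projective spaces -/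

section MultiProjective

variable {ι κ : Type*}

/-- The tuples of nonzero vectors that span tuples of points with the property `p`. -/
abbrev VecTuple (p : (ι → ℙ ℂ (κ → ℂ)) → Prop) :=
  {v : ι × κ → ℂ // ∃ h : ∀ i, (fun k => v (i, k)) ≠ 0, p (spanPoints ι κ ⟨v, h⟩)}

/-- The tuple of points spanned by a tuple of vectors. -/
noncomputable def VecTuple.span {p : (ι → ℙ ℂ (κ → ℂ)) → Prop} (v : VecTuple p) : {x // p x} :=
  ⟨spanPoints ι κ ⟨v.1, v.2.1⟩, v.2.2⟩

theorem spanPoints_eq_iff {v w : {v : ι × κ → ℂ // ∀ i, (fun k => v (i, k)) ≠ 0}} :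
    spanPoints ι κ v = spanPoints ι κ w ↔
      ∃ t : ι → ℂ, (∀ i, t i ≠ 0) ∧ ∀ i k, w.1 (i, k) = t i * v.1 (i, k) := by
  constructor
  · intro h
    have h' : ∀ i, ∃ a : ℂˣ, a • (fun k => v.1 (i, k)) = fun k => w.1 (i, k) := fun i =>
      (Projectivization.mk_eq_mk_iff ℂ _ _ (w.2 i) (v.2 i)).1 (congrFun h i).symm
    choose a ha using h'
    exact ⟨fun i => a i, fun i => (a i).ne_zero, fun i k => (congrFun (ha i) k).symm⟩
  · rintro ⟨t, ht, h⟩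
    funext i
    refine ((Projectivization.mk_eq_mk_iff' ℂ _ _ (w.2 i) (v.2 i)).2 ⟨t i, ?_⟩).symm
    funext k
    exact (h i k).symm

/-- The representative of a tuple of points whose coordinates with the given labels are `1`. -/
noncomputable def chart (c : ι → κ) (x : ι → ℙ ℂ (κ → ℂ)) : ι × κ → ℂ :=
  fun e => (x e.1).rep e.2 / (x e.1).rep (c e.1)

theorem chart_spanPoints (c : ι → κ) (v : {v : ι × κ → ℂ // ∀ i, (fun k => v (i, k)) ≠ 0}) :
    chart c (spanPoints ι κ v) = fun e => v.1 e / v.1 (e.1, c e.1) := by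
  funext ⟨i, k⟩
  obtain ⟨a, ha⟩ := Projectivization.exists_smul_eq_mk_rep ℂ _ (v.2 i)
  have h : ∀ k, (spanPoints ι κ v i).rep k = a * v.1 (i, k) := fun k => (congrFun ha k).symm
  rw [chart, h, h, mul_div_mul_left _ _ a.ne_zero]

theorem rep_ne_zero_iff (c : ι → κ) (v : {v : ι × κ → ℂ // ∀ i, (fun k => v (i, k)) ≠ 0}) (i : ι) :
    (spanPoints ι κ v i).rep (c i) ≠ 0 ↔ v.1 (i, c i) ≠ 0 := by
  obtain ⟨a, ha⟩ := Projectivization.exists_smul_eq_mk_rep ℂ _ (v.2 i)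
  rw [show (spanPoints ι κ v i).rep (c i) = a * v.1 (i, c i) from (congrFun ha _).symm]
  simp

/-- A subspace of a product of projective spaces is the quotient of the corresponding space of
tuples of vectors: the map to the projective spaces is open and has local sections, so passing to
subspaces commutes with passing to the quotient. -/
theorem multiProjectiveSpace_induced [Fintype ι] (p : (ι → ℙ ℂ (κ → ℂ)) → Prop) :
    (multiProjectiveSpace ι κ).induced (Subtype.val : {x // p x} → _) =
      ((affineSpace (ι × κ)).induced (Subtype.val : VecTuple p → _)).coinduced VecTuple.span := by
  refine FunctionSpace.ext_of_iff (fun U => ⟨?_, ?_⟩) fun U f => ⟨fun hf => ?_, fun hf => ?_⟩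
  · rintro ⟨V, ⟨O, hO, hOV⟩, rfl⟩
    refine ⟨O, hO, ?_⟩
    ext v
    exact Set.ext_iff.1 hOV ⟨v.1, v.2.1⟩
  · rintro ⟨O, hO, hOU⟩
    refine ⟨{x | ∃ v : {v : ι × κ → ℂ // ∀ i, (fun k => v (i, k)) ≠ 0}, v.1 ∈ O ∧
      spanPoints ι κ v = x}, ⟨{v | ∃ t : ι → ℂ, (∀ i, t i ≠ 0) ∧
        (fun e => t e.1 * v e) ∈ O}, ?_, ?_⟩, ?_⟩
    · rintro v ⟨t, ht, hv⟩
      obtain ⟨k, hk, hkO⟩ := hO _ hv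
      have e : ∀ w : ι × κ → ℂ, MvPolynomial.eval w
          (MvPolynomial.bind₁ (fun e : ι × κ => MvPolynomial.C (t e.1) * MvPolynomial.X e) k) =
          MvPolynomial.eval (fun e => t e.1 * w e) k := by
        intro w
        clear hk hkO
        induction k using MvPolynomial.induction_on with
        | C a => simp
        | add p q hp hq => rw [map_add, map_add, hp, hq, map_add]
        | mul_X p i hp => rw [map_mul, map_mul, hp, map_mul]; simp
      exact ⟨_, by rw [e]; exact hk, fun w hw => ⟨t, ht, hkO _ (by rw [← e]; exact hw)⟩⟩
    · ext v
      constructor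
      · rintro ⟨t, ht, hv⟩
        have h0 : ∀ i, (fun k => t i * v.1 (i, k)) ≠ 0 := fun i h => v.2 i (by
          funext k
          exact (mul_eq_zero.1 (congrFun h k)).resolve_left (ht i))
        exact ⟨⟨_, h0⟩, hv, (spanPoints_eq_iff.2 ⟨t, ht, fun _ _ => rfl⟩).symm⟩
      · rintro ⟨w, hw, e⟩
        obtain ⟨t, ht, h⟩ := spanPoints_eq_iff.1 e.symm
        refine ⟨t, ht, ?_⟩
        rwa [show (fun e => t e.1 * v.1 e) = w.1 from funext fun ⟨i, k⟩ => (h i k).symm]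
    · ext ⟨x, hx⟩
      constructor
      · rintro ⟨v, hv, rfl⟩
        exact (Set.ext_iff.1 hOU ⟨v.1, v.2, hx⟩).1 hv
      · intro hxU
        obtain ⟨v, hv⟩ : ∃ v, spanPoints ι κ v = x :=
          ⟨⟨fun e => (x e.1).rep e.2, fun i => (x i).rep_nonzero⟩,
            funext fun i => (x i).mk_rep⟩
        subst hv
        exact ⟨v, (Set.ext_iff.1 hOU ⟨v.1, v.2, hx⟩).2 hxU, rfl⟩
  · intro v hv
    obtain ⟨V, h, ⟨O, hO, hOV⟩, hvV, hh, e⟩ := hf _ hv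
    obtain ⟨W, k, hW, hvW, hk, e'⟩ := hh ⟨v.1, v.2.1⟩ hvV
    refine ⟨W ∩ O, k, (affineSpace _).isOpen_inter hW hO,
      ⟨hvW, (Set.ext_iff.1 hOV ⟨v.1, v.2.1⟩).2 hvV⟩,
      (affineSpace _).regular_restrict _ _ _ Set.inter_subset_left hk, fun w hw hwW => ?_⟩
    have hwV := (Set.ext_iff.1 hOV ⟨w.1, w.2.1⟩).1 hwW.2
    exact (e (VecTuple.span w) hw hwV).trans (e' ⟨w.1, w.2.1⟩ hwV hwW.1)
  · rintro ⟨x, hx⟩ hxU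
    have hc : ∀ i, ∃ k, (x i).rep k ≠ 0 := fun i => Function.ne_iff.1 (x i).rep_nonzero
    choose c hc using hc
    -- The representative normalized in the chart at `x`.
    have hn : ∀ y : ι → ℙ ℂ (κ → ℂ), (∀ i, (y i).rep (c i) ≠ 0) →
        ∃ h : ∀ i, (fun k => chart c y (i, k)) ≠ 0, spanPoints ι κ ⟨chart c y, h⟩ = y := by
      intro y hy
      have h : ∀ i, (fun k => chart c y (i, k)) ≠ 0 := fun i h => by
        have := congrFun h (c i)
        simp [chart, div_self (hy i)] at this
      refine ⟨h, funext fun i => ?_⟩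
      rw [← (y i).mk_rep]
      refine (Projectivization.mk_eq_mk_iff' ℂ _ _ (h i) (y i).rep_nonzero).2
        ⟨((y i).rep (c i))⁻¹, ?_⟩
      funext k
      simp [chart, div_eq_inv_mul]
    obtain ⟨h0, h1⟩ := hn x hc
    obtain ⟨W, k, hW, hxW, hk, e⟩ := hf ⟨chart c x, h0, h1.symm ▸ hx⟩ (by
      change (⟨spanPoints ι κ ⟨chart c x, h0⟩, _⟩ : {x // p x}) ∈ U
      simpa only [h1] using hxU)
    have hD : IsOpen[(affineSpace (ι × κ)).top] {v | (∏ i, v (i, c i)) ≠ 0} := by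
      have := (FunctionSpace.isLocal_affineSpace (ι × κ)).isOpen_ne Set.univ
        (fun v => ∏ i, v (i, c i)) (FunctionSpace.isOpen_univ _)
        (FunctionSpace.regular_prod _ _ fun i _ => FunctionSpace.regular_coord _ _)
      rwa [Set.univ_inter] at this
    have hm : (affineSpace (ι × κ)).IsMorphismOn {v | (∏ i, v (i, c i)) ≠ 0} (affineSpace (ι × κ))
        fun v e => v e / v (e.1, c e.1) :=
      FunctionSpace.isMorphismOn_affineSpace (FunctionSpace.isLocal_affineSpace _) hD fun e =>
        (FunctionSpace.isLocal_affineSpace _).div (FunctionSpace.regular_coord _ _)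
          (FunctionSpace.regular_coord _ _) fun v hv =>
            Finset.prod_ne_zero_iff.1 hv e.1 (Finset.mem_univ _)
    have hpre : ∀ v : {v : ι × κ → ℂ // ∀ i, (fun k => v (i, k)) ≠ 0},
        v.1 ∈ {v | (∏ i, v (i, c i)) ≠ 0} ∩ (fun v e => v e / v (e.1, c e.1)) ⁻¹' W ↔
        spanPoints ι κ v ∈ {y | (∀ i, (y i).rep (c i) ≠ 0) ∧ chart c y ∈ W} := by
      intro v
      have := chart_spanPoints c v
      simp only [Set.mem_inter_iff, Set.mem_ofPred_eq, Set.mem_preimage, Finset.prod_ne_zero_iff,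
        Finset.mem_univ, true_implies, rep_ne_zero_iff, this]
    refine ⟨{y | (∀ i, (y i).rep (c i) ≠ 0) ∧ chart c y ∈ W}, k ∘ chart c,
      ⟨_, hm.1 W hW, Set.ext hpre⟩, ⟨hc, hxW⟩, ?_, ?_⟩
    · intro v hv
      refine ⟨_, _, hm.1 W hW, (hpre v).2 hv, hm.2 W k hW hk, fun w hw hwW => ?_⟩
      rw [Function.comp_apply, Function.comp_apply, chart_spanPoints]
      rfl
    · rintro ⟨y, hy⟩ hyU ⟨hyc, hyW⟩
      obtain ⟨h2, h3⟩ := hn y hyc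
      have := e ⟨chart c y, h2, h3.symm ▸ hy⟩ (by
        change (⟨spanPoints ι κ ⟨chart c y, h2⟩, _⟩ : {x // p x}) ∈ U
        simpa only [h3] using hyU) hyW
      refine Eq.trans ?_ this
      change f _ = f ⟨spanPoints ι κ ⟨chart c y, h2⟩, _⟩
      simp only [h3]

end MultiProjective

/-! ### Vectors representing stable configurations on the line -/

/-- The determinant of two vectors in the plane. It vanishes if and only if they are
proportional. -/
def bracket (u v : Fin 2 → ℂ) : ℂ := u 0 * v 1 - u 1 * v 0

theorem bracket_self (u : Fin 2 → ℂ) : bracket u u = 0 := by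
  simp [bracket, mul_comm]

theorem mk_eq_mk_iff_bracket {u v : Fin 2 → ℂ} (hu : u ≠ 0) (hv : v ≠ 0) :
    Projectivization.mk ℂ u hu = .mk ℂ v hv ↔ bracket u v = 0 := by
  rw [Projectivization.mk_eq_mk_iff']
  constructor
  · rintro ⟨a, rfl⟩
    simp [bracket]
    ring
  · intro h
    have h' : u 0 * v 1 = u 1 * v 0 := sub_eq_zero.1 h
    by_cases h0 : v 0 = 0
    · have h1 : v 1 ≠ 0 := fun h1 => hv (by funext i; fin_cases i <;> assumption)
      have hu0 : u 0 = 0 := by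
        rw [h0, mul_zero] at h'
        exact (mul_eq_zero.1 h').resolve_right h1
      refine ⟨u 1 / v 1, ?_⟩
      funext i
      fin_cases i
      · simp [h0, hu0]
      · simp [div_mul_cancel₀ _ h1]
    · refine ⟨u 0 / v 0, ?_⟩
      funext i
      fin_cases i
      · simp [div_mul_cancel₀ _ h0]
      · simp only [Pi.smul_apply, smul_eq_mul, Fin.mk_one]
        rw [div_mul_eq_mul_div, h', mul_div_cancel_right₀ _ h0]

/-- An invertible matrix acts on the projective line like an element of `SL₂(ℂ)`. -/
theorem exists_sl_smul_mk {G : Matrix (Fin 2) (Fin 2) ℂ} (hG : G.det ≠ 0) :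
    ∃ g : Matrix.SpecialLinearGroup (Fin 2) ℂ, ∀ (u v : Fin 2 → ℂ) (hu : u ≠ 0) (hv : v ≠ 0),
      bracket v (G *ᵥ u) = 0 → Projectivization.mk ℂ v hv = g • Projectivization.mk ℂ u hu := by
  obtain ⟨r, hr⟩ := IsAlgClosed.exists_pow_nat_eq (G.det)⁻¹ two_pos
  obtain ⟨g, hg⟩ : ∃ g : Matrix.SpecialLinearGroup (Fin 2) ℂ, g.1 = r • G :=
    ⟨⟨r • G, by rw [Matrix.det_smul, Fintype.card_fin, hr, inv_mul_cancel₀ hG]⟩, rfl⟩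
  refine ⟨g, ?_⟩
  intro u v hu hv h
  rw [Projectivization.smul_mk, mk_eq_mk_iff_bracket]
  change bracket v (g.1 *ᵥ u) = 0
  rw [hg, Matrix.smul_mulVec]
  simp only [bracket, Pi.smul_apply, smul_eq_mul] at h ⊢
  linear_combination r * h

section

variable {ι : Type*} [Fintype ι] {μ : ι → ℕ}

open Classical in
theorem IsStable.of_imp {p q : ι → P1} (hp : IsStable μ p) (h : ∀ i j, q i = q j → p i = p j) :
    IsStable μ q := by
  intro x
  by_cases hx : ∃ i, q i = x
  · obtain ⟨i, rfl⟩ := hx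
    refine lt_of_le_of_lt (Nat.mul_le_mul_left 2 ?_) (hp (p i))
    refine Finset.sum_le_sum_of_subset fun j hj => ?_
    rw [Finset.mem_filter] at hj ⊢
    exact ⟨hj.1, h _ _ hj.2⟩
  · have : ∑ i with q i = x, μ i = 0 := Finset.sum_eq_zero fun i hi =>
      absurd ⟨i, (Finset.mem_filter.1 hi).2⟩ hx
    rw [this]
    exact lt_of_le_of_lt (Nat.zero_le _) (hp x)

/-- The class in `DM(μ)` of the configuration represented by a tuple of vectors. -/
noncomputable def DM.ofVec (μ : ι → ℕ) (v : VecTuple (κ := Fin 2) (IsStable μ)) : DM μ :=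
  DM.mk μ (VecTuple.span v)

theorem DM.space_eq (μ : ι → ℕ) :
    DM.space μ = ((affineSpace (ι × Fin 2)).induced Subtype.val).coinduced (DM.ofVec μ) := by
  rw [DM.space, multiProjectiveSpace_induced]
  rfl

theorem DM.ofVec_surjective (μ : ι → ℕ) : Function.Surjective (DM.ofVec μ) := by
  intro x
  induction x using Quotient.inductionOn with
  | h p =>
    have e : spanPoints ι (Fin 2) ⟨fun e => (p.1 e.1).rep e.2, fun i => (p.1 i).rep_nonzero⟩ = p.1 :=
      funext fun i => (p.1 i).mk_rep
    exact ⟨⟨_, fun i => (p.1 i).rep_nonzero, e.symm ▸ p.2⟩, congrArg (DM.mk μ) (Subtype.ext e)⟩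

/-- Tuples of vectors that are proportional to each other up to an invertible matrix represent the
same point of `DM(μ)`. -/
theorem DM.ofVec_eq {w : ι × Fin 2 → ℂ} (hw : ∃ h, IsStable μ (spanPoints ι (Fin 2) ⟨w, h⟩))
    {v : ι × Fin 2 → ℂ} (hv : ∀ i, (fun k => v (i, k)) ≠ 0) {G : Matrix (Fin 2) (Fin 2) ℂ}
    (hG : G.det ≠ 0) (h : ∀ i, bracket (fun k => v (i, k)) (G *ᵥ fun k => w (i, k)) = 0) :
    ∃ h' : ∃ h, IsStable μ (spanPoints ι (Fin 2) ⟨v, h⟩),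
      DM.ofVec μ ⟨v, h'⟩ = DM.ofVec μ ⟨w, hw⟩ := by
  obtain ⟨g, hg⟩ := exists_sl_smul_mk hG
  have e : ∀ i, spanPoints ι (Fin 2) ⟨v, hv⟩ i = g • spanPoints ι (Fin 2) ⟨w, hw.1⟩ i := fun i =>
    hg _ _ (hw.1 i) (hv i) (h i)
  have hs : IsStable μ (spanPoints ι (Fin 2) ⟨v, hv⟩) := hw.2.of_imp fun i j hij => by
    rw [e, e] at hij
    exact smul_left_cancel _ hij
  exact ⟨⟨hv, hs⟩, (Quotient.sound ⟨g, e⟩ : DM.mk μ ⟨_, hw.2⟩ = DM.mk μ ⟨_, hs⟩).symm⟩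

theorem DM.exists_of_ofVec_eq {v w : VecTuple (κ := Fin 2) (IsStable μ)}
    (h : DM.ofVec μ v = DM.ofVec μ w) : ∃ (g : Matrix.SpecialLinearGroup (Fin 2) ℂ) (t : ι → ℂ),
      (∀ i, t i ≠ 0) ∧ ∀ i, (fun k => w.1 (i, k)) = t i • g.1 *ᵥ fun k => v.1 (i, k) := by
  obtain ⟨g, hg⟩ := Quotient.exact h
  have h' : ∀ i, ∃ a : ℂˣ, a • (g.1 *ᵥ fun k => v.1 (i, k)) = fun k => w.1 (i, k) := fun i =>
    (Projectivization.mk_eq_mk_iff ℂ _ _ (w.2.1 i)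
      (g.1.mulVec_injective_iff_isUnit.2 (by
        rw [Matrix.isUnit_iff_isUnit_det, g.2]; exact isUnit_one) |>.ne_iff' (by simp) |>.2
          (v.2.1 i))).1 (hg i)
  choose a ha using h'
  exact ⟨g, fun i => a i, fun i => (a i).ne_zero, fun i => (ha i).symm⟩

theorem isOpen_isStable (μ : ι → ℕ) : IsOpen[(affineSpace (ι × Fin 2)).top]
    {v | ∃ h, IsStable μ (spanPoints ι (Fin 2) ⟨v, h⟩)} := by
  classical
  rintro v ⟨hv, hs⟩
  have hc : ∀ i, ∃ k, v (i, k) ≠ 0 := fun i => Function.ne_iff.1 (hv i)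
  choose c hc using hc
  obtain ⟨K, ev⟩ : ∃ K : MvPolynomial (ι × Fin 2) ℂ, ∀ w : ι × Fin 2 → ℂ, MvPolynomial.eval w K =
      (∏ i, w (i, c i)) * ∏ e : ι × ι,
        if bracket (fun k => v (e.1, k)) (fun k => v (e.2, k)) = 0 then 1 else
          bracket (fun k => w (e.1, k)) (fun k => w (e.2, k)) := by
    refine ⟨(∏ i, MvPolynomial.X (i, c i)) * ∏ e : ι × ι,
      if bracket (fun k => v (e.1, k)) (fun k => v (e.2, k)) = 0 then 1 else
        MvPolynomial.X (e.1, 0) * MvPolynomial.X (e.2, 1) -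
          MvPolynomial.X (e.1, 1) * MvPolynomial.X (e.2, 0), fun w => ?_⟩
    rw [map_mul, map_prod, map_prod]
    congr 1
    · simp
    · refine Finset.prod_congr rfl fun e _ => ?_
      split_ifs <;> simp [bracket]
  refine ⟨K, ?_, fun w hw => ?_⟩
  · rw [ev]
    refine mul_ne_zero (Finset.prod_ne_zero_iff.2 fun i _ => hc i)
      (Finset.prod_ne_zero_iff.2 fun e _ => ?_)
    split_ifs with h
    · exact one_ne_zero
    · exact h
  · rw [ev] at hw
    have h1 := Finset.prod_ne_zero_iff.1 (left_ne_zero_of_mul hw)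
    have h2 := Finset.prod_ne_zero_iff.1 (right_ne_zero_of_mul hw)
    have hw0 : ∀ i, (fun k => w (i, k)) ≠ 0 := fun i h => h1 i (Finset.mem_univ _) (congrFun h _)
    refine ⟨hw0, hs.of_imp fun i j hij => ?_⟩
    have h3 := (mk_eq_mk_iff_bracket (hw0 i) (hw0 j)).1 hij
    refine (mk_eq_mk_iff_bracket (hv i) (hv j)).2 ?_
    by_contra hne
    have := h2 (i, j) (Finset.mem_univ _)
    rw [if_neg hne] at this
    exact this h3

end

/-- The class in `DM_{ℤ/2}(2⁵,1²)` of the configuration represented by a tuple of vectors. -/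
noncomputable def DMZ2.ofVec (v : VecTuple (κ := Fin 2) (IsStable weight2511)) : DMZ2 :=
  DMZ2.mk (DM.ofVec weight2511 v)

theorem DMZ2.space_eq :
    DMZ2.space = ((affineSpace (Seven × Fin 2)).induced Subtype.val).coinduced DMZ2.ofVec := by
  rw [DMZ2.space, DM.space_eq]
  rfl

/-- Tuples of vectors that are proportional to each other, up to an invertible matrix and an
interchange of the last two, represent the same point of `DM_{ℤ/2}(2⁵,1²)`. -/
theorem DMZ2.exists_of_ofVec_eq {v w : VecTuple (κ := Fin 2) (IsStable weight2511)}
    (h : DMZ2.ofVec v = DMZ2.ofVec w) :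
    ∃ (g : Matrix.SpecialLinearGroup (Fin 2) ℂ) (t : Seven → ℂ) (τ : Equiv.Perm Seven),
      (τ = 1 ∨ τ = swapLast) ∧ (∀ i, t i ≠ 0) ∧
        ∀ i, (fun k => w.1 (i, k)) = t i • g.1 *ᵥ fun k => v.1 (τ i, k) := by
  rcases Quotient.exact h with h | h
  · obtain ⟨g, t, ht, e⟩ := DM.exists_of_ofVec_eq h.symm
    exact ⟨g, t, 1, Or.inl rfl, ht, e⟩
  · have h1 : DM.ofVec weight2511 w = DM.swap (DM.ofVec weight2511 v) := h
    have hinv : swapLast⁻¹ = swapLast := by decide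
    have h2 : DM.swap (DM.ofVec weight2511 v) = DM.ofVec weight2511
        ⟨fun e => v.1 (swapLast e.1, e.2), fun i => v.2.1 (swapLast i), by
          have := v.2.2.perm swapLast weight_swapLast
          rw [hinv] at this
          exact this⟩ := by
      refine (congrArg (DM.mk weight2511) (Subtype.ext ?_))
      exact funext fun i =>
        congrArg (fun τ : Equiv.Perm Seven => spanPoints _ _ ⟨v.1, v.2.1⟩ (τ i)) hinv
    obtain ⟨g, t, ht, e⟩ := DM.exists_of_ofVec_eq (h1.trans h2).symm
    exact ⟨g, t, swapLast, Or.inr rfl, ht, e⟩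

/-! ### The embedding of `DM(2⁶)` -/

section Descend

/-- The point of `DM(2⁶)` given by a tuple of vectors, mapped to `DM_{ℤ/2}(2⁵,1²)`. -/
theorem descend_ofVec (v : VecTuple (κ := Fin 2) (IsStable weight26)) :
    descend (DM.ofVec weight26 v) =
      DMZ2.ofVec ⟨fun e => v.1 (collapse e.1, e.2), fun i => v.2.1 (collapse i), v.2.2.collapse⟩ :=
  rfl

theorem descend_isMorphism : (DM.space weight26).IsMorphism DMZ2.space descend := by
  rw [DM.space_eq, FunctionSpace.isMorphism_coinduced_iff, DMZ2.space_eq]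
  refine FunctionSpace.IsMorphismOn.isMorphism (FunctionSpace.isMorphismOn_coinduced
    ((FunctionSpace.isLocal_affineSpace _).induced _) fun v _ => ?_)
  exact ⟨Set.univ, fun v e => v.1 (collapse e.1, e.2), FunctionSpace.isOpen_univ _, trivial,
    subset_rfl, fun _ => FunctionSpace.regular_coord_induced _ _ _,
    fun v _ => ⟨_, rfl, (descend_ofVec v).symm⟩⟩

/-- The two last of seven points on the line are replaced by one, the harmonic conjugate of the
`i`-th point with respect to them. -/
def harmonic (i : Fin 5) (v : Seven × Fin 2 → ℂ) : Six × Fin 2 → ℂ := fun e =>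
  Sum.elim (fun j => v (Sum.inl j, e.2)) (fun _ =>
    bracket (fun k => v (Sum.inl i, k)) (fun k => v (Sum.inr 0, k)) * v (Sum.inr 1, e.2) +
    bracket (fun k => v (Sum.inl i, k)) (fun k => v (Sum.inr 1, k)) * v (Sum.inr 0, e.2)) e.1

theorem harmonic_bracket (i : Fin 5) {v w : Seven × Fin 2 → ℂ}
    {g : Matrix.SpecialLinearGroup (Fin 2) ℂ} {t : Seven → ℂ} {τ : Equiv.Perm Seven}
    (hτ : τ = 1 ∨ τ = swapLast)
    (h : ∀ i, (fun k => w (i, k)) = t i • g.1 *ᵥ fun k => v (τ i, k)) (j : Six) :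
    ∃ c : ℂ, ((∀ i, t i ≠ 0) → c ≠ 0) ∧ (fun k => harmonic i w (j, k)) =
      c • (g.1 *ᵥ fun k => harmonic i v (j, k)) := by
  have hd := g.2
  rw [Matrix.det_fin_two] at hd
  have hl : ∀ j : Fin 5, τ (Sum.inl j) = Sum.inl j := by
    intro j
    rcases hτ with rfl | rfl <;> rfl
  rcases j with j | j
  · refine ⟨t (Sum.inl j), fun ht => ht _, ?_⟩
    have := h (Sum.inl j)
    rw [hl] at this
    exact this
  · refine ⟨t (Sum.inl i) * t (Sum.inr 0) * t (Sum.inr 1), fun ht =>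
      mul_ne_zero (mul_ne_zero (ht _) (ht _)) (ht _), ?_⟩
    have hw : ∀ s k, w (s, k) = t s * (g.1 k 0 * v (τ s, 0) + g.1 k 1 * v (τ s, 1)) := by
      intro s k
      have := congrFun (h s) k
      rw [Pi.smul_apply, Matrix.mulVec, dotProduct, Fin.sum_univ_two] at this
      exact this
    rcases hτ with rfl | rfl
    · funext k
      have e : ∀ s : Seven, (1 : Equiv.Perm Seven) s = s := fun _ => rfl
      simp only [harmonic, Sum.elim_inr, bracket, hw, e, Pi.smul_apply, smul_eq_mul, Matrix.mulVec,
        dotProduct, Fin.sum_univ_two]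
      linear_combination (t (Sum.inl i) * t (Sum.inr 0) * t (Sum.inr 1) *
        ((v (Sum.inl i, 0) * v (Sum.inr 0, 1) - v (Sum.inl i, 1) * v (Sum.inr 0, 0)) *
          (g.1 k 0 * v (Sum.inr 1, 0) + g.1 k 1 * v (Sum.inr 1, 1)) +
        (v (Sum.inl i, 0) * v (Sum.inr 1, 1) - v (Sum.inl i, 1) * v (Sum.inr 1, 0)) *
          (g.1 k 0 * v (Sum.inr 0, 0) + g.1 k 1 * v (Sum.inr 0, 1)))) * hd
    · funext k
      have e0 : swapLast (Sum.inr 0) = Sum.inr 1 := rfl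
      have e1 : swapLast (Sum.inr 1) = Sum.inr 0 := rfl
      simp only [harmonic, Sum.elim_inr, bracket, hw, hl, e0, e1, Pi.smul_apply, smul_eq_mul,
        Matrix.mulVec, dotProduct, Fin.sum_univ_two]
      linear_combination (t (Sum.inl i) * t (Sum.inr 0) * t (Sum.inr 1) *
        ((v (Sum.inl i, 0) * v (Sum.inr 0, 1) - v (Sum.inl i, 1) * v (Sum.inr 0, 0)) *
          (g.1 k 0 * v (Sum.inr 1, 0) + g.1 k 1 * v (Sum.inr 1, 1)) +
        (v (Sum.inl i, 0) * v (Sum.inr 1, 1) - v (Sum.inl i, 1) * v (Sum.inr 1, 0)) *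
          (g.1 k 0 * v (Sum.inr 0, 0) + g.1 k 1 * v (Sum.inr 0, 1)))) * hd

/-- The class of the six points obtained by `harmonic` depends only on the point of
`DM_{ℤ/2}(2⁵,1²)`. -/
theorem harmonic_class (i : Fin 5) {v w : VecTuple (κ := Fin 2) (IsStable weight2511)}
    (h : DMZ2.ofVec v = DMZ2.ofVec w)
    (hv : ∃ h, IsStable weight26 (spanPoints Six (Fin 2) ⟨harmonic i v.1, h⟩)) :
    ∃ hw, DM.ofVec weight26 ⟨harmonic i w.1, hw⟩ = DM.ofVec weight26 ⟨harmonic i v.1, hv⟩ := by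
  obtain ⟨g, t, τ, hτ, ht, e⟩ := DMZ2.exists_of_ofVec_eq h
  have hg : g.1.det ≠ 0 := by rw [g.2]; exact one_ne_zero
  refine DM.ofVec_eq hv (G := g.1) (fun j h0 => ?_) hg fun j => ?_
  · obtain ⟨c, hc, hj⟩ := harmonic_bracket i hτ e j
    rw [hj] at h0
    exact hv.1 j (Matrix.eq_zero_of_mulVec_eq_zero hg ((smul_eq_zero.1 h0).resolve_left (hc ht)))
  · obtain ⟨c, -, hj⟩ := harmonic_bracket i hτ e j
    rw [hj]
    simp only [bracket, Pi.smul_apply, smul_eq_mul]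
    ring

open Classical in
/-- Near a configuration in which the two points of weight `1` coincide and differ from the `i`-th
point, the harmonic conjugate of the `i`-th point gives a retraction to `DM(2⁶)`. -/
theorem descend_isEmb : (DM.space weight26).IsEmb DMZ2.space descend := by
  refine FunctionSpace.isEmb_of_retraction descend_isMorphism fun y => ?_
  obtain ⟨v, rfl⟩ := DM.ofVec_surjective _ y
  -- Some of the first five points differs from the sixth, by stability.
  obtain ⟨i, hi⟩ : ∃ i : Fin 5,
      bracket (fun k => v.1 (Sum.inl i, k)) (fun k => v.1 (Sum.inr 0, k)) ≠ 0 := by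
    by_contra! H
    have := v.2.2 (spanPoints Six (Fin 2) ⟨v.1, v.2.1⟩ (Sum.inr 0))
    rw [Finset.filter_true_of_mem] at this
    · omega
    · rintro (i | i) -
      · exact (mk_eq_mk_iff_bracket _ _).2 (H i)
      · rw [Subsingleton.elim i 0]
  let good : VecTuple (κ := Fin 2) (IsStable weight2511) → Prop := fun w =>
    ∃ h, IsStable weight26 (spanPoints Six (Fin 2) ⟨harmonic i w.1, h⟩)
  let r : DMZ2 → DM weight26 := fun z =>
    if h : ∃ w, DMZ2.ofVec w = z ∧ good w then
      DM.ofVec weight26 ⟨harmonic i h.choose.1, h.choose_spec.2⟩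
    else DM.ofVec weight26 v
  have hr : ∀ w (hw : good w), r (DMZ2.ofVec w) = DM.ofVec weight26 ⟨harmonic i w.1, hw⟩ := by
    intro w hw
    have h : ∃ w', DMZ2.ofVec w' = DMZ2.ofVec w ∧ good w' := ⟨w, rfl, hw⟩
    change dite _ _ _ = _
    rw [dif_pos h]
    obtain ⟨_, h'⟩ := harmonic_class i h.choose_spec.1.symm hw
    exact h'
  have hO : DMZ2.ofVec ⁻¹' {z | ∃ w, DMZ2.ofVec w = z ∧ good w} = {w | good w} := by
    ext w
    constructor
    · rintro ⟨w', e, hw'⟩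
      exact (harmonic_class i e hw').1
    · exact fun hw => ⟨w, rfl, hw⟩
  have hF : ∀ e, ((affineSpace (Seven × Fin 2)).induced
      (Subtype.val : VecTuple (κ := Fin 2) (IsStable weight2511) → _)).IsRegular Set.univ
        fun w => harmonic i w.1 e := by
    have hc := fun e => FunctionSpace.regular_coord_induced
      (Subtype.val : VecTuple (κ := Fin 2) (IsStable weight2511) → _) Set.univ e
    have hb : ∀ s t : Seven, ((affineSpace (Seven × Fin 2)).induced
      (Subtype.val : VecTuple (κ := Fin 2) (IsStable weight2511) → _)).IsRegular Set.univ
        fun w => bracket (fun k => w.1 (s, k)) (fun k => w.1 (t, k)) := fun s t =>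
      FunctionSpace.regular_sub _ (FunctionSpace.regular_mul _ _ _ _ (hc _) (hc _))
        (FunctionSpace.regular_mul _ _ _ _ (hc _) (hc _))
    rintro ⟨j | j, k⟩
    · exact hc _
    · exact FunctionSpace.regular_add _ _ _ _ (FunctionSpace.regular_mul _ _ _ _ (hb _ _) (hc _))
        (FunctionSpace.regular_mul _ _ _ _ (hb _ _) (hc _))
  have hloc := (FunctionSpace.isLocal_affineSpace (Seven × Fin 2)).induced
    (Subtype.val : VecTuple (κ := Fin 2) (IsStable weight2511) → _)
  have hopen : IsOpen[((affineSpace (Seven × Fin 2)).induced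
      (Subtype.val : VecTuple (κ := Fin 2) (IsStable weight2511) → _)).top] {w | good w} := by
    have := (FunctionSpace.isMorphismOn_affineSpace hloc (FunctionSpace.isOpen_univ _) hF).1 _
      (isOpen_isStable weight26)
    rwa [Set.univ_inter] at this
  -- Where the last two vectors are proportional, the harmonic conjugate is proportional to them.
  have hcol : ∀ u : VecTuple (κ := Fin 2) (IsStable weight26), ∀ k,
      harmonic i (fun e => u.1 (collapse e.1, e.2)) (Sum.inr 0, k) =
        2 * bracket (fun k => u.1 (Sum.inl i, k)) (fun k => u.1 (Sum.inr 0, k)) *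
          u.1 (Sum.inr 0, k) := fun u k => by
    change bracket (fun k => u.1 (Sum.inl i, k)) (fun k => u.1 (Sum.inr 0, k)) *
      u.1 (Sum.inr 0, k) + bracket (fun k => u.1 (Sum.inl i, k)) (fun k => u.1 (Sum.inr 0, k)) *
      u.1 (Sum.inr 0, k) = _
    ring
  have hbr : ∀ u : VecTuple (κ := Fin 2) (IsStable weight26), ∀ j,
      bracket (fun k => harmonic i (fun e => u.1 (collapse e.1, e.2)) (j, k))
        ((1 : Matrix (Fin 2) (Fin 2) ℂ) *ᵥ fun k => u.1 (j, k)) = 0 := by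
    intro u j
    rw [Matrix.one_mulVec]
    rcases j with j | j
    · simp only [harmonic, Sum.elim_inl, collapse, Sum.map_inl, bracket, id]
      ring
    · rw [Subsingleton.elim j 0]
      simp only [bracket, hcol]
      ring
  refine ⟨{z | ∃ w, DMZ2.ofVec w = z ∧ good w}, r, ?_, ?_, ?_, ?_⟩
  · rw [DMZ2.space_eq]
    exact (congrArg (fun s => IsOpen[((affineSpace (Seven × Fin 2)).induced
      (Subtype.val : VecTuple (κ := Fin 2) (IsStable weight2511) → _)).top] s) hO).mpr hopen
  · refine ⟨_, (descend_ofVec v).symm, ?_⟩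
    refine (DM.ofVec_eq v.2 (fun j h0 => ?_) (by simp) (hbr v)).1
    rcases j with j | j
    · exact v.2.1 (Sum.inl j) h0
    · rw [Subsingleton.elim j 0] at h0
      refine v.2.1 (Sum.inr 0) (funext fun k => ?_)
      have := congrFun h0 k
      simp only [hcol] at this
      exact (mul_eq_zero.1 this).resolve_left (mul_ne_zero two_ne_zero hi)
  · rw [DMZ2.space_eq, DM.space_eq]
    change ((affineSpace (Seven × Fin 2)).induced
      (Subtype.val : VecTuple (κ := Fin 2) (IsStable weight2511) → _)).IsMorphismOn
        (DMZ2.ofVec ⁻¹' {z | ∃ w, DMZ2.ofVec w = z ∧ good w}) _ (r ∘ DMZ2.ofVec)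
    rw [hO]
    exact FunctionSpace.isMorphismOn_coinduced hloc fun w hw => ⟨_, fun w => harmonic i w.1, hopen,
      hw, subset_rfl, fun e => FunctionSpace.regular_restrict _ _ _ _ (Set.subset_univ _) (hF e),
      fun u hu => ⟨⟨_, hu⟩, rfl, (hr u hu).symm⟩⟩
  · intro y hy
    obtain ⟨u, rfl⟩ := DM.ofVec_surjective _ y
    rw [descend_ofVec] at hy ⊢
    have hgood := (Set.ext_iff.1 hO _).1 hy
    rw [hr _ hgood]
    exact (DM.ofVec_eq u.2 hgood.1 (by simp) (hbr u)).2

end Descend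

/-! ### Maps given by unordered pairs of roots -/

/-- Seven vectors in the plane, the last two of them `(1, a)` and `(1, b)`. -/
def sevenVec (u : Fin 5 → Fin 2 → ℂ) (a b : ℂ) : Seven × Fin 2 → ℂ := fun e =>
  Sum.elim (fun i => u i e.2) (fun j => ![![1, a], ![1, b]] j e.2) e.1

/-- A polynomial in the roots of a monic quadratic polynomial, the remaining variables being
regular functions, is linear in the first root, with regular coefficients. -/
theorem eval_sevenVec {X : Type*} (S : FunctionSpace X) {U : Set X} {u : X → Fin 5 → Fin 2 → ℂ}
    {s e : X → ℂ} (hu : ∀ i k, S.IsRegular U fun x => u x i k) (hs : S.IsRegular U s)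
    (he : S.IsRegular U e) (p : MvPolynomial (Seven × Fin 2) ℂ) :
    ∃ f g : X → ℂ, S.IsRegular U f ∧ S.IsRegular U g ∧ ∀ x a b, a + b = s x → a * b = e x →
      MvPolynomial.eval (sevenVec (u x) a b) p = f x + g x * a := by
  induction p using MvPolynomial.induction_on with
  | C c => exact ⟨fun _ => c, fun _ => 0, S.regular_const _ _, S.regular_const _ _, by simp⟩
  | add p q hp hq =>
    obtain ⟨f, g, hf, hg, h⟩ := hp
    obtain ⟨f', g', hf', hg', h'⟩ := hq
    refine ⟨_, _, S.regular_add _ _ _ hf hf', S.regular_add _ _ _ hg hg',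
      fun x a b h1 h2 => ?_⟩
    rw [map_add, h x a b h1 h2, h' x a b h1 h2]
    ring
  | mul_X p i hp =>
    obtain ⟨f, g, hf, hg, h⟩ := hp
    -- It suffices to write the variable itself in this form.
    obtain ⟨f', g', hf', hg', h'⟩ : ∃ f' g' : X → ℂ, S.IsRegular U f' ∧ S.IsRegular U g' ∧
        ∀ x a b, a + b = s x → a * b = e x → sevenVec (u x) a b i = f' x + g' x * a := by
      obtain ⟨i | j, k⟩ := i
      · exact ⟨_, _, hu i k, S.regular_const _ 0, fun x a b _ _ => by simp [sevenVec]⟩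
      · fin_cases j <;> fin_cases k
        · exact ⟨_, _, S.regular_const _ 1, S.regular_const _ 0, fun x a b _ _ => by
            simp [sevenVec]⟩
        · exact ⟨_, _, S.regular_const _ 0, S.regular_const _ 1, fun x a b _ _ => by
            simp [sevenVec]⟩
        · exact ⟨_, _, S.regular_const _ 1, S.regular_const _ 0, fun x a b _ _ => by
            simp [sevenVec]⟩
        · exact ⟨_, _, hs, S.regular_const _ (-1), fun x a b h _ => by
            simp [sevenVec, ← h]⟩
    refine ⟨_, _, S.regular_sub (S.regular_mul _ _ _ hf hf')
      (S.regular_mul _ _ _ (S.regular_mul _ _ _ hg hg') he),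
      S.regular_add _ _ _ (S.regular_add _ _ _ (S.regular_mul _ _ _ hf hg')
        (S.regular_mul _ _ _ hg hf')) (S.regular_mul _ _ _ (S.regular_mul _ _ _ hg hg') hs),
      fun x a b h1 h2 => ?_⟩
    rw [map_mul, MvPolynomial.eval_X, h x a b h1 h2, h' x a b h1 h2, ← h1, ← h2]
    ring

theorem exists_roots (s e : ℂ) : ∃ a b : ℂ, a + b = s ∧ a * b = e := by
  obtain ⟨d, hd⟩ := IsAlgClosed.exists_pow_nat_eq (s ^ 2 - 4 * e) two_pos
  exact ⟨(s + d) / 2, (s - d) / 2, by ring, by linear_combination -hd / 4⟩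

/-- A map to `DM_{ℤ/2}(2⁵,1²)` is a morphism if, locally, it is given by five vectors with regular
coordinates and by the pair of roots of a quadratic polynomial with regular coefficients. The roots
need not be regular functions; but a function on the target can be averaged over the two orderings
of the roots. -/
theorem DMZ2.isMorphism_of_roots {X : Type*} {S : FunctionSpace X} (hS : S.IsLocal) {f : X → DMZ2}
    (h : ∀ x, ∃ (U : Set X) (u : X → Fin 5 → Fin 2 → ℂ) (s e : X → ℂ), IsOpen[S.top] U ∧ x ∈ U ∧
      (∀ i k, S.IsRegular U fun x => u x i k) ∧ S.IsRegular U s ∧ S.IsRegular U e ∧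
      ∀ y ∈ U, ∀ a b, a + b = s y → a * b = e y →
        ∃ h, DMZ2.ofVec ⟨sevenVec (u y) a b, h⟩ = f y) :
    S.IsMorphism DMZ2.space f := by
  rw [DMZ2.space_eq]
  have key : ∀ (x : X) (U : Set X) (u : X → Fin 5 → Fin 2 → ℂ) (s e : X → ℂ) (a b : ℂ)
      (K : MvPolynomial (Seven × Fin 2) ℂ), IsOpen[S.top] U → x ∈ U →
      (∀ i k, S.IsRegular U fun x => u x i k) → S.IsRegular U s → S.IsRegular U e →
      a + b = s x → a * b = e x → MvPolynomial.eval (sevenVec (u x) a b) K ≠ 0 →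
      ∃ U' ⊆ U, IsOpen[S.top] U' ∧ x ∈ U' ∧ ∀ y ∈ U', ∃ a b, a + b = s y ∧ a * b = e y ∧
        MvPolynomial.eval (sevenVec (u y) a b) K ≠ 0 := by
    intro x U u s e a b K hU hx hu hs he h1 h2 hK
    obtain ⟨f, g, hf, hg, hfg⟩ := eval_sevenVec S hu hs he K
    -- The sum and the product of the values at the two roots are regular.
    have hsum := S.regular_add _ _ _ (S.regular_mul _ _ _ (S.regular_const U 2) hf)
      (S.regular_mul _ _ _ hg hs)
    have hprod := S.regular_add _ _ _ (S.regular_add _ _ _ (S.regular_mul _ _ _ hf hf)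
      (S.regular_mul _ _ _ (S.regular_mul _ _ _ hf hg) hs))
      (S.regular_mul _ _ _ (S.regular_mul _ _ _ hg hg) he)
    by_cases h0 : 2 * f x + g x * s x = 0
    · refine ⟨_, Set.inter_subset_left, hS.isOpen_ne U _ hU hprod, ⟨hx, ?_⟩, ?_⟩
      · rw [Set.mem_ofPred_eq]
        rw [hfg x a b h1 h2] at hK
        have : f x * f x + f x * g x * s x + g x * g x * e x = -((f x + g x * a) ^ 2) := by
          rw [← h1] at h0
          rw [← h1, ← h2]
          linear_combination (f x + g x * a) * h0
        rw [this]
        exact neg_ne_zero.2 (pow_ne_zero 2 hK)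
      · rintro y ⟨hyU, hy⟩
        obtain ⟨a, b, h3, h4⟩ := exists_roots (s y) (e y)
        refine ⟨a, b, h3, h4, fun h5 => hy ?_⟩
        rw [hfg y a b h3 h4] at h5
        rw [← h3, ← h4]
        linear_combination (f y + g y * b) * h5
    · refine ⟨_, Set.inter_subset_left, hS.isOpen_ne U _ hU hsum, ⟨hx, h0⟩, ?_⟩
      rintro y ⟨hyU, hy⟩
      obtain ⟨a, b, h3, h4⟩ := exists_roots (s y) (e y)
      by_cases h5 : MvPolynomial.eval (sevenVec (u y) a b) K = 0
      · refine ⟨b, a, by rw [add_comm, h3], by rw [mul_comm, h4], fun h6 => hy ?_⟩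
        rw [hfg y a b h3 h4] at h5
        rw [hfg y b a (by rw [add_comm, h3]) (by rw [mul_comm, h4])] at h6
        rw [← h3]
        linear_combination h5 + h6
      · exact ⟨a, b, h3, h4, h5⟩
  have hopen : ∀ V : Set DMZ2, IsOpen[(((affineSpace (Seven × Fin 2)).induced
      Subtype.val).coinduced DMZ2.ofVec).top] V → IsOpen[S.top] (f ⁻¹' V) := by
    rintro V ⟨W, hW, hWV⟩
    refine S.isOpen_of_forall fun x hx => ?_
    obtain ⟨U, u, s, e, hU, hxU, hu, hs, he, hl⟩ := h x
    obtain ⟨a, b, h1, h2⟩ := exists_roots (s x) (e x)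
    obtain ⟨h3, h4⟩ := hl x hxU a b h1 h2
    have h5 : sevenVec (u x) a b ∈ W :=
      (Set.ext_iff.1 hWV ⟨_, h3⟩).2 (by rw [Set.mem_preimage, h4]; exact hx)
    obtain ⟨K, hK, hKW⟩ := hW _ h5
    obtain ⟨U', hU'U, hU', hxU', hy⟩ := key x U u s e a b K hU hxU hu hs he h1 h2 hK
    refine ⟨U', hU', hxU', fun y hyU => ?_⟩
    obtain ⟨a', b', h6, h7, h8⟩ := hy y hyU
    obtain ⟨h9, h10⟩ := hl y (hU'U hyU) a' b' h6 h7
    rw [Set.mem_preimage, ← h10]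
    exact (Set.ext_iff.1 hWV ⟨_, h9⟩).1 (hKW _ h8)
  refine ⟨hopen, fun V F hV hF => S.regular_glue _ _ fun x hx => ?_⟩
  obtain ⟨W, hW, hWV⟩ := hV
  obtain ⟨U, u, s, e, hU, hxU, hu, hs, he, hl⟩ := h x
  obtain ⟨a, b, h1, h2⟩ := exists_roots (s x) (e x)
  obtain ⟨h3, h4⟩ := hl x hxU a b h1 h2
  obtain ⟨V', F', hV', hxV', hF', e'⟩ := hF ⟨_, h3⟩ (by
    change DMZ2.ofVec _ ∈ V
    rw [h4]
    exact hx)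
  obtain ⟨P, Q, hQ, e''⟩ := hF' _ hxV'
  obtain ⟨k, hk, hkV'⟩ := hV' _ hxV'
  -- Near the configuration with the ordered roots `a`, `b`, the function is `P / Q`; the identity
  -- `F * (Q * R) = P * R`, with `R = Q * k`, holds at all configurations with values in `V`.
  have hFQ : ∀ y ∈ U, f y ∈ V → ∀ a b, a + b = s y → a * b = e y →
      F (f y) * MvPolynomial.eval (sevenVec (u y) a b) (Q * (Q * k)) =
        MvPolynomial.eval (sevenVec (u y) a b) (P * (Q * k)) := by
    intro y hy hyV a b h1 h2
    by_cases h0 : MvPolynomial.eval (sevenVec (u y) a b) (Q * k) = 0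
    · rw [map_mul, h0, map_mul, h0, mul_zero, mul_zero, mul_zero]
    · obtain ⟨h5, h6⟩ := hl y hy a b h1 h2
      have h7 := h0
      rw [map_mul] at h7
      have h8 := hkV' _ (right_ne_zero_of_mul h7)
      have h9 := e' ⟨_, h5⟩ (by change DMZ2.ofVec _ ∈ V; rw [h6]; exact hyV) h8
      rw [Function.comp_apply, h6, e'' _ h8 (left_ne_zero_of_mul h7)] at h9
      rw [h9, map_mul, map_mul _ P, ← mul_assoc, div_mul_cancel₀ _ (left_ne_zero_of_mul h7)]
  generalize hQ1 : Q * (Q * k) = Q' at hFQ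
  generalize P * (Q * k) = P' at hFQ
  have hQx : MvPolynomial.eval (sevenVec (u x) a b) Q' ≠ 0 := by
    rw [← hQ1, map_mul, map_mul]
    exact mul_ne_zero hQ (mul_ne_zero hQ hk)
  obtain ⟨p, p', hp, hp', hpp⟩ := eval_sevenVec S hu hs he P'
  obtain ⟨q, q', hq, hq', hqq⟩ := eval_sevenVec S hu hs he Q'
  have hF2 : ∀ y ∈ U, f y ∈ V → ∀ a b, a + b = s y → a * b = e y →
      F (f y) * (q y + q' y * a) = p y + p' y * a := by
    intro y hy hyV a b h1 h2
    rw [← hqq y a b h1 h2, ← hpp y a b h1 h2]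
    exact hFQ y hy hyV a b h1 h2
  rw [hqq x a b h1 h2] at hQx
  -- The sums, respectively products, over the two roots of numerator and denominator.
  have hres : ∀ g h : X → ℂ, S.IsRegular U g → S.IsRegular U h → h x ≠ 0 →
      (∀ y ∈ U, f y ∈ V → F (f y) * h y = g y) →
      ∃ V_1 : Set X, IsOpen[S.top] V_1 ∧ x ∈ V_1 ∧ S.IsRegular (f ⁻¹' V ∩ V_1) (F ∘ f) := by
    intro g h hg hh h0 hgh
    refine ⟨_, hS.isOpen_ne U h hU hh, ⟨hxU, h0⟩, ?_⟩
    refine S.regular_congr _ (fun y => g y / h y) _ (fun y hy => ?_)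
      (hS.div (S.regular_restrict _ _ _ (fun y hy => hy.2.1) hg)
        (S.regular_restrict _ _ _ (fun y hy => hy.2.1) hh) fun y hy => hy.2.2)
    rw [Function.comp_apply, ← hgh y hy.2.1 hy.1, mul_div_cancel_right₀ _ hy.2.2]
  have hswap : ∀ y ∈ U, f y ∈ V → ∃ a b, a + b = s y ∧ a * b = e y ∧
      F (f y) * (q y + q' y * a) = p y + p' y * a ∧
      F (f y) * (q y + q' y * b) = p y + p' y * b := by
    intro y hy hyV
    obtain ⟨a, b, h3, h4⟩ := exists_roots (s y) (e y)
    exact ⟨a, b, h3, h4, hF2 y hy hyV a b h3 h4,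
      hF2 y hy hyV b a (by rw [add_comm, h3]) (by rw [mul_comm, h4])⟩
  have R := fun f g hf hg => S.regular_mul U f g hf hg
  by_cases h0 : 2 * q x + q' x * s x = 0
  · refine hres _ _
      (S.regular_add _ _ _ (S.regular_add _ _ _ (R _ _ (S.regular_const U 2) (R _ _ hp hq))
        (R _ _ (S.regular_add _ _ _ (R _ _ hp hq') (R _ _ hp' hq)) hs))
        (R _ _ (S.regular_const U 2) (R _ _ (R _ _ hp' hq') he)))
      (R _ _ (S.regular_const U 2) (S.regular_add _ _ _ (S.regular_add _ _ _ (R _ _ hq hq)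
      (R _ _ (R _ _ hq hq') hs)) (R _ _ (R _ _ hq' hq') he))) ?_ fun y hy hyV => ?_
    · have : 2 * (q x * q x + q x * q' x * s x + q' x * q' x * e x) =
          -2 * ((q x + q' x * a) ^ 2) := by
        rw [← h1] at h0
        rw [← h1, ← h2]
        linear_combination 2 * (q x + q' x * a) * h0
      rw [this]
      exact mul_ne_zero (by norm_num) (pow_ne_zero 2 hQx)
    · obtain ⟨a, b, h3, h4, h5, h6⟩ := hswap y hy hyV
      rw [← h3, ← h4]
      linear_combination (q y + q' y * b) * h5 + (q y + q' y * a) * h6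
  · refine hres _ _ (S.regular_add _ _ _ (R _ _ (S.regular_const U 2) hp) (R _ _ hp' hs))
      (S.regular_add _ _ _ (R _ _ (S.regular_const U 2) hq) (R _ _ hq' hs)) h0 fun y hy hyV => ?_
    obtain ⟨a, b, h3, h4, h5, h6⟩ := hswap y hy hyV
    rw [← h3]
    linear_combination h5 + h6

/-! ### Conics through five points -/

/-- The matrix of the conic parametrized by `t ↦ (1, t, t²)`. -/
def standardConic : Matrix (Fin 3) (Fin 3) ℂ := !![0, 0, 1; 0, -2, 0; 1, 0, 0]

theorem standardConic_isSymm : standardConic.IsSymm := by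
  ext i j
  fin_cases i <;> fin_cases j <;> rfl

theorem standardConic_det : standardConic.det = 2 := by
  simp [standardConic, Matrix.det_fin_three]

theorem eq_zero_of_quadratic {M : Matrix (Fin 3) (Fin 3) ℂ} (hM : M.IsSymm)
    (h : ∀ x, x ⬝ᵥ M *ᵥ x = 0) : M = 0 := by
  have hd : ∀ i, M i i = 0 := fun i => by simpa using h (Pi.single i 1)
  ext i j
  have h1 := h (Pi.single i 1 + Pi.single j 1)
  have h2 : M j i = M i j := congrFun (congrFun hM i) j
  simp [Matrix.mulVec_add, hd, h2] at h1
  exact h1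

theorem exists_congr_standardConic {A : Matrix (Fin 3) (Fin 3) ℂ} (hA : IsIrreducibleConic A) :
    ∃ P : Matrix (Fin 3) (Fin 3) ℂ, Pᵀ * A * P = standardConic := by
  have hB : ∀ M : Matrix (Fin 3) (Fin 3) ℂ, M.IsSymm → M.det ≠ 0 →
      (QuadraticMap.associated (R := ℂ)
        (LinearMap.BilinMap.toQuadraticMap (Matrix.toLinearMap₂' ℂ M))).SeparatingLeft := by
    intro M hM hd
    rw [QuadraticMap.associated_left_inverse]
    · exact Matrix.separatingLeft_toLinearMap₂'_iff.2 (Matrix.separatingLeft_iff_det_ne_zero.2 hd)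
    · intro x y
      rw [Matrix.toLinearMap₂'_apply', Matrix.toLinearMap₂'_apply', polar_comm hM]
  obtain ⟨e⟩ := QuadraticForm.equivalent_of_isAlgClosed _ _
    (hB standardConic standardConic_isSymm (by rw [standardConic_det]; exact two_ne_zero))
    (hB A hA.1 hA.2)
  let P : Matrix (Fin 3) (Fin 3) ℂ := LinearMap.toMatrix' e.toLinearEquiv.toLinearMap
  have hP : ∀ x, P *ᵥ x = e x := fun x => LinearMap.toMatrix'_mulVec _ _
  have hq : ∀ x : Fin 3 → ℂ, (e x) ⬝ᵥ A *ᵥ (e x) = x ⬝ᵥ standardConic *ᵥ x := by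
    intro x
    have := e.map_app x
    rwa [LinearMap.BilinMap.toQuadraticMap_apply, LinearMap.BilinMap.toQuadraticMap_apply,
      Matrix.toLinearMap₂'_apply', Matrix.toLinearMap₂'_apply'] at this
  refine ⟨P, sub_eq_zero.1 (eq_zero_of_quadratic ?_ fun x => ?_)⟩
  · refine Matrix.IsSymm.sub ?_ standardConic_isSymm
    simp only [Matrix.IsSymm, Matrix.transpose_mul, Matrix.transpose_transpose, hA.1.eq,
      Matrix.mul_assoc]
  · rw [Matrix.sub_mulVec, dotProduct_sub, ← Matrix.mulVec_mulVec, ← Matrix.mulVec_mulVec, hP,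
      Matrix.mulVec_transpose, dotProduct_comm x, ← Matrix.dotProduct_mulVec, hP, dotProduct_comm,
      hq, sub_self]

/-- A finite set of points on an irreducible conic is contained in the affine part of a
parametrization of the conic. -/
theorem exists_parametrization {ι : Type*} [Fintype ι] {A : Matrix (Fin 3) (Fin 3) ℂ}
    (hA : IsIrreducibleConic A) {x : ι → Fin 3 → ℂ} (hx : ∀ i, x i ≠ 0)
    (hxA : ∀ i, x i ⬝ᵥ A *ᵥ x i = 0) :
    ∃ (P : Matrix.SpecialLinearGroup (Fin 3) ℂ) (c : ℂ) (t : ι → ℂ), c ≠ 0 ∧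
      P.1ᵀ * A * P.1 = c • standardConic ∧ ∀ i, ∃ s : ℂ, s ≠ 0 ∧
        x i = s • P.1 *ᵥ ![1, t i, t i ^ 2] := by
  obtain ⟨P₀, hP₀⟩ := exists_congr_standardConic hA
  have hdP₀ : P₀.det ≠ 0 := by
    intro h
    have := congrArg Matrix.det hP₀
    rw [Matrix.det_mul, h, mul_zero, standardConic_det] at this
    exact two_ne_zero this.symm
  have hquad : ∀ (P : Matrix (Fin 3) (Fin 3) ℂ) (y : Fin 3 → ℂ),
      (P *ᵥ y) ⬝ᵥ A *ᵥ (P *ᵥ y) = y ⬝ᵥ (Pᵀ * A * P) *ᵥ y := by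
    intro P y
    rw [← Matrix.mulVec_mulVec, ← Matrix.mulVec_mulVec, Matrix.mulVec_transpose,
      dotProduct_comm y, ← Matrix.dotProduct_mulVec, dotProduct_comm]
  have hy : ∀ i, ∃ y, P₀ *ᵥ y = x i := fun i => ⟨P₀⁻¹ *ᵥ x i, by
    rw [Matrix.mulVec_mulVec, Matrix.mul_nonsing_inv _ (isUnit_iff_ne_zero.2 hdP₀),
      Matrix.one_mulVec]⟩
  choose y hy using hy
  have hy0 : ∀ i, y i ≠ 0 := fun i h => hx i (by rw [← hy, h, Matrix.mulVec_zero])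
  have hyq : ∀ i, y i 0 * y i 2 = y i 1 ^ 2 := by
    intro i
    have := hxA i
    rw [← hy, hquad, hP₀] at this
    simp [standardConic, Matrix.mulVec, dotProduct, Fin.sum_univ_three] at this
    linear_combination this / 2
  -- A translation of the parameter moves all the points away from infinity.
  obtain ⟨a, ha⟩ : ∃ a : ℂ, ∀ i, y i 0 + 2 * a * y i 1 + a ^ 2 * y i 2 ≠ 0 := by
    let p : Polynomial ℂ := ∏ i, (Polynomial.C (y i 0) + Polynomial.C (2 * y i 1) * Polynomial.X +
      Polynomial.C (y i 2) * Polynomial.X ^ 2)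
    have hp : p ≠ 0 := Finset.prod_ne_zero_iff.2 fun i _ h => hy0 i (by
      have h0 := congrArg (fun q => Polynomial.coeff q 0) h
      have h1 := congrArg (fun q => Polynomial.coeff q 1) h
      have h2 := congrArg (fun q => Polynomial.coeff q 2) h
      simp [Polynomial.coeff_X, Polynomial.coeff_C, Polynomial.coeff_X_pow] at h0 h1 h2
      funext k
      fin_cases k <;> assumption)
    obtain ⟨a, ha⟩ : ∃ a, p.eval a ≠ 0 := by
      by_contra! H
      exact hp (Polynomial.funext fun a => by rw [H a, Polynomial.eval_zero])
    refine ⟨a, fun i h => ha ?_⟩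
    rw [Polynomial.eval_prod]
    refine Finset.prod_eq_zero (Finset.mem_univ i) ?_
    simp
    linear_combination h
  let S : Matrix (Fin 3) (Fin 3) ℂ := !![1, -2 * a, a ^ 2; 0, 1, -a; 0, 0, 1]
  have hS : Sᵀ * standardConic * S = standardConic := by
    ext i j
    fin_cases i <;> fin_cases j <;>
    · simp [S, standardConic, Matrix.mul_apply, Fin.sum_univ_three]
      try ring
  have hSdet : S.det = 1 := by simp [S, Matrix.det_fin_three]
  obtain ⟨r, hr⟩ := IsAlgClosed.exists_pow_nat_eq (P₀.det)⁻¹ (show 0 < 3 by norm_num)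
  have hr0 : r ≠ 0 := by
    rintro rfl
    rw [zero_pow (by norm_num), eq_comm, inv_eq_zero] at hr
    exact hdP₀ hr
  have hdet : (r • (P₀ * S)).det = 1 := by
    rw [Matrix.det_smul, Fintype.card_fin, hr, Matrix.det_mul, hSdet, mul_one,
      inv_mul_cancel₀ hdP₀]
  refine ⟨⟨_, hdet⟩, r ^ 2, fun i => (y i 1 + a * y i 2) / (y i 0 + 2 * a * y i 1 + a ^ 2 * y i 2),
    pow_ne_zero 2 hr0, ?_, fun i =>
      ⟨(y i 0 + 2 * a * y i 1 + a ^ 2 * y i 2) / r, div_ne_zero (ha i) hr0, ?_⟩⟩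
  · rw [← hS, ← hP₀]
    simp only [Matrix.transpose_smul, Matrix.transpose_mul, Matrix.smul_mul, Matrix.mul_smul,
      smul_smul, Matrix.mul_assoc, pow_two]
  · have e : ((y i 0 + 2 * a * y i 1 + a ^ 2 * y i 2) / r) • (r • (P₀ * S)) *ᵥ
        ![1, (y i 1 + a * y i 2) / (y i 0 + 2 * a * y i 1 + a ^ 2 * y i 2),
          ((y i 1 + a * y i 2) / (y i 0 + 2 * a * y i 1 + a ^ 2 * y i 2)) ^ 2] =
        P₀ *ᵥ (S *ᵥ ![y i 0 + 2 * a * y i 1 + a ^ 2 * y i 2, y i 1 + a * y i 2, y i 2]) := by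
      rw [Matrix.smul_mulVec, smul_smul, div_mul_cancel₀ _ hr0, ← Matrix.mulVec_smul,
        Matrix.mulVec_mulVec]
      congr 1
      have h := ha i
      have h2 := hyq i
      funext k
      fin_cases k
      · simp
      · simp [mul_div_cancel₀ _ h]
      · simp only [Pi.smul_apply, smul_eq_mul, Fin.reduceFinMk, Matrix.cons_val]
        rw [div_pow, ← mul_div_assoc, div_eq_iff (pow_ne_zero 2 h)]
        linear_combination -(y i 0 + 2 * a * y i 1 + a ^ 2 * y i 2) * h2
    refine Eq.trans ?_ e.symm
    rw [← hy i]
    congr 1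
    funext k
    fin_cases k
    · simp [S, Matrix.mulVec, dotProduct, Fin.sum_univ_three]
      ring
    · simp [S, Matrix.mulVec, dotProduct, Fin.sum_univ_three]
    · simp [S, Matrix.mulVec, dotProduct, Fin.sum_univ_three]

/-- A polynomial of degree at most four with five roots, at most two of which coincide and where
coinciding roots are double roots, vanishes. -/
theorem quartic_eq_zero {F : Polynomial ℂ} (hF : F.natDegree ≤ 4) {t : Fin 5 → ℂ}
    (h3 : ∀ i j k, i ≠ j → i ≠ k → j ≠ k → ¬ (t i = t j ∧ t i = t k))
    (h1 : ∀ i, F.IsRoot (t i)) (h2 : ∀ i j, i ≠ j → t i = t j → F.derivative.IsRoot (t i)) :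
    F = 0 := by
  classical
  by_contra h0
  have hle : Multiset.map t Finset.univ.val ≤ F.roots := by
    rw [Multiset.le_iff_count]
    intro x
    rw [Polynomial.count_roots, Multiset.count_map]
    change (Finset.univ.filter fun i => x = t i).card ≤ _
    have hle2 : (Finset.univ.filter fun i => x = t i).card ≤ 2 := by
      by_contra! H
      obtain ⟨i, hi, j, hj, k, hk, hij, hik, hjk⟩ := Finset.two_lt_card.1 H
      rw [Finset.mem_filter] at hi hj hk
      exact h3 i j k hij hik hjk ⟨hi.2.symm.trans hj.2, hi.2.symm.trans hk.2⟩
    rcases Nat.lt_or_ge 1 (Finset.univ.filter fun i => x = t i).card with H | H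
    · obtain ⟨i, hi, j, hj, hij⟩ := Finset.one_lt_card.1 H
      rw [Finset.mem_filter] at hi hj
      obtain rfl := hi.2
      have := (Polynomial.one_lt_rootMultiplicity_iff_isRoot h0).2 ⟨h1 i, h2 i j hij hj.2⟩
      omega
    · rcases Finset.eq_empty_or_nonempty (Finset.univ.filter fun i => x = t i) with H' | ⟨i, hi⟩
      · rw [H', Finset.card_empty]
        exact Nat.zero_le _
      · obtain rfl := (Finset.mem_filter.1 hi).2
        have := (Polynomial.rootMultiplicity_pos h0).2 (h1 i)
        omega
  have := (Multiset.card_le_card hle).trans (Polynomial.card_roots' F)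
  simp at this
  omega

theorem eq_smul_of_cross_eq_zero {u w : Fin 3 → ℂ} (hw : w ≠ 0) (h : u ⨯₃ w = 0) :
    ∃ b : ℂ, u = b • w := by
  obtain ⟨k, hk⟩ := Function.ne_iff.1 hw
  rw [Pi.zero_apply] at hk
  have h0 := congrFun h 0
  have h1 := congrFun h 1
  have h2 := congrFun h 2
  simp [cross_apply] at h0 h1 h2
  refine ⟨u k / w k, ?_⟩
  funext j
  rw [Pi.smul_apply, smul_eq_mul, div_mul_eq_mul_div, eq_div_iff hk]
  fin_cases k <;> fin_cases j <;> simp <;>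
    first
    | linear_combination h0
    | linear_combination h1
    | linear_combination h2
    | linear_combination -h0
    | linear_combination -h1
    | linear_combination -h2

/-- Two vectors orthogonal to a nonzero vector have a cross product proportional to it. -/
theorem cross_eq_smul {u v w : Fin 3 → ℂ} (hw : w ≠ 0) (hu : w ⬝ᵥ u = 0) (hv : w ⬝ᵥ v = 0) :
    ∃ b : ℂ, u ⨯₃ v = b • w := by
  refine eq_smul_of_cross_eq_zero hw ?_
  rw [cross_cross_eq_smul_sub_smul, dotProduct_comm u, hu, dotProduct_comm v, hv, zero_smul,
    zero_smul, sub_zero]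

/-- The pair of two distinct labels. -/
def pairOf {i j : Six} (h : i ≠ j) : Pair := ⟨s(i, j), by simpa using h⟩

theorem pairOf_comm {i j : Six} (h : i ≠ j) : pairOf h = pairOf h.symm :=
  Subtype.ext Sym2.eq_swap

theorem inl_ne_inl {i j : Fin 5} (h : i ≠ j) : (Sum.inl i : Six) ≠ Sum.inl j := by simpa using h

/-- Vectors representing points and lines, incident with each other, at most two of the points
coinciding at any place. -/
structure IsAdmissible (m : Six → Fin 3 → ℂ) (l : Pair → Fin 3 → ℂ) : Prop where
  point_ne : ∀ i, m i ≠ 0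
  line_ne : ∀ e, l e ≠ 0
  incident : ∀ (e : Pair) i, i ∈ e.1 → l e ⬝ᵥ m i = 0
  not_triple : ∀ i j k, i ≠ j → i ≠ k → j ≠ k → ¬ (m i ⨯₃ m j = 0 ∧ m i ⨯₃ m k = 0)

/-- The irreducible conic contains the first five points, and where two of them coincide it is
tangent to the line belonging to them. -/
structure IsFiveConic (m : Six → Fin 3 → ℂ) (l : Pair → Fin 3 → ℂ)
    (A : Matrix (Fin 3) (Fin 3) ℂ) : Prop where
  conic : IsIrreducibleConic A
  on : ∀ i : Fin 5, m (Sum.inl i) ⬝ᵥ A *ᵥ m (Sum.inl i) = 0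
  tangent : ∀ (i j : Fin 5) (h : i ≠ j), m (Sum.inl i) ⨯₃ m (Sum.inl j) = 0 →
    (A *ᵥ m (Sum.inl i)) ⨯₃ l (pairOf (inl_ne_inl h)) = 0

/-- Linear conditions on a symmetric matrix which say that the conic contains the first five points
and intersects the lines belonging to them in these points. They are polynomial in the
configuration, and make sense when points coincide: with `n = l × w` a further point of the line
through `x` and `y`, and `w` a coordinate vector, `⟨w, y⟩ x + ⟨w, x⟩ y` is conjugate to `n`, being
so in the pencil of quadratic forms on the line that vanish at `x` and `y`. -/
structure IsSecantConic (m : Six → Fin 3 → ℂ) (l : Pair → Fin 3 → ℂ)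
    (A : Matrix (Fin 3) (Fin 3) ℂ) : Prop where
  symm : ∀ i j, A i j - A j i = 0
  on : ∀ i : Fin 5, m (Sum.inl i) ⬝ᵥ A *ᵥ m (Sum.inl i) = 0
  secant : ∀ (i j : Fin 5) (h : i ≠ j) (k : Fin 3), (l (pairOf (inl_ne_inl h)) ⨯₃ Pi.single k 1) ⬝ᵥ
    A *ᵥ (m (Sum.inl j) k • m (Sum.inl i) + m (Sum.inl i) k • m (Sum.inl j)) = 0

variable {m : Six → Fin 3 → ℂ} {l : Pair → Fin 3 → ℂ}

theorem IsAdmissible.incident_left (hc : IsAdmissible m l) {i j : Six} (h : i ≠ j) :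
    l (pairOf h) ⬝ᵥ m i = 0 := hc.incident _ _ (Sym2.mem_mk_left _ _)

theorem IsAdmissible.incident_right (hc : IsAdmissible m l) {i j : Six} (h : i ≠ j) :
    l (pairOf h) ⬝ᵥ m j = 0 := hc.incident _ _ (Sym2.mem_mk_right _ _)

theorem IsFiveConic.isSecantConic (hc : IsAdmissible m l) {A : Matrix (Fin 3) (Fin 3) ℂ}
    (hA : IsFiveConic m l A) : IsSecantConic m l A where
  symm i j := by rw [← hA.conic.1.apply i j, sub_self]
  on := hA.on
  secant i j h k := by
    have hl := hc.line_ne (pairOf (inl_ne_inl h))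
    have h1 := hc.incident_left (inl_ne_inl h)
    have h2 := hc.incident_right (inl_ne_inl h)
    have hi := hA.on i
    have hj := hA.on j
    have ht := hA.tangent i j h
    have hmi := hc.point_ne (Sum.inl i)
    generalize m (Sum.inl i) = x at *
    generalize m (Sum.inl j) = y at *
    generalize l (pairOf (inl_ne_inl h)) = n at *
    obtain ⟨b, hb⟩ := cross_eq_smul hl h1 h2
    by_cases h0 : x ⨯₃ y = 0
    · obtain ⟨r, hr⟩ := eq_smul_of_cross_eq_zero hl (ht h0)
      obtain ⟨s, hs⟩ := eq_smul_of_cross_eq_zero hmi (show y ⨯₃ x = 0 by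
        rw [← cross_anticomm, h0, neg_zero])
      rw [hs, smul_smul, ← add_smul, Matrix.mulVec_smul, hr, dotProduct_smul, dotProduct_smul,
        dotProduct_comm, dot_self_cross, smul_zero, smul_zero]
    · have hb0 : b ≠ 0 := by
        rintro rfl
        exact h0 (by rw [hb, zero_smul])
      have e : b • (n ⨯₃ Pi.single k 1) = x k • y - y k • x := by
        rw [← LinearMap.smul_apply, ← map_smul, ← hb, cross_cross_eq_smul_sub_smul]
        simp
      refine (mul_eq_zero.1 (?_ : b * _ = 0)).resolve_left hb0
      rw [← smul_eq_mul, ← smul_dotProduct, e]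
      simp only [sub_dotProduct, smul_dotProduct, Matrix.mulVec_add, Matrix.mulVec_smul,
        dotProduct_add, dotProduct_smul, hi, hj, polar_comm hA.conic.1 y x, smul_eq_mul]
      ring

/-- The conic through five points, at most two of which coincide at any place, is unique, even
among the possibly degenerate conics satisfying the secant conditions. In a parametrization of the
conic the quadratic form becomes a quartic polynomial with five roots, counted with
multiplicity. -/
theorem IsFiveConic.eq_smul (hc : IsAdmissible m l) {A B : Matrix (Fin 3) (Fin 3) ℂ}
    (hA : IsFiveConic m l A) (hB : IsSecantConic m l B) : ∃ s : ℂ, B = s • A := by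
  obtain ⟨P, c, t, hc0, hPA, ht⟩ := exists_parametrization hA.conic
    (x := fun i : Fin 5 => m (Sum.inl i)) (fun i => hc.point_ne _) hA.on
  choose s hs0 hs using ht
  have hBsymm : B.IsSymm := Matrix.IsSymm.ext fun i j => by
    rw [← sub_eq_zero]; exact hB.symm j i
  set N := P.1ᵀ * B * P.1 with hN
  have hNsymm : ∀ i j, N i j = N j i := by
    have : N.IsSymm := by
      simp only [hN, Matrix.IsSymm, Matrix.transpose_mul, Matrix.transpose_transpose, hBsymm.eq,
        Matrix.mul_assoc]
    exact fun i j => (this.apply i j).symm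
  have hpol : ∀ (C : Matrix (Fin 3) (Fin 3) ℂ) (x y : Fin 3 → ℂ),
      (P.1 *ᵥ x) ⬝ᵥ C *ᵥ (P.1 *ᵥ y) = x ⬝ᵥ (P.1ᵀ * C * P.1) *ᵥ y := by
    intro C x y
    rw [← Matrix.mulVec_mulVec, ← Matrix.mulVec_mulVec, Matrix.mulVec_transpose,
      dotProduct_comm x, ← Matrix.dotProduct_mulVec, dotProduct_comm]
  have hon : ∀ i, ![1, t i, t i ^ 2] ⬝ᵥ N *ᵥ ![1, t i, t i ^ 2] = 0 := by
    intro i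
    have := hB.on i
    simp only [hs, Matrix.mulVec_smul, dotProduct_smul, smul_dotProduct, smul_eq_mul, hpol] at this
    exact ((mul_eq_zero.1 ((mul_eq_zero.1 this).resolve_left (hs0 i))).resolve_left (hs0 i))
  -- At coinciding points the quadratic form vanishes along the tangent direction.
  have htan : ∀ i j, i ≠ j → t i = t j → ![0, 1, 2 * t i] ⬝ᵥ N *ᵥ ![1, t i, t i ^ 2] = 0 := by
    intro i j hij htij
    have hl := hc.line_ne (pairOf (inl_ne_inl hij))
    have h1 := hc.incident_left (inl_ne_inl hij)
    have hcr : m (Sum.inl i) ⨯₃ m (Sum.inl j) = 0 := by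
      rw [hs i, hs j, htij]
      simp
    obtain ⟨r, hr⟩ := eq_smul_of_cross_eq_zero hl (hA.tangent i j hij hcr)
    have hr0 : r ≠ 0 := by
      rintro rfl
      rw [zero_smul] at hr
      exact hc.point_ne (Sum.inl i) (Matrix.eq_zero_of_mulVec_eq_zero hA.conic.2 hr)
    have hy : l (pairOf (inl_ne_inl hij)) ⬝ᵥ (P.1 *ᵥ ![0, 1, 2 * t i]) = 0 := by
      refine (mul_eq_zero.1 (?_ : r * _ = 0)).resolve_left hr0
      rw [← smul_eq_mul, ← smul_dotProduct, ← hr, hs i, Matrix.mulVec_smul, smul_dotProduct,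
        dotProduct_comm, hpol, hPA]
      simp [standardConic, Matrix.mulVec, dotProduct, Fin.sum_univ_three]
      right
      ring
    obtain ⟨k, hk⟩ := Function.ne_iff.1 (hc.point_ne (Sum.inl i))
    rw [Pi.zero_apply] at hk
    obtain ⟨b, hb⟩ := cross_eq_smul hl h1 hy
    have hsec := hB.secant i j hij k
    have hmj : m (Sum.inl j) = (s j / s i) • m (Sum.inl i) := by
      rw [hs i, hs j, htij, smul_smul, div_mul_cancel₀ _ (hs0 i)]
    have hsec' : (l (pairOf (inl_ne_inl hij)) ⨯₃ Pi.single k 1) ⬝ᵥ B *ᵥ m (Sum.inl i) = 0 := by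
      rw [hmj, smul_smul, ← add_smul, Matrix.mulVec_smul, dotProduct_smul, smul_eq_mul] at hsec
      refine (mul_eq_zero.1 hsec).resolve_left ?_
      rw [Pi.smul_apply, smul_eq_mul, mul_comm, ← mul_add, ← two_mul, mul_comm]
      exact mul_ne_zero (mul_ne_zero two_ne_zero (div_ne_zero (hs0 j) (hs0 i))) hk
    have e : b • (l (pairOf (inl_ne_inl hij)) ⨯₃ Pi.single k 1) =
        m (Sum.inl i) k • (P.1 *ᵥ ![0, 1, 2 * t i]) -
          (P.1 *ᵥ ![0, 1, 2 * t i]) k • m (Sum.inl i) := by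
      rw [← LinearMap.smul_apply, ← map_smul, ← hb, cross_cross_eq_smul_sub_smul]
      simp
    have h3 := congrArg (fun z => z ⬝ᵥ B *ᵥ m (Sum.inl i)) e
    simp only [smul_dotProduct, sub_dotProduct, hsec', hB.on i, mul_zero, sub_zero,
      smul_eq_mul] at h3
    have h4 := (mul_eq_zero.1 h3.symm).resolve_left hk
    rw [hs i, Matrix.mulVec_smul, dotProduct_smul, hpol, smul_eq_mul] at h4
    exact (mul_eq_zero.1 h4).resolve_left (hs0 i)
  let F : Polynomial ℂ := Polynomial.C (N 0 0) + Polynomial.C (2 * N 0 1) * Polynomial.X +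
    Polynomial.C (2 * N 0 2 + N 1 1) * Polynomial.X ^ 2 +
    Polynomial.C (2 * N 1 2) * Polynomial.X ^ 3 + Polynomial.C (N 2 2) * Polynomial.X ^ 4
  have hF : F = 0 := by
    refine quartic_eq_zero (t := t) (by simp only [F]; compute_degree) ?_ (fun i => ?_)
      fun i j hij h => ?_
    · rintro i j k hij hik hjk ⟨e1, e2⟩
      refine hc.not_triple (Sum.inl i) (Sum.inl j) (Sum.inl k) (inl_ne_inl hij) (inl_ne_inl hik)
        (inl_ne_inl hjk) ⟨?_, ?_⟩
      · rw [hs i, hs j, e1]; simp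
      · rw [hs i, hs k, e2]; simp
    · have := hon i
      simp [Matrix.mulVec, dotProduct, Fin.sum_univ_three] at this
      rw [hNsymm 1 0, hNsymm 2 0, hNsymm 2 1] at this
      simp only [F, Polynomial.IsRoot, Polynomial.eval_add, Polynomial.eval_mul,
        Polynomial.eval_C, Polynomial.eval_X, Polynomial.eval_pow]
      linear_combination this
    · have := htan i j hij h
      simp [Matrix.mulVec, dotProduct, Fin.sum_univ_three] at this
      rw [hNsymm 1 0, hNsymm 2 0, hNsymm 2 1] at this
      simp [F, Polynomial.IsRoot]
      linear_combination 2 * this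
  have c0 := congrArg (fun q => Polynomial.coeff q 0) hF
  have c1 := congrArg (fun q => Polynomial.coeff q 1) hF
  have c2 := congrArg (fun q => Polynomial.coeff q 2) hF
  have c3 := congrArg (fun q => Polynomial.coeff q 3) hF
  have c4 := congrArg (fun q => Polynomial.coeff q 4) hF
  simp only [F, Polynomial.coeff_add, Polynomial.coeff_C_mul, Polynomial.coeff_X,
    Polynomial.coeff_C, Polynomial.coeff_X_pow, Polynomial.coeff_zero] at c0 c1 c2 c3 c4
  norm_num at c0 c1 c2 c3 c4
  have hNJ : N = N 0 2 • standardConic := by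
    ext i j
    fin_cases i <;> fin_cases j <;> simp [standardConic, c0, c1, c3, c4, hNsymm 1 0, hNsymm 2 0,
      hNsymm 2 1]
    linear_combination c2
  refine ⟨N 0 2 / c, sub_eq_zero.1 ?_⟩
  have hd : P.1ᵀ * (B - (N 0 2 / c) • A) * P.1 = 0 := by
    rw [Matrix.mul_sub, Matrix.sub_mul, Matrix.mul_smul, Matrix.smul_mul, hPA, smul_smul,
      div_mul_cancel₀ _ hc0, ← hNJ, sub_self]
  have hu : IsUnit P.1.det := by rw [P.2]; exact isUnit_one
  have hut : IsUnit P.1ᵀ.det := by rwa [Matrix.det_transpose]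
  have := congrArg (fun X => P.1ᵀ⁻¹ * X * P.1⁻¹) hd
  simpa [Matrix.mul_assoc, Matrix.nonsing_inv_mul_cancel_left _ _ hut, Matrix.mul_nonsing_inv _ hu]
    using this

/-! ### Regular solutions of linear equations -/

theorem FunctionSpace.regular_mulVec {X : Type*} (S : FunctionSpace X) {R n : Type*} [Fintype n]
    {U : Set X} {M : X → Matrix R n ℂ} {v : X → n → ℂ}
    (hM : ∀ i j, S.IsRegular U fun x => M x i j) (hv : ∀ j, S.IsRegular U fun x => v x j) (i : R) :
    S.IsRegular U fun x => (M x *ᵥ v x) i :=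
  S.regular_sum _ fun j _ => S.regular_mul _ _ _ (hM i j) (hv j)

theorem FunctionSpace.regular_dotProduct {X : Type*} (S : FunctionSpace X) {n : Type*} [Fintype n]
    {U : Set X} {u v : X → n → ℂ} (hu : ∀ j, S.IsRegular U fun x => u x j)
    (hv : ∀ j, S.IsRegular U fun x => v x j) : S.IsRegular U fun x => u x ⬝ᵥ v x :=
  S.regular_sum _ fun j _ => S.regular_mul _ _ _ (hu j) (hv j)

open Classical in
/-- If a system of linear equations with regular coefficients has at some point a one-dimensional
space of solutions, then nearby all solutions are multiples of a regular family of vectors. The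
system is completed by one inhomogeneous equation that normalizes the solution, and Cramer's rule
is applied. -/
theorem exists_regular_kernel {X : Type*} {S : FunctionSpace X} (hS : S.IsLocal)
    {R n : Type*} [Fintype R] [Fintype n] {N : X → Matrix R n ℂ}
    (hN : ∀ r j, S.IsRegular Set.univ fun x => N x r j) (x₀ : X) {a₀ : n → ℂ} (h₀ : a₀ ≠ 0)
    (hker : ∀ b, N x₀ *ᵥ b = 0 → ∃ s : ℂ, b = s • a₀) :
    ∃ (U : Set X) (a : X → n → ℂ), IsOpen[S.top] U ∧ x₀ ∈ U ∧
      (∀ j, S.IsRegular U fun x => a x j) ∧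
      ∀ x ∈ U, ∀ b, N x *ᵥ b = 0 → ∃ s : ℂ, b = s • a x := by
  obtain ⟨k, hk⟩ := Function.ne_iff.1 h₀
  rw [Pi.zero_apply] at hk
  let N' : X → Matrix (Option R) n ℂ := fun x => Matrix.of fun r =>
    Option.elim r (Pi.single k 1) (N x)
  have hN' : ∀ r j, S.IsRegular Set.univ fun x => N' x r j := by
    intro r j
    cases r with
    | none => exact S.regular_const _ (Pi.single (M := fun _ => ℂ) k 1 j)
    | some r => exact hN r j
  have hN'b : ∀ x b, N x *ᵥ b = 0 → N' x *ᵥ b = Pi.single none (b k) := by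
    intro x b hb
    funext r
    cases r with
    | none =>
      change (Pi.single k 1 : n → ℂ) ⬝ᵥ b = _
      simp
    | some r =>
      rw [Pi.single_eq_of_ne (by simp)]
      exact congrFun hb r
  have hinj : Function.Injective (Matrix.toLin' (N' x₀)) := by
    rw [← LinearMap.ker_eq_bot, LinearMap.ker_eq_bot']
    intro b hb
    rw [Matrix.toLin'_apply] at hb
    obtain ⟨s, rfl⟩ := hker b (funext fun r => congrFun hb (some r))
    have h1 : (Pi.single k 1 : n → ℂ) ⬝ᵥ (s • a₀) = 0 := congrFun hb none
    rw [single_one_dotProduct, Pi.smul_apply, smul_eq_mul] at h1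
    rw [(mul_eq_zero.1 h1).resolve_right hk, zero_smul]
  obtain ⟨C, hC⟩ := LinearMap.exists_leftInverse_of_injective _ (LinearMap.ker_eq_bot.2 hinj)
  obtain ⟨C', hCN⟩ : ∃ C' : Matrix n (Option R) ℂ, C' * N' x₀ = 1 := by
    have h := congrArg LinearMap.toMatrix' hC
    rw [LinearMap.toMatrix'_comp, LinearMap.toMatrix'_toLin', LinearMap.toMatrix'_id] at h
    exact ⟨_, h⟩
  have hB : ∀ i j, S.IsRegular Set.univ fun x => (C' * N' x) i j := fun i j =>
    S.regular_sum _ fun r _ => S.regular_mul _ _ _ (S.regular_const _ _) (hN' r j)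
  have hadj : ∀ i j, S.IsRegular Set.univ fun x => (C' * N' x).adjugate i j := by
    intro i j
    simp only [Matrix.adjugate_apply]
    refine S.regular_det fun a b => ?_
    by_cases h : a = j
    · subst h
      simp only [Matrix.updateRow_self]
      exact S.regular_const _ (Pi.single (M := fun _ => ℂ) i 1 b)
    · simp only [Matrix.updateRow_ne h]
      exact hB a b
  refine ⟨Set.univ ∩ {x | (C' * N' x).det ≠ 0},
    fun x => (C' * N' x).adjugate *ᵥ fun j => C' j none,
    hS.isOpen_ne Set.univ _ S.isOpen_univ (S.regular_det hB), ⟨trivial, ?_⟩, ?_, ?_⟩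
  · rw [Set.mem_ofPred_eq, hCN, Matrix.det_one]
    exact one_ne_zero
  · intro j
    exact S.regular_restrict _ _ _ (Set.subset_univ _)
      (S.regular_mulVec (v := fun _ j => C' j none) hadj (fun j => S.regular_const _ (C' j none)) j)
  · rintro x ⟨-, hx⟩ b hb
    rw [Set.mem_ofPred_eq] at hx
    have h1 : (C' * N' x) *ᵥ b = b k • fun j => C' j none := by
      rw [← Matrix.mulVec_mulVec, hN'b x b hb]
      funext j
      rw [Matrix.mulVec_single]
      exact mul_comm _ _
    have h2 := congrArg (fun z => (C' * N' x).adjugate *ᵥ z) h1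
    simp only [Matrix.mulVec_mulVec, Matrix.adjugate_mul, Matrix.smul_mulVec, Matrix.one_mulVec,
      Matrix.mulVec_smul] at h2
    refine ⟨b k / (C' * N' x).det, ?_⟩
    change b = _ • ((C' * N' x).adjugate *ᵥ fun j => C' j none)
    rw [div_eq_inv_mul, mul_smul, ← h2, smul_smul, inv_mul_cancel₀ hx, one_smul]

variable {m : Six → Fin 3 → ℂ} {l : Pair → Fin 3 → ℂ}

/-- The conditions of `IsSecantConic` as a system of linear equations for the coefficients. -/
noncomputable def secantMatrix (m : Six → Fin 3 → ℂ) (l : Pair → Fin 3 → ℂ) :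
    Matrix ((Fin 3 × Fin 3) ⊕ Fin 5 ⊕ ({p : Fin 5 × Fin 5 // p.1 ≠ p.2} × Fin 3)) (Fin 3 × Fin 3) ℂ :=
  Matrix.of <| Sum.elim (fun e => Pi.single e 1 - Pi.single e.swap 1) <|
    Sum.elim (fun i e => m (Sum.inl i) e.1 * m (Sum.inl i) e.2) fun p e =>
      (l (pairOf (inl_ne_inl p.1.2)) ⨯₃ Pi.single p.2 1) e.1 *
        (m (Sum.inl p.1.1.2) p.2 • m (Sum.inl p.1.1.1) +
          m (Sum.inl p.1.1.1) p.2 • m (Sum.inl p.1.1.2)) e.2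

theorem secantMatrix_mulVec_eq_zero_iff {b : Fin 3 × Fin 3 → ℂ} :
    secantMatrix m l *ᵥ b = 0 ↔ IsSecantConic m l (Matrix.of fun i j => b (i, j)) := by
  have hd : ∀ u v : Fin 3 → ℂ, (fun e : Fin 3 × Fin 3 => u e.1 * v e.2) ⬝ᵥ b =
      u ⬝ᵥ (Matrix.of fun i j => b (i, j)) *ᵥ v := by
    intro u v
    simp [dotProduct, Matrix.mulVec, Fintype.sum_prod_type, Fin.sum_univ_three]
    ring
  have hs : ∀ e : Fin 3 × Fin 3, (Pi.single e 1 - Pi.single e.swap 1 : Fin 3 × Fin 3 → ℂ) ⬝ᵥ b =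
      b e - b e.swap := by
    intro e
    rw [sub_dotProduct, single_one_dotProduct, single_one_dotProduct]
  constructor
  · intro h
    refine ⟨fun i j => ?_, fun i => ?_, fun i j hij k => ?_⟩
    · exact (hs (i, j)).symm.trans (congrFun h (Sum.inl (i, j)))
    · exact (hd _ _).symm.trans (congrFun h (Sum.inr (Sum.inl i)))
    · exact (hd _ _).symm.trans (congrFun h (Sum.inr (Sum.inr ⟨⟨(i, j), hij⟩, k⟩)))
  · intro h
    funext r
    rcases r with e | i | ⟨⟨⟨i, j⟩, hij⟩, k⟩
    · exact (hs e).trans (h.symm e.1 e.2)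
    · exact (hd _ _).trans (h.on i)
    · exact (hd _ _).trans (h.secant i j hij k)

/-- Locally, the conic through the first five points depends regularly on the configuration. -/
theorem exists_regular_conic {X : Type*} {S : FunctionSpace X} (hS : S.IsLocal)
    {m : X → Six → Fin 3 → ℂ} {l : X → Pair → Fin 3 → ℂ}
    (hm : ∀ i k, S.IsRegular Set.univ fun x => m x i k)
    (hl : ∀ e k, S.IsRegular Set.univ fun x => l x e k)
    (hc : ∀ x, IsAdmissible (m x) (l x)) (hA : ∀ x, ∃ A, IsFiveConic (m x) (l x) A) (x₀ : X) :
    ∃ (U : Set X) (A : X → Matrix (Fin 3) (Fin 3) ℂ), IsOpen[S.top] U ∧ x₀ ∈ U ∧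
      (∀ i j, S.IsRegular U fun x => A x i j) ∧ ∀ x ∈ U, IsFiveConic (m x) (l x) (A x) := by
  obtain ⟨A₀, hA₀⟩ := hA x₀
  have hreg : ∀ r j, S.IsRegular Set.univ fun x => secantMatrix (m x) (l x) r j := by
    rintro (e | i | p) j
    · exact S.regular_const _ ((Pi.single e 1 - Pi.single e.swap 1 : Fin 3 × Fin 3 → ℂ) j)
    · exact S.regular_mul _ _ _ (hm _ _) (hm _ _)
    · refine S.regular_mul _ _ _ ?_ (S.regular_add _ _ _ (S.regular_mul _ _ _ (hm _ _) (hm _ _))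
        (S.regular_mul _ _ _ (hm _ _) (hm _ _)))
      have hcr : ∀ a b : Fin 3, S.IsRegular Set.univ fun x =>
          l x (pairOf (inl_ne_inl p.1.2)) a * (Pi.single p.2 1 : Fin 3 → ℂ) b := fun a b =>
        S.regular_mul _ _ _ (hl _ _) (S.regular_const _ _)
      simp only [cross_apply]
      obtain ⟨j, -⟩ := j
      fin_cases j
      · exact S.regular_sub (hcr 1 2) (hcr 2 1)
      · exact S.regular_sub (hcr 2 0) (hcr 0 2)
      · exact S.regular_sub (hcr 0 1) (hcr 1 0)
  have hA₀0 : (fun e : Fin 3 × Fin 3 => A₀ e.1 e.2) ≠ 0 := by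
    intro h
    refine hA₀.conic.2 ?_
    rw [show A₀ = 0 by ext i j; exact congrFun h (i, j)]
    simp
  obtain ⟨U, a, hU, hxU, ha, hab⟩ := exists_regular_kernel hS hreg x₀ hA₀0 fun b hb => by
    obtain ⟨s, hs⟩ := hA₀.eq_smul (hc x₀) (secantMatrix_mulVec_eq_zero_iff.1 hb)
    exact ⟨s, funext fun e => congrFun (congrFun hs e.1) e.2⟩
  refine ⟨U, fun x => Matrix.of fun i j => a x (i, j), hU, hxU, fun i j => ha (i, j),
    fun x hx => ?_⟩
  obtain ⟨A, hA⟩ := hA x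
  obtain ⟨s, hs⟩ := hab x hx (fun e => A e.1 e.2)
    (secantMatrix_mulVec_eq_zero_iff.2 (hA.isSecantConic (hc x)))
  have hAs : A = s • Matrix.of fun i j => a x (i, j) := by
    ext i j
    exact congrFun hs (i, j)
  have hs0 : s ≠ 0 := by
    rintro rfl
    refine hA.conic.2 ?_
    rw [hAs]
    simp
  have hAs' : (Matrix.of fun i j => a x (i, j)) = s⁻¹ • A := by
    rw [hAs, smul_smul, inv_mul_cancel₀ hs0, one_smul]
  change IsFiveConic (m x) (l x) (Matrix.of fun i j => a x (i, j))
  rw [hAs']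
  refine ⟨⟨hA.conic.1.smul _, ?_⟩, fun i => ?_, fun i j h h' => ?_⟩
  · rw [Matrix.det_smul]
    exact mul_ne_zero (pow_ne_zero _ (inv_ne_zero hs0)) hA.conic.2
  · rw [Matrix.smul_mulVec, dotProduct_smul, hA.on, smul_zero]
  · rw [Matrix.smul_mulVec, map_smul, LinearMap.smul_apply, hA.tangent i j h h', smul_zero]

/-! ### Projection from the sixth point -/

/-- The quadratic form whose zeros are the points on the tangent lines from `c` to the conic. -/
def tangentForm (A : Matrix (Fin 3) (Fin 3) ℂ) (c y : Fin 3 → ℂ) : ℂ :=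
  (c ⬝ᵥ A *ᵥ c) * (y ⬝ᵥ A *ᵥ y) - (c ⬝ᵥ A *ᵥ y) ^ 2

theorem inl_ne_inr (i : Fin 5) : (Sum.inl i : Six) ≠ Sum.inr 0 := by simp

/-- The seven vectors `v` represent the seven points on the line obtained from a configuration of
points and lines: in the pencil of lines through the sixth point, which is identified with the
projective line by the projection `π`, the first five are the lines joining the sixth point with the
others, and the last two are the tangent lines to the conic through the first five points. If the
sixth point lies on the conic, the last two are equal to the tangent line at this point. -/
structure IsTangentProjection (m : Six → Fin 3 → ℂ) (l : Pair → Fin 3 → ℂ)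
    (A : Matrix (Fin 3) (Fin 3) ℂ) (π : (Fin 3 → ℂ) →ₗ[ℂ] (Fin 2 → ℂ)) (v : Seven × Fin 2 → ℂ) :
    Prop where
  five : IsFiveConic m l A
  surj : Function.Surjective π
  ker : ∀ y, π y = 0 ↔ ∃ a : ℂ, y = a • m (Sum.inr 0)
  line : ∀ i : Fin 5, ∃ a : ℂ, a ≠ 0 ∧
    ∀ y, l (pairOf (inl_ne_inr i)) ⬝ᵥ y = a * bracket (π y) fun k => v (Sum.inl i, k)
  quad : ∃ a : ℂ, a ≠ 0 ∧ ∀ y, tangentForm A (m (Sum.inr 0)) y =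
    a * (bracket (π y) fun k => v (Sum.inr 0, k)) * bracket (π y) fun k => v (Sum.inr 1, k)

/-- The polarization of `tangentForm`. -/
def tangentBilin (A : Matrix (Fin 3) (Fin 3) ℂ) (c y z : Fin 3 → ℂ) : ℂ :=
  (c ⬝ᵥ A *ᵥ c) * (y ⬝ᵥ A *ᵥ z) - (c ⬝ᵥ A *ᵥ y) * (c ⬝ᵥ A *ᵥ z)

theorem tangentForm_comb {A : Matrix (Fin 3) (Fin 3) ℂ} (hA : A.IsSymm) (c y z : Fin 3 → ℂ)
    (a b d : ℂ) : tangentForm A c (a • c + b • y + d • z) =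
      b ^ 2 * tangentForm A c y + 2 * (b * d) * tangentBilin A c y z +
        d ^ 2 * tangentForm A c z := by
  simp only [tangentForm, tangentBilin, Matrix.mulVec_add, Matrix.mulVec_smul, dotProduct_add,
    dotProduct_smul, add_dotProduct, smul_dotProduct, smul_eq_mul, polar_comm hA y c,
    polar_comm hA z c, polar_comm hA z y]
  ring

theorem exists_tangentForm_ne_zero {A : Matrix (Fin 3) (Fin 3) ℂ} (hA : IsIrreducibleConic A)
    {c : Fin 3 → ℂ} (hc : c ≠ 0) : ∃ y, tangentForm A c y ≠ 0 := by
  by_contra! H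
  have hM : (c ⬝ᵥ A *ᵥ c) • A - Matrix.vecMulVec (A *ᵥ c) (A *ᵥ c) = 0 := by
    refine eq_zero_of_quadratic ((hA.1.smul _).sub ?_) fun x => ?_
    · rw [Matrix.IsSymm, Matrix.transpose_vecMulVec]
    · rw [← H x, tangentForm, Matrix.sub_mulVec, dotProduct_sub, Matrix.smul_mulVec,
        dotProduct_smul, smul_eq_mul, Matrix.vecMulVec_mulVec, polar_comm hA.1 c x]
      simp [dotProduct_comm (A *ᵥ c) x, pow_two]
  rw [sub_eq_zero] at hM
  have h0 : c ⬝ᵥ A *ᵥ c = 0 := by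
    have := congrArg Matrix.det hM
    rw [Matrix.det_smul, Fintype.card_fin] at this
    have h2 : (Matrix.vecMulVec (A *ᵥ c) (A *ᵥ c)).det = 0 := by
      rw [Matrix.det_fin_three]
      simp only [Matrix.vecMulVec_apply]
      ring
    rw [h2] at this
    exact pow_eq_zero_iff (by norm_num) |>.1 ((mul_eq_zero.1 this).resolve_right hA.2)
  rw [h0, zero_smul] at hM
  refine hc (Matrix.eq_zero_of_mulVec_eq_zero hA.2 (funext fun i => ?_))
  have := congrFun (congrFun hM i) i
  rw [Matrix.vecMulVec_apply] at this
  exact mul_self_eq_zero.1 this.symm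

theorem tangentForm_smul_self {A : Matrix (Fin 3) (Fin 3) ℂ} (c : Fin 3 → ℂ) (a : ℂ) :
    tangentForm A c (a • c) = 0 := by
  simp only [tangentForm, Matrix.mulVec_smul, dotProduct_smul, smul_dotProduct, smul_eq_mul]
  ring

/-- Two vectors that, together with `c`, give coordinates on the pencil of lines through `c`, the
tangent lines having finite coordinates. -/
theorem exists_frame {A : Matrix (Fin 3) (Fin 3) ℂ} (hA : IsIrreducibleConic A)
    {c : Fin 3 → ℂ} (hc : c ≠ 0) :
    ∃ y z : Fin 3 → ℂ, tangentForm A c y ≠ 0 ∧ (c ⨯₃ y) ⬝ᵥ z ≠ 0 := by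
  obtain ⟨y, hy⟩ := exists_tangentForm_ne_zero hA hc
  have h : c ⨯₃ y ≠ 0 := by
    intro h
    obtain ⟨b, rfl⟩ := eq_smul_of_cross_eq_zero hc (show y ⨯₃ c = 0 by
      rw [← cross_anticomm, h, neg_zero])
    exact hy (tangentForm_smul_self c b)
  obtain ⟨k, hk⟩ := Function.ne_iff.1 h
  exact ⟨y, Pi.single k 1, hy, by rwa [dotProduct_single_one]⟩

/-- The projection from `c` in the coordinates given by `y` and `z`. -/
noncomputable def frameProjection (c y z : Fin 3 → ℂ) : (Fin 3 → ℂ) →ₗ[ℂ] (Fin 2 → ℂ) :=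
  Matrix.mulVecLin (Matrix.of ![c ⨯₃ y, c ⨯₃ z])

/-- Explicit vectors representing the seven points on the line. -/
theorem isTangentProjection_frame (hc : IsAdmissible m l) {A : Matrix (Fin 3) (Fin 3) ℂ}
    (hA : IsFiveConic m l A) {y z : Fin 3 → ℂ} (hy : tangentForm A (m (Sum.inr 0)) y ≠ 0)
    (hz : (m (Sum.inr 0) ⨯₃ y) ⬝ᵥ z ≠ 0) {a b : ℂ}
    (hab : a + b = 2 * tangentBilin A (m (Sum.inr 0)) y z / tangentForm A (m (Sum.inr 0)) y)
    (hab' : a * b = tangentForm A (m (Sum.inr 0)) z / tangentForm A (m (Sum.inr 0)) y) :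
    IsTangentProjection m l A (frameProjection (m (Sum.inr 0)) y z)
      (sevenVec (fun i => ![l (pairOf (inl_ne_inr i)) ⬝ᵥ y, l (pairOf (inl_ne_inr i)) ⬝ᵥ z])
        a b) := by
  have hl := fun i => hc.incident_right (inl_ne_inr i)
  set c := m (Sum.inr 0) with hcdef
  set d := (c ⨯₃ y) ⬝ᵥ z with hd
  have hπ0 : ∀ x, frameProjection c y z x 0 = (c ⨯₃ y) ⬝ᵥ x := fun x => rfl
  have hπ1 : ∀ x, frameProjection c y z x 1 = (c ⨯₃ z) ⬝ᵥ x := fun x => rfl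
  -- Cramer's rule
  have hcr : ∀ x, d • x = ((y ⨯₃ z) ⬝ᵥ x) • c + (-(frameProjection c y z x 1)) • y +
      (frameProjection c y z x 0) • z := by
    intro x
    funext k
    rw [hπ0, hπ1, hd]
    fin_cases k <;> simp [cross_apply, dotProduct, Fin.sum_univ_three] <;> ring
  have hy1 : (c ⨯₃ z) ⬝ᵥ y = -d := by
    simp [hd, cross_apply, dotProduct, Fin.sum_univ_three]
    ring
  have hy0 : (c ⨯₃ y) ⬝ᵥ y = 0 := by
    rw [dotProduct_comm, dot_cross_self]
  have hz1 : (c ⨯₃ z) ⬝ᵥ z = 0 := by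
    rw [dotProduct_comm, dot_cross_self]
  refine ⟨hA, fun w => ⟨(w 0 / d) • z - (w 1 / d) • y, ?_⟩, fun x => ⟨fun h => ?_, ?_⟩,
    fun i => ⟨d⁻¹, inv_ne_zero hz, fun x => ?_⟩,
    ⟨tangentForm A c y / d ^ 2, div_ne_zero hy (pow_ne_zero 2 hz), fun x => ?_⟩⟩
  · funext k
    fin_cases k
    · rw [Fin.mk_zero, hπ0, dotProduct_sub, dotProduct_smul, dotProduct_smul, hy0, ← hd]
      simp [div_mul_cancel₀ _ hz]
    · rw [Fin.mk_one, hπ1, dotProduct_sub, dotProduct_smul, dotProduct_smul, hz1, hy1]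
      simp [div_mul_cancel₀ _ hz]
  · have := hcr x
    rw [h] at this
    simp only [Pi.zero_apply, neg_zero, zero_smul, add_zero] at this
    refine ⟨d⁻¹ * ((y ⨯₃ z) ⬝ᵥ x), ?_⟩
    rw [mul_smul, ← this, smul_smul, inv_mul_cancel₀ hz, one_smul]
  · rintro ⟨s, rfl⟩
    funext k
    fin_cases k
    · rw [Fin.mk_zero, hπ0, dotProduct_smul, dotProduct_comm, dot_self_cross, smul_zero]
      rfl
    · rw [Fin.mk_one, hπ1, dotProduct_smul, dotProduct_comm, dot_self_cross, smul_zero]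
      rfl
  · have := congrArg (fun w => l (pairOf (inl_ne_inr i)) ⬝ᵥ w) (hcr x)
    simp only [dotProduct_add, dotProduct_smul, hl, smul_eq_mul, mul_zero, zero_add] at this
    rw [eq_inv_mul_iff_mul_eq₀ hz, this]
    simp [bracket, sevenVec]
    ring
  · have h1 := congrArg (tangentForm A c) (hcr x)
    rw [tangentForm_comb hA.conic.1] at h1
    have h2 : tangentForm A c (d • x) = d ^ 2 * tangentForm A c x := by
      simp only [tangentForm, Matrix.mulVec_smul, dotProduct_smul, smul_dotProduct, smul_eq_mul]
      ring
    rw [h2] at h1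
    rw [eq_div_iff hy] at hab hab'
    rw [div_mul_eq_mul_div, div_mul_eq_mul_div, eq_div_iff (pow_ne_zero 2 hz), mul_comm, h1]
    simp only [bracket, sevenVec, Sum.elim_inr, Matrix.cons_val_zero, Matrix.cons_val_one]
    linear_combination (frameProjection c y z x 0 * frameProjection c y z x 1) * hab -
      (frameProjection c y z x 0) ^ 2 * hab'

theorem IsFiveConic.exists_isTangentProjection (hc : IsAdmissible m l)
    {A : Matrix (Fin 3) (Fin 3) ℂ} (hA : IsFiveConic m l A) :
    ∃ π v, IsTangentProjection m l A π v := by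
  obtain ⟨y, z, hy, hz⟩ := exists_frame hA.conic (hc.point_ne (Sum.inr 0))
  obtain ⟨a, b, hab, hab'⟩ := exists_roots
    (2 * tangentBilin A (m (Sum.inr 0)) y z / tangentForm A (m (Sum.inr 0)) y)
    (tangentForm A (m (Sum.inr 0)) z / tangentForm A (m (Sum.inr 0)) y)
  exact ⟨_, _, isTangentProjection_frame hc hA hy hz hab hab'⟩

theorem IsTangentProjection.ne_zero (hc : IsAdmissible m l) {A : Matrix (Fin 3) (Fin 3) ℂ}
    {π : (Fin 3 → ℂ) →ₗ[ℂ] (Fin 2 → ℂ)} {v : Seven × Fin 2 → ℂ}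
    (h : IsTangentProjection m l A π v) (i : Seven) : (fun k => v (i, k)) ≠ 0 := by
  intro h0
  have hb : ∀ w, (bracket w fun k => v (i, k)) = 0 := fun w => by
    rw [h0]
    simp [bracket]
  rcases i with i | i
  · obtain ⟨a, -, ha⟩ := h.line i
    refine hc.line_ne (pairOf (inl_ne_inr i)) (dotProduct_eq_zero _ fun y => ?_)
    rw [ha, hb, mul_zero]
  · obtain ⟨a, -, ha⟩ := h.quad
    obtain ⟨y, hy⟩ := exists_tangentForm_ne_zero h.five.conic (hc.point_ne (Sum.inr 0))
    refine hy ?_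
    rw [ha]
    fin_cases i
    · rw [Fin.zero_eta] at hb
      rw [hb, mul_zero, zero_mul]
    · rw [Fin.mk_one] at hb
      rw [hb, mul_zero]

/-! ### The seven points of a generic configuration -/

section

variable {m : Six → Fin 3 → ℂ} {l : Pair → Fin 3 → ℂ}

theorem map_span_eq_of_mk_eq {π : (Fin 3 → ℂ) →ₗ[ℂ] (Fin 2 → ℂ)} {x : Fin 3 → ℂ} (hx : x ≠ 0)
    {u : Fin 2 → ℂ} (hu : u ≠ 0) (hπ : π x ≠ 0) (h : bracket (π x) u = 0) :
    (Projectivization.mk ℂ x hx).submodule.map π = (Projectivization.mk ℂ u hu).submodule := by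
  rw [Projectivization.submodule_mk, Submodule.map_span, Set.image_singleton,
    ← Projectivization.submodule_mk _ hπ, (mk_eq_mk_iff_bracket hπ hu).2 h]

/-- For a generic configuration, `IsTangentProjection` describes the seven points in the definition
of `phi67`. -/
theorem IsTangentProjection.ofVec_eq_sevenPoints (hc : IsAdmissible m l)
    {A : Matrix (Fin 3) (Fin 3) ℂ} {π : (Fin 3 → ℂ) →ₗ[ℂ] (Fin 2 → ℂ)} {v : Seven × Fin 2 → ℂ}
    (h : IsTangentProjection m l A π v)
    (hm : IsGeneric fun i => Projectivization.mk ℂ (m i) (hc.point_ne i)) :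
    ∃ hv, DMZ2.ofVec ⟨v, hv⟩ = sevenPoints ⟨_, hm⟩ := by
  have hv0 := h.ne_zero hc
  have comm := polar_comm h.five.conic.1
  have hon : ∀ i : Fin 5, OnConic A (.mk ℂ (m (Sum.inl i)) (hc.point_ne _)) := fun i =>
    (onConic_mk _).2 (h.five.on i)
  have hl := fun i => hc.incident_left (inl_ne_inr i)
  have hπc : π (m (Sum.inr 0)) = 0 := (h.ker _).2 ⟨1, (one_smul _ _).symm⟩
  have hker : ∀ y, π y = 0 ↔ y ∈ (Projectivization.mk ℂ (m (Sum.inr 0))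
      (hc.point_ne (Sum.inr 0))).submodule := by
    intro y
    rw [h.ker, Projectivization.submodule_mk, Submodule.mem_span_singleton]
    exact ⟨fun ⟨a, ha⟩ => ⟨a, ha.symm⟩, fun ⟨a, ha⟩ => ⟨a, ha.symm⟩⟩
  have hπm : ∀ i : Fin 5, π (m (Sum.inl i)) ≠ 0 := by
    intro i h0
    obtain ⟨a, ha⟩ := (h.ker _).1 h0
    exact hm.ne (inl_ne_inr i) ((Projectivization.mk_eq_mk_iff' ℂ _ _ _ _).2 ⟨a, ha.symm⟩)
  have hq : m (Sum.inr 0) ⬝ᵥ A *ᵥ m (Sum.inr 0) ≠ 0 := by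
    intro h0
    refine hm.2 ⟨A, h.five.conic.1, fun e => h.five.conic.2 (by rw [e]; simp), ?_⟩
    rintro (i | i)
    · exact hon i
    · rw [Subsingleton.elim i 0]
      exact (onConic_mk _).2 h0
  have hcne := hc.point_ne (Sum.inr 0)
  obtain ⟨a, ha, hquad⟩ := h.quad
  obtain ⟨c, hcdef⟩ : ∃ c, m (Sum.inr 0) = c := ⟨_, rfl⟩
  rw [hcdef] at hπc hq hquad
  simp only [hcdef] at hker hcne hl
  -- The point of tangency on the line through `c` and `y`.
  let t : (Fin 3 → ℂ) → Fin 3 → ℂ := fun y => (c ⬝ᵥ A *ᵥ c) • y - (c ⬝ᵥ A *ᵥ y) • c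
  have hπt : ∀ y, π (t y) = (c ⬝ᵥ A *ᵥ c) • π y := fun y => by
    simp only [t, map_sub, map_smul, hπc, smul_zero, sub_zero]
  have hct : ∀ y, c ⬝ᵥ A *ᵥ t y = 0 := fun y => by
    simp only [t, Matrix.mulVec_sub, Matrix.mulVec_smul, dotProduct_sub, dotProduct_smul,
      smul_eq_mul]
    ring
  have htz : ∀ y z, t y ⬝ᵥ A *ᵥ z = tangentBilin A c y z := fun y z => by
    simp only [t, tangentBilin, sub_dotProduct, smul_dotProduct, smul_eq_mul]
  have htt : ∀ y, t y ⬝ᵥ A *ᵥ t y = (c ⬝ᵥ A *ᵥ c) * tangentForm A c y := fun y => by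
    simp only [t, tangentForm, Matrix.mulVec_sub, Matrix.mulVec_smul, dotProduct_sub,
      dotProduct_smul, sub_dotProduct, smul_dotProduct, smul_eq_mul, comm y c]
    ring
  have hy : ∀ j : Fin 2, ∃ y, π y = fun k => v (Sum.inr j, k) := fun j => h.surj _
  choose y hy using hy
  have hform : ∀ j, tangentForm A c (y j) = 0 := by
    intro j
    rw [hquad, hy]
    fin_cases j
    · rw [Fin.zero_eta, bracket_self, mul_zero, zero_mul]
    · rw [Fin.mk_one, bracket_self, mul_zero]
  have hπty : ∀ j, π (t (y j)) ≠ 0 := fun j => by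
    rw [hπt, hy]
    exact smul_ne_zero hq (hv0 _)
  have ht0 : ∀ j, t (y j) ≠ 0 := fun j h0 => hπty j (by rw [h0, map_zero])
  have hproj : IsProjection (fun i => Projectivization.mk ℂ (m i) (hc.point_ne i))
      (spanPoints Seven (Fin 2) ⟨v, hv0⟩) A (fun j => .mk ℂ (t (y j)) (ht0 j)) π := by
    refine ⟨h.five.conic, hon, fun hne => ?_, fun j => (onConic_mk _).2 ?_, fun j => ?_, ?_,
      fun i => ?_, fun j => ?_⟩
    · -- If the points of tangency coincide, then the form on the pencil is degenerate.
      obtain ⟨b, hb⟩ := (Projectivization.mk_eq_mk_iff' ℂ _ _ _ _).1 hne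
      have hv01 : ∀ w, (bracket w fun k => v (Sum.inr 0, k)) =
          b * bracket w fun k => v (Sum.inr 1, k) := by
        have h1 := congrArg π hb
        rw [map_smul, hπt, hπt, hy, hy, smul_comm] at h1
        have h2 := smul_right_injective _ hq h1
        intro w
        rw [← h2]
        simp [bracket]
        ring
      have hbil : ∀ z, t (y 1) ⬝ᵥ A *ᵥ z = 0 := by
        intro z
        have h1 := tangentForm_comb h.five.conic.1 c (y 1) z 0 1 1
        rw [hquad, hquad (y 1), hquad z, hv01, hv01, hv01, map_add, map_add, map_smul, map_smul,
          map_smul, hy 1, bracket_self] at h1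
        rw [htz]
        simp [bracket] at h1
        linear_combination -h1 / 2
      refine ht0 1 (Matrix.eq_zero_of_mulVec_eq_zero h.five.conic.2 (dotProduct_eq_zero _
        fun z => ?_))
      rw [dotProduct_comm, comm, hbil]
    · rw [htt, hform, mul_zero]
    · simp only [hcdef]
      exact (tangent_mk h.five.conic.2 (ht0 j) hcne).2 (by rw [dotProduct_comm, hct])
    · ext z
      rw [LinearMap.mem_ker, hker]
      simp only [hcdef]
    · refine map_span_eq_of_mk_eq (hc.point_ne (Sum.inl i)) (hv0 (Sum.inl i)) (hπm i) ?_
      obtain ⟨b, hb0, hb⟩ := h.line i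
      have := hb (m (Sum.inl i))
      rw [hl] at this
      exact (mul_eq_zero.1 this.symm).resolve_left hb0
    · refine map_span_eq_of_mk_eq (ht0 j) (hv0 (Sum.inr j)) (hπty j) ?_
      rw [hπt, hy]
      simp [bracket]
      ring
  exact ⟨⟨hv0, hproj.isStable hm⟩, (sevenPoints_eq ⟨_, hm⟩ hproj).symm⟩

end

/-! ### Configurations on a conic -/

/-- The parametrization of the standard conic. -/
def veronese (t : Fin 2 → ℂ) : Fin 3 → ℂ := ![t 0 ^ 2, t 0 * t 1, t 1 ^ 2]

/-- The coordinates of the line joining two points of the standard conic, or of the tangent line if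
they coincide. -/
def joinVec (s t : Fin 2 → ℂ) : Fin 3 → ℂ := ![s 1 * t 1, -(s 0 * t 1 + s 1 * t 0), s 0 * t 0]

theorem joinVec_comm (s t : Fin 2 → ℂ) : joinVec s t = joinVec t s := by
  simp [joinVec, mul_comm, add_comm]

theorem joinVec_dotProduct (s t u : Fin 2 → ℂ) :
    joinVec s t ⬝ᵥ veronese u = bracket u s * bracket u t := by
  simp [joinVec, veronese, bracket, dotProduct, Fin.sum_univ_three]
  ring

theorem joinVec_smul (s t : Fin 2 → ℂ) (a b : ℂ) :
    joinVec (a • s) (b • t) = (a * b) • joinVec s t := by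
  funext k
  fin_cases k <;> simp [joinVec] <;> ring

theorem veronese_smul (t : Fin 2 → ℂ) (a : ℂ) : veronese (a • t) = a ^ 2 • veronese t := by
  funext k
  fin_cases k <;> simp [veronese] <;> ring

theorem standardConic_veronese (t : Fin 2 → ℂ) : standardConic *ᵥ veronese t = joinVec t t := by
  funext k
  fin_cases k <;>
    simp [standardConic, veronese, joinVec, Matrix.mulVec, dotProduct, Fin.sum_univ_three] <;> ring

theorem veronese_cross (s t : Fin 2 → ℂ) :
    veronese s ⨯₃ veronese t = bracket s t • joinVec s t := by
  funext k
  fin_cases k <;> simp [veronese, joinVec, bracket, cross_apply] <;> ring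

theorem veronese_ne_zero {t : Fin 2 → ℂ} (ht : t ≠ 0) : veronese t ≠ 0 := by
  intro h
  refine ht (funext fun k => ?_)
  fin_cases k
  · exact pow_eq_zero_iff two_ne_zero |>.1 (congrFun h 0)
  · exact pow_eq_zero_iff two_ne_zero |>.1 (congrFun h 2)

theorem joinVec_ne_zero {s t : Fin 2 → ℂ} (hs : s ≠ 0) (ht : t ≠ 0) : joinVec s t ≠ 0 := by
  intro h
  have h' : ∀ u, bracket u s * bracket u t = 0 := fun u => by
    rw [← joinVec_dotProduct, h, zero_dotProduct]
  have h1 : ∀ {w : Fin 2 → ℂ}, w ≠ 0 → ∀ a b : ℂ, a ≠ b →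
      ¬ (bracket ![1, a] w = 0 ∧ bracket ![1, b] w = 0) := by
    rintro w hw a b hab ⟨e1, e2⟩
    simp [bracket] at e1 e2
    have h0 : w 0 = 0 := by
      refine (mul_eq_zero.1 (?_ : (a - b) * w 0 = 0)).resolve_left (sub_ne_zero.2 hab)
      linear_combination e2 - e1
    refine hw (funext fun k => ?_)
    fin_cases k
    · exact h0
    · change w 1 = 0
      rw [h0] at e1
      linear_combination e1
  -- Two linear forms have at most two zeros together.
  rcases mul_eq_zero.1 (h' ![1, 0]) with e0 | e0 <;> rcases mul_eq_zero.1 (h' ![1, 1]) with e1 | e1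
  · exact h1 hs 0 1 (by norm_num) ⟨e0, e1⟩
  · rcases mul_eq_zero.1 (h' ![1, 2]) with e2 | e2
    · exact h1 hs 0 2 (by norm_num) ⟨e0, e2⟩
    · exact h1 ht 1 2 (by norm_num) ⟨e1, e2⟩
  · rcases mul_eq_zero.1 (h' ![1, 2]) with e2 | e2
    · exact h1 hs 1 2 (by norm_num) ⟨e1, e2⟩
    · exact h1 ht 0 2 (by norm_num) ⟨e0, e2⟩
  · exact h1 ht 0 1 (by norm_num) ⟨e0, e1⟩

theorem eq_smul_of_bracket {u w : Fin 2 → ℂ} (hu : u ≠ 0) (hw : w ≠ 0) (h : bracket u w = 0) :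
    ∃ a : ℂ, a • w = u :=
  (Projectivization.mk_eq_mk_iff' ℂ _ _ hu hw).1 ((mk_eq_mk_iff_bracket hu hw).2 h)

section

variable {m : Six → Fin 3 → ℂ} {l : Pair → Fin 3 → ℂ}

/-- The configuration is obtained by `g` from the configuration of six points on the standard
conic with parameters `t`. -/
structure IsOnConic (m : Six → Fin 3 → ℂ) (l : Pair → Fin 3 → ℂ)
    (g : Matrix.SpecialLinearGroup (Fin 3) ℂ) (t : Six → Fin 2 → ℂ) : Prop where
  point : ∀ i, ∃ a : ℂ, a ≠ 0 ∧ m i = a • g.1 *ᵥ veronese (t i)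
  line : ∀ (i j) (h : i ≠ j), ∃ a : ℂ, a ≠ 0 ∧ g.1ᵀ *ᵥ l (pairOf h) = a • joinVec (t i) (t j)

theorem IsOnConic.isFiveConic {g : Matrix.SpecialLinearGroup (Fin 3) ℂ} {t : Six → Fin 2 → ℂ}
    (ht : ∀ i, t i ≠ 0) (h : IsOnConic m l g t) :
    IsFiveConic m l (g⁻¹.1ᵀ * standardConic * g⁻¹.1) := by
  have hgg : g⁻¹.1 * g.1 = 1 := by
    rw [← Matrix.SpecialLinearGroup.coe_mul, inv_mul_cancel, Matrix.SpecialLinearGroup.coe_one]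
  have hA : ∀ i, ∃ a : ℂ, a ≠ 0 ∧ g⁻¹.1 *ᵥ m i = a • veronese (t i) := by
    intro i
    obtain ⟨a, ha, e⟩ := h.point i
    exact ⟨a, ha, by rw [e, Matrix.mulVec_smul, Matrix.mulVec_mulVec, hgg, Matrix.one_mulVec]⟩
  refine ⟨IsIrreducibleConic.of_smul ⟨standardConic_isSymm, by
    rw [standardConic_det]; exact two_ne_zero⟩, fun i => ?_, fun i j hij h0 => ?_⟩
  · obtain ⟨a, -, e⟩ := hA (Sum.inl i)
    rw [← Matrix.mulVec_mulVec, ← Matrix.mulVec_mulVec, Matrix.mulVec_transpose,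
      dotProduct_comm, ← Matrix.dotProduct_mulVec, e, Matrix.mulVec_smul, dotProduct_smul,
      smul_dotProduct, standardConic_veronese, joinVec_dotProduct, bracket_self]
    simp
  · obtain ⟨a, ha, e⟩ := hA (Sum.inl i)
    obtain ⟨b, hb, e'⟩ := hA (Sum.inl j)
    obtain ⟨r, hr, e2⟩ := h.line _ _ (inl_ne_inl hij)
    have hpar : bracket (t (Sum.inl i)) (t (Sum.inl j)) = 0 := by
      by_contra hne
      have hm0 : m (Sum.inl i) ≠ 0 := by
        intro h0
        rw [h0, Matrix.mulVec_zero] at e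
        exact smul_ne_zero ha (veronese_ne_zero (ht _)) e.symm
      obtain ⟨s, hs⟩ := eq_smul_of_cross_eq_zero hm0 (show m (Sum.inl j) ⨯₃ m (Sum.inl i) = 0 by
        rw [← cross_anticomm, h0, neg_zero])
      rw [hs, Matrix.mulVec_smul, e, smul_smul] at e'
      have h4 := congrArg (fun x => veronese (t (Sum.inl i)) ⨯₃ x) e'
      simp only [map_smul, cross_self, smul_zero, veronese_cross] at h4
      exact smul_ne_zero hb (smul_ne_zero hne (joinVec_ne_zero (ht _) (ht _))) h4.symm
    obtain ⟨s, hs⟩ := eq_smul_of_bracket (ht _) (ht _) hpar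
    have hl : l (pairOf (inl_ne_inl hij)) =
        r • g⁻¹.1ᵀ *ᵥ joinVec (t (Sum.inl i)) (t (Sum.inl j)) := by
      rw [← Matrix.mulVec_smul, ← e2, Matrix.mulVec_mulVec, ← Matrix.transpose_mul,
        mul_eq_one_comm.1 hgg, Matrix.transpose_one, Matrix.one_mulVec]
    have e3 : ∀ u : Fin 2 → ℂ, joinVec (s • t (Sum.inl j)) u = s • joinVec (t (Sum.inl j)) u := by
      intro u
      simpa using joinVec_smul (t (Sum.inl j)) u s 1
    have e4 : joinVec (t (Sum.inl j)) (s • t (Sum.inl j)) =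
        s • joinVec (t (Sum.inl j)) (t (Sum.inl j)) := by
      simpa using joinVec_smul (t (Sum.inl j)) (t (Sum.inl j)) 1 s
    rw [← Matrix.mulVec_mulVec, ← Matrix.mulVec_mulVec, e, Matrix.mulVec_smul,
      standardConic_veronese, hl, ← hs, e3, e3, e4]
    simp only [Matrix.mulVec_smul, map_smul, LinearMap.smul_apply, cross_self, smul_zero]

/-- If the six points lie on a conic, then the seven points on the line are the six points in a
parametrization of the conic, the sixth being counted twice: the projection from a point of the
conic is a parametrization of the conic. -/
theorem IsTangentProjection.ofVec_eq_descend (hc : IsAdmissible m l)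
    {A : Matrix (Fin 3) (Fin 3) ℂ} {π : (Fin 3 → ℂ) →ₗ[ℂ] (Fin 2 → ℂ)} {v : Seven × Fin 2 → ℂ}
    (h : IsTangentProjection m l A π v) {g : Matrix.SpecialLinearGroup (Fin 3) ℂ}
    {t : VecTuple (κ := Fin 2) (IsStable weight26)}
    (ht : IsOnConic m l g fun i k => t.1 (i, k)) :
    ∃ hv, DMZ2.ofVec ⟨v, hv⟩ = descend (DM.ofVec weight26 t) := by
  have hgg : g⁻¹.1 * g.1 = 1 := by
    rw [← Matrix.SpecialLinearGroup.coe_mul, inv_mul_cancel, Matrix.SpecialLinearGroup.coe_one]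
  obtain ⟨s, hs⟩ := (ht.isFiveConic t.2.1).eq_smul hc (h.five.isSecantConic hc)
  have hs0 : s ≠ 0 := by
    rintro rfl
    exact h.five.conic.2 (by rw [hs, zero_smul]; simp)
  obtain ⟨t₆, ht₆⟩ : ∃ t₆ : Fin 2 → ℂ, (fun k => t.1 (Sum.inr 0, k)) = t₆ := ⟨_, rfl⟩
  have ht₆0 : t₆ ≠ 0 := ht₆ ▸ t.2.1 _
  obtain ⟨a, ha, hm⟩ := ht.point (Sum.inr 0)
  simp only [ht₆] at hm
  have hm' : g⁻¹.1 *ᵥ m (Sum.inr 0) = a • veronese t₆ := by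
    rw [hm, Matrix.mulVec_smul, Matrix.mulVec_mulVec, hgg, Matrix.one_mulVec]
  obtain ⟨y₀, hy₀⟩ := h.surj ![1, 0]
  obtain ⟨y₁, hy₁⟩ := h.surj ![0, 1]
  -- The line joining the points with parameters `u` and `t₆`, as a linear form.
  obtain ⟨f, hf⟩ : ∃ f : (Fin 2 → ℂ) → (Fin 3 → ℂ) → ℂ,
      ∀ u y, f u y = joinVec u t₆ ⬝ᵥ g⁻¹.1 *ᵥ y := ⟨_, fun _ _ => rfl⟩
  have hfu : ∀ u y, f u y = u 0 * f ![1, 0] y + u 1 * f ![0, 1] y := by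
    intro u y
    simp only [hf]
    rw [← smul_eq_mul, ← smul_eq_mul, ← smul_dotProduct, ← smul_dotProduct, ← add_dotProduct]
    congr 1
    funext k
    fin_cases k <;> simp [joinVec]
    ring
  have hfy : ∀ u y, f u y = π y 0 * f u y₀ + π y 1 * f u y₁ := by
    intro u y
    obtain ⟨b, hb⟩ := (h.ker (y - π y 0 • y₀ - π y 1 • y₁)).1 (by
      rw [map_sub, map_sub, map_smul, map_smul, hy₀, hy₁]
      funext k
      fin_cases k <;> simp [Matrix.vecHead, Matrix.vecTail])
    have hb' : y = b • m (Sum.inr 0) + π y 0 • y₀ + π y 1 • y₁ := by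
      rw [← hb]
      abel
    have h0 : joinVec u t₆ ⬝ᵥ veronese t₆ = 0 := by
      rw [joinVec_dotProduct, bracket_self, mul_zero]
    have := congrArg (f u) hb'
    rw [this]
    simp only [hf, Matrix.mulVec_add, Matrix.mulVec_smul, hm', dotProduct_add, dotProduct_smul, h0,
      smul_eq_mul, mul_zero, zero_add]
  obtain ⟨G, hG⟩ : ∃ G : Matrix (Fin 2) (Fin 2) ℂ, G = !![-f ![1, 0] y₁, -f ![0, 1] y₁;
      f ![1, 0] y₀, f ![0, 1] y₀] := ⟨_, rfl⟩
  have hfG : ∀ u y, f u y = bracket (π y) (G *ᵥ u) := by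
    intro u y
    rw [hfy, hfu u y₀, hfu u y₁, hG]
    simp [bracket, Matrix.mulVec, dotProduct, Fin.sum_univ_two]
    ring
  have hdet : G.det ≠ 0 := by
    intro h0
    obtain ⟨u, hu, hGu⟩ := Matrix.exists_mulVec_eq_zero_iff.2 h0
    refine joinVec_ne_zero hu ht₆0 (dotProduct_eq_zero _ fun y => ?_)
    have := hfG u (g.1 *ᵥ y)
    rw [hf, Matrix.mulVec_mulVec, hgg, Matrix.one_mulVec, hGu] at this
    rw [this]
    simp [bracket]
  have hcol : ∀ j : Fin 2, bracket (fun k => v (Sum.inr j, k)) (G *ᵥ t₆) = 0 := by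
    intro j
    obtain ⟨b, hb, hq⟩ := h.quad
    obtain ⟨y, hy⟩ := h.surj fun k => v (Sum.inr j, k)
    have h1 : ∀ z, m (Sum.inr 0) ⬝ᵥ A *ᵥ z = s * a * f t₆ z := by
      intro z
      rw [hs, Matrix.smul_mulVec, dotProduct_smul, ← Matrix.mulVec_mulVec, ← Matrix.mulVec_mulVec,
        Matrix.mulVec_transpose, dotProduct_comm, ← Matrix.dotProduct_mulVec, hm', dotProduct_smul,
        dotProduct_comm, polar_comm standardConic_isSymm (veronese t₆), standardConic_veronese,
        dotProduct_comm, hf]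
      simp only [smul_eq_mul]
      ring
    have h2 : tangentForm A (m (Sum.inr 0)) y = 0 := by
      rw [hq, hy]
      fin_cases j
      · rw [Fin.zero_eta, bracket_self, mul_zero, zero_mul]
      · rw [Fin.mk_one, bracket_self, mul_zero]
    have h3 : π (m (Sum.inr 0)) = 0 := (h.ker _).2 ⟨1, (one_smul _ _).symm⟩
    have h4 : f t₆ (m (Sum.inr 0)) = 0 := by
      rw [hfG, h3]
      simp [bracket]
    rw [tangentForm, h1, h4, h1, mul_zero, zero_mul, zero_sub, neg_eq_zero] at h2
    rw [← hy, ← hfG]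
    exact (mul_eq_zero.1 (pow_eq_zero_iff two_ne_zero |>.1 h2)).resolve_left (mul_ne_zero hs0 ha)
  have key : ∀ i : Seven, bracket (fun k => v (i, k))
      (G *ᵥ fun k => t.1 (collapse i, k)) = 0 := by
    rintro (i | j)
    · obtain ⟨b, hb, hl⟩ := h.line i
      obtain ⟨r, hr, hl'⟩ := ht.line _ _ (inl_ne_inr i)
      simp only [ht₆] at hl'
      obtain ⟨y, hy⟩ := h.surj fun k => v (Sum.inl i, k)
      have h1 : r * f (fun k => t.1 (Sum.inl i, k)) y = 0 := by
        rw [hf, ← smul_eq_mul, ← smul_dotProduct, ← hl', Matrix.mulVec_transpose,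
          ← Matrix.dotProduct_mulVec, Matrix.mulVec_mulVec, mul_eq_one_comm.1 hgg,
          Matrix.one_mulVec, hl, hy, bracket_self, mul_zero]
      rw [← hy, ← hfG]
      exact (mul_eq_zero.1 h1).resolve_left hr
    · rw [← ht₆] at hcol
      exact hcol j
  obtain ⟨hv, e⟩ := DM.ofVec_eq (μ := weight2511) (w := fun e => t.1 (collapse e.1, e.2))
    ⟨fun i => t.2.1 (collapse i), t.2.2.collapse⟩ (h.ne_zero hc) hdet key
  exact ⟨hv, congrArg DMZ2.mk e⟩

end

/-! ### Vectors representing configurations of points and lines -/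

/-- The vectors representing the six points. -/
def pointVec (w : (Six ⊕ Pair) × Fin 3 → ℂ) : Six → Fin 3 → ℂ := fun i k => w (Sum.inl i, k)

/-- The vectors representing the lines. -/
def lineVec (w : (Six ⊕ Pair) × Fin 3 → ℂ) : Pair → Fin 3 → ℂ := fun e k => w (Sum.inr e, k)

theorem exists_pairOf (e : Pair) : ∃ (i j : Six) (h : i ≠ j), e = pairOf h := by
  obtain ⟨e, he⟩ := e
  induction e using Sym2.inductionOn with | hf i j =>
  rw [Sym2.mk_isDiag_iff] at he
  exact ⟨i, j, he, rfl⟩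

theorem isTangentLine_mk {A : Matrix (Fin 3) (Fin 3) ℂ} {x l : Fin 3 → ℂ} (hx : x ≠ 0)
    (hl : l ≠ 0) : IsTangentLine A (.mk ℂ x hx) (.mk ℂ l hl) ↔ (A *ᵥ x) ⨯₃ l = 0 := by
  constructor
  · intro h
    have := h x (by simp [Projectivization.submodule_mk, Submodule.mem_span_singleton_self])
    rw [Projectivization.submodule_mk, Submodule.mem_span_singleton] at this
    obtain ⟨a, ha⟩ := this
    rw [← ha, map_smul, LinearMap.smul_apply, cross_self, smul_zero]
  · intro h u hu
    obtain ⟨b, hb⟩ := eq_smul_of_cross_eq_zero hl h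
    rw [Projectivization.submodule_mk, Submodule.mem_span_singleton] at hu ⊢
    obtain ⟨a, rfl⟩ := hu
    exact ⟨a * b, by rw [Matrix.mulVec_smul, hb, smul_smul]⟩

section

variable {w : (Six ⊕ Pair) × Fin 3 → ℂ} (hw : ∀ i, (fun k => w (i, k)) ≠ 0)

theorem isIncident_spanPoints : Config.IsIncident (spanPoints (Six ⊕ Pair) (Fin 3) ⟨w, hw⟩) ↔
    ∀ (e : Pair) i, i ∈ e.1 → lineVec w e ⬝ᵥ pointVec w i = 0 :=
  forall_congr' fun e => forall_congr' fun i => imp_congr_right fun _ =>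
    Projectivization.orthogonal_mk (hw (Sum.inr e)) (hw (Sum.inl i))

theorem point_eq_iff_cross (i j : Six) : spanPoints (Six ⊕ Pair) (Fin 3) ⟨w, hw⟩ (Sum.inl i) =
    spanPoints (Six ⊕ Pair) (Fin 3) ⟨w, hw⟩ (Sum.inl j) ↔ pointVec w i ⨯₃ pointVec w j = 0 :=
  Projectivization.mk_eq_mk_iff_crossProduct_eq_zero (hw (Sum.inl i)) (hw (Sum.inl j))

/-- The definition of `Δ_Q` in terms of vectors. -/
theorem isDeltaQ_spanPoints : Config.IsDeltaQ (spanPoints (Six ⊕ Pair) (Fin 3) ⟨w, hw⟩) ↔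
    IsAdmissible (pointVec w) (lineVec w) ∧ ∃ A : Matrix (Fin 3) (Fin 3) ℂ, IsIrreducibleConic A ∧
      (∀ i, pointVec w i ⬝ᵥ A *ᵥ pointVec w i = 0) ∧ ∀ (i j : Six) (h : i ≠ j),
        pointVec w i ⨯₃ pointVec w j = 0 → (A *ᵥ pointVec w i) ⨯₃ lineVec w (pairOf h) = 0 := by
  have tan : ∀ (A : Matrix (Fin 3) (Fin 3) ℂ) (i : Six) (e : Pair), IsTangentLine A
      (Config.points (spanPoints (Six ⊕ Pair) (Fin 3) ⟨w, hw⟩) i)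
      (Config.line (spanPoints (Six ⊕ Pair) (Fin 3) ⟨w, hw⟩) e) ↔
      (A *ᵥ pointVec w i) ⨯₃ lineVec w e = 0 := fun A i e =>
    isTangentLine_mk (hw (Sum.inl i)) (hw (Sum.inr e))
  constructor
  · rintro ⟨h1, h2, A, hA, h3, h4⟩
    refine ⟨⟨fun i => hw _, fun e => hw _, (isIncident_spanPoints hw).1 h1,
      fun i j k e1 e2 e3 ⟨h5, h6⟩ => h2 i j k e1 e2 e3
        ⟨(point_eq_iff_cross hw i j).2 h5, (point_eq_iff_cross hw i k).2 h6⟩⟩, A, hA,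
      fun i => (onConic_mk (hw (Sum.inl i))).1 (h3 i), fun i j h h5 => (tan A i _).1 ?_⟩
    refine h4 (pairOf h) ?_ i (Sym2.mem_mk_left _ _)
    have h6 := (point_eq_iff_cross hw i j).2 h5
    intro a ha b hb
    rcases Sym2.mem_iff.1 ha with rfl | rfl <;> rcases Sym2.mem_iff.1 hb with rfl | rfl
    · rfl
    · exact h6
    · exact h6.symm
    · rfl
  · rintro ⟨hc, A, hA, h3, h4⟩
    refine ⟨(isIncident_spanPoints hw).2 hc.incident, fun i j k e1 e2 e3 ⟨h5, h6⟩ =>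
      hc.not_triple i j k e1 e2 e3
        ⟨(point_eq_iff_cross hw i j).1 h5, (point_eq_iff_cross hw i k).1 h6⟩, A, hA,
      fun i => (onConic_mk (hw (Sum.inl i))).2 (h3 i), fun e he i hi => (tan A i _).2 ?_⟩
    obtain ⟨a, b, hab, rfl⟩ := exists_pairOf e
    have h5 := he a (Sym2.mem_mk_left _ _) b (Sym2.mem_mk_right _ _)
    rcases Sym2.mem_iff.1 hi with rfl | rfl
    · exact h4 _ _ hab ((point_eq_iff_cross hw _ _).1 h5)
    · rw [pairOf_comm]
      exact h4 _ _ hab.symm ((point_eq_iff_cross hw _ _).1 h5.symm)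

end

/-- The class of the configuration represented by a tuple of vectors. -/
noncomputable def ConfigModuli.ofVec (S : Config → Prop) (w : VecTuple (κ := Fin 3) S) :
    ConfigModuli S :=
  Quotient.mk (configSetoid S) (VecTuple.span w)

theorem ConfigModuli.space_eq (S : Config → Prop) : ConfigModuli.space S =
    ((affineSpace ((Six ⊕ Pair) × Fin 3)).induced Subtype.val).coinduced (ConfigModuli.ofVec S) := by
  rw [ConfigModuli.space, multiProjectiveSpace_induced]
  rfl

theorem VecTuple.exists_span_eq {S : Config → Prop} (c : {c // S c}) :
    ∃ w : VecTuple (κ := Fin 3) S, VecTuple.span w = c := by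
  have e : spanPoints (Six ⊕ Pair) (Fin 3)
      ⟨fun e => (c.1 e.1).rep e.2, fun i => (c.1 i).rep_nonzero⟩ = c.1 :=
    funext fun i => (c.1 i).mk_rep
  exact ⟨⟨_, fun i => (c.1 i).rep_nonzero, e.symm ▸ c.2⟩, Subtype.ext e⟩

theorem ConfigModuli.ofVec_surjective (S : Config → Prop) :
    Function.Surjective (ConfigModuli.ofVec S) := by
  intro x
  induction x using Quotient.inductionOn with
  | h c =>
    obtain ⟨w, rfl⟩ := VecTuple.exists_span_eq c
    exact ⟨w, rfl⟩

/-- Tuples of vectors represent the same class if, up to scalars, an element of `SL₃(ℂ)` takes one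
to the other. The action on lines is expressed through the transposed matrix. -/
theorem ConfigModuli.ofVec_eq_iff {S : Config → Prop} {w w' : VecTuple (κ := Fin 3) S} :
    ConfigModuli.ofVec S w = ConfigModuli.ofVec S w' ↔
      ∃ g : Matrix.SpecialLinearGroup (Fin 3) ℂ,
        (∀ i, ∃ a : ℂ, a ≠ 0 ∧ pointVec w'.1 i = a • g.1 *ᵥ pointVec w.1 i) ∧
          ∀ e, ∃ a : ℂ, a ≠ 0 ∧ g.1ᵀ *ᵥ lineVec w'.1 e = a • lineVec w.1 e := by
  have hgg : ∀ g : Matrix.SpecialLinearGroup (Fin 3) ℂ, g⁻¹.1 * g.1 = 1 := fun g => by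
    rw [← Matrix.SpecialLinearGroup.coe_mul, inv_mul_cancel, Matrix.SpecialLinearGroup.coe_one]
  have key : ∀ (g : Matrix.SpecialLinearGroup (Fin 3) ℂ) (u v : Fin 3 → ℂ) (hu : u ≠ 0)
      (hv : v ≠ 0), Projectivization.mk ℂ v hv = g • Projectivization.mk ℂ u hu ↔
        ∃ a : ℂ, a ≠ 0 ∧ v = a • g.1 *ᵥ u := by
    intro g u v hu hv
    rw [Projectivization.smul_mk, Projectivization.mk_eq_mk_iff']
    constructor
    · rintro ⟨a, ha⟩
      refine ⟨a, ?_, ha.symm⟩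
      rintro rfl
      rw [zero_smul] at ha
      exact hv ha.symm
    · rintro ⟨a, -, ha⟩
      exact ⟨a, ha.symm⟩
  have key' : ∀ (g : Matrix.SpecialLinearGroup (Fin 3) ℂ) (u v : Fin 3 → ℂ) (a : ℂ),
      v = a • (g⁻¹).transpose.1 *ᵥ u ↔ g.1ᵀ *ᵥ v = a • u := by
    intro g u v a
    rw [Matrix.SpecialLinearGroup.coe_transpose]
    constructor
    · rintro rfl
      rw [Matrix.mulVec_smul, Matrix.mulVec_mulVec, ← Matrix.transpose_mul, hgg,
        Matrix.transpose_one, Matrix.one_mulVec]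
    · intro h
      rw [← Matrix.mulVec_smul, ← h, Matrix.mulVec_mulVec, ← Matrix.transpose_mul,
        mul_eq_one_comm.1 (hgg g), Matrix.transpose_one, Matrix.one_mulVec]
  have h1 : ConfigModuli.ofVec S w = ConfigModuli.ofVec S w' ↔
      ∃ g, (VecTuple.span w').1 = Config.act g (VecTuple.span w).1 :=
    ⟨fun h => Quotient.exact h, fun h => Quotient.sound h⟩
  rw [h1]
  refine exists_congr fun g => ?_
  rw [funext_iff, Sum.forall]
  refine and_congr (forall_congr' fun i => key g _ _ (w.2.1 _) (w'.2.1 _))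
    (forall_congr' fun e => (key _ _ _ (w.2.1 (Sum.inr e)) (w'.2.1 (Sum.inr e))).trans ?_)
  exact exists_congr fun a => and_congr_right fun _ => key' g _ _ a

theorem IsOnConic.of_ofVec_eq {S : Config → Prop} {w w' : VecTuple (κ := Fin 3) S}
    (h : ConfigModuli.ofVec S w = ConfigModuli.ofVec S w')
    {g : Matrix.SpecialLinearGroup (Fin 3) ℂ} {t : Six → Fin 2 → ℂ}
    (hw : IsOnConic (pointVec w.1) (lineVec w.1) g t) :
    ∃ g', IsOnConic (pointVec w'.1) (lineVec w'.1) g' t := by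
  obtain ⟨f, h1, h2⟩ := ConfigModuli.ofVec_eq_iff.1 h
  refine ⟨f * g, fun i => ?_, fun i j hij => ?_⟩
  · obtain ⟨a, ha, e⟩ := h1 i
    obtain ⟨b, hb, e'⟩ := hw.point i
    refine ⟨a * b, mul_ne_zero ha hb, ?_⟩
    rw [e, e', Matrix.mulVec_smul, smul_smul, Matrix.mulVec_mulVec,
      Matrix.SpecialLinearGroup.coe_mul]
  · obtain ⟨a, ha, e⟩ := h2 (pairOf hij)
    obtain ⟨b, hb, e'⟩ := hw.line i j hij
    refine ⟨a * b, mul_ne_zero ha hb, ?_⟩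
    rw [Matrix.SpecialLinearGroup.coe_mul, Matrix.transpose_mul, ← Matrix.mulVec_mulVec, e,
      Matrix.mulVec_smul, e', smul_smul]

/-! ### The parametrization of `Δ_Q` by `DM(2⁶)` -/

open Classical in
theorem isStable_weight26_iff {p : Six → P1} : IsStable weight26 p ↔
    ∀ i j k, i ≠ j → i ≠ k → j ≠ k → ¬ (p i = p j ∧ p i = p k) := by
  have h12 : ∑ i, weight26 i = 12 := rfl
  constructor
  · rintro h i j k h1 h2 h3 ⟨h4, h5⟩
    have := h (p i)
    rw [h12] at this
    have hs : ∑ a ∈ {i, j, k}, weight26 a ≤ ∑ a with p a = p i, weight26 a := by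
      refine Finset.sum_le_sum_of_subset fun a ha => ?_
      simp only [Finset.mem_insert, Finset.mem_singleton] at ha
      rcases ha with rfl | rfl | rfl
      · simp
      · simp [h4]
      · simp [h5]
    rw [Finset.sum_insert (by simp [h1, h2]), Finset.sum_insert (by simp [h3]),
      Finset.sum_singleton] at hs
    simp only [weight26] at hs this
    omega
  · intro h x
    rw [h12]
    have hcard : (Finset.univ.filter fun i => p i = x).card ≤ 2 := by
      by_contra hlt
      obtain ⟨i, j, k, hi, hj, hk, h1, h2, h3⟩ := Finset.two_lt_card_iff.1 (not_le.1 hlt)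
      simp only [Finset.mem_filter, Finset.mem_univ, true_and] at hi hj hk
      exact h i j k h1 h2 h3 ⟨hi.trans hj.symm, hi.trans hk.symm⟩
    simp only [weight26, Finset.sum_const, smul_eq_mul]
    omega

/-- Vectors representing the points of the standard conic with parameters `t` and the lines joining
them. -/
def conicVec (t : Six × Fin 2 → ℂ) : (Six ⊕ Pair) × Fin 3 → ℂ := fun x =>
  Sum.elim (fun i => veronese (fun k => t (i, k)) x.2)
    (fun e => Sym2.lift ⟨fun i j => joinVec (fun k => t (i, k)) (fun k => t (j, k)) x.2,
      fun _ _ => congrFun (joinVec_comm _ _) _⟩ e.1) x.1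

theorem isOnConic_conicVec (t : Six × Fin 2 → ℂ) :
    IsOnConic (pointVec (conicVec t)) (lineVec (conicVec t)) 1 fun i k => t (i, k) where
  point i := ⟨1, one_ne_zero, by
    rw [one_smul, Matrix.SpecialLinearGroup.coe_one, Matrix.one_mulVec]
    rfl⟩
  line i j h := ⟨1, one_ne_zero, by
    rw [one_smul, Matrix.SpecialLinearGroup.coe_one, Matrix.transpose_one, Matrix.one_mulVec]
    rfl⟩

theorem conicVec_isDeltaQ (t : VecTuple (κ := Fin 2) (IsStable weight26)) :
    ∃ h, Config.IsDeltaQ (spanPoints (Six ⊕ Pair) (Fin 3) ⟨conicVec t.1, h⟩) := by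
  obtain ⟨u, hu⟩ : ∃ u : Six → Fin 2 → ℂ, u = fun i k => t.1 (i, k) := ⟨_, rfl⟩
  have hu0 : ∀ i, u i ≠ 0 := fun i => hu ▸ t.2.1 i
  have hp : ∀ i, pointVec (conicVec t.1) i = veronese (u i) := fun i => by rw [hu]; rfl
  have hl : ∀ i j (h : i ≠ j), lineVec (conicVec t.1) (pairOf h) = joinVec (u i) (u j) :=
    fun i j h => by rw [hu]; rfl
  have hl' : ∀ e, lineVec (conicVec t.1) e ≠ 0 := fun e => by
    obtain ⟨i, j, h, rfl⟩ := exists_pairOf e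
    rw [hl]
    exact joinVec_ne_zero (hu0 i) (hu0 j)
  have hp' : ∀ i, pointVec (conicVec t.1) i ≠ 0 := fun i => by
    rw [hp]
    exact veronese_ne_zero (hu0 i)
  have hcr : ∀ i j, pointVec (conicVec t.1) i ⨯₃ pointVec (conicVec t.1) j = 0 →
      bracket (u i) (u j) = 0 := fun i j h => by
    rw [hp, hp, veronese_cross] at h
    exact (smul_eq_zero.1 h).resolve_right (joinVec_ne_zero (hu0 i) (hu0 j))
  have heq : ∀ i j, bracket (u i) (u j) = 0 → spanPoints Six (Fin 2) ⟨t.1, t.2.1⟩ i =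
      spanPoints Six (Fin 2) ⟨t.1, t.2.1⟩ j := fun i j h => by
    subst hu
    exact (mk_eq_mk_iff_bracket _ _).2 h
  refine ⟨Sum.forall.2 ⟨hp', hl'⟩, (isDeltaQ_spanPoints _).2 ⟨⟨hp', hl', fun e i hi => ?_,
    fun i j k h1 h2 h3 ⟨h4, h5⟩ => isStable_weight26_iff.1 t.2.2 i j k h1 h2 h3
      ⟨heq _ _ (hcr _ _ h4), heq _ _ (hcr _ _ h5)⟩⟩, standardConic,
    ⟨standardConic_isSymm, by rw [standardConic_det]; exact two_ne_zero⟩, fun i => ?_,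
    fun i j h h0 => ?_⟩⟩
  · obtain ⟨a, b, h, rfl⟩ := exists_pairOf e
    rw [hl, hp, joinVec_dotProduct]
    rcases Sym2.mem_iff.1 hi with rfl | rfl
    · rw [bracket_self, zero_mul]
    · rw [bracket_self, mul_zero]
  · rw [hp, standardConic_veronese, dotProduct_comm, joinVec_dotProduct, bracket_self, mul_zero]
  · obtain ⟨s, hs⟩ := eq_smul_of_bracket (hu0 i) (hu0 j) (hcr i j h0)
    rw [hp, hl, standardConic_veronese, ← hs, joinVec_smul]
    have := joinVec_smul (u j) (u j) s 1
    rw [one_smul] at this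
    rw [this, map_smul, map_smul, LinearMap.smul_apply, cross_self, smul_zero, smul_zero]

/-- Every configuration in `Δ_Q` is obtained from stable parameters on a conic. -/
theorem exists_isOnConic {m : Six → Fin 3 → ℂ} {l : Pair → Fin 3 → ℂ} (hc : IsAdmissible m l)
    {A : Matrix (Fin 3) (Fin 3) ℂ} (hA : IsIrreducibleConic A) (hon : ∀ i, m i ⬝ᵥ A *ᵥ m i = 0)
    (htan : ∀ (i j : Six) (h : i ≠ j), m i ⨯₃ m j = 0 → (A *ᵥ m i) ⨯₃ l (pairOf h) = 0) :
    ∃ (g : Matrix.SpecialLinearGroup (Fin 3) ℂ)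
      (t : VecTuple (κ := Fin 2) (IsStable weight26)), IsOnConic m l g fun i k => t.1 (i, k) := by
  obtain ⟨P, c, τ, hc0, hP, hm⟩ := exists_parametrization hA hc.point_ne hon
  obtain ⟨u, hu⟩ : ∃ u : Six → Fin 2 → ℂ, u = fun i => ![1, τ i] := ⟨_, rfl⟩
  have hu0 : ∀ i, u i ≠ 0 := fun i h => by
    have := congrFun h 0
    simp [hu] at this
  have hm' : ∀ i, ∃ s : ℂ, s ≠ 0 ∧ m i = s • P.1 *ᵥ veronese (u i) := by
    intro i
    obtain ⟨s, hs, e⟩ := hm i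
    refine ⟨s, hs, ?_⟩
    rw [e, hu]
    simp [veronese]
  have huu : ∀ i j, bracket (u i) (u j) = 0 → u i = u j := fun i j h => by
    rw [hu] at h ⊢
    simp [bracket, sub_eq_zero] at h
    simp [h]
  have hcr : ∀ i j, bracket (u i) (u j) = 0 → m i ⨯₃ m j = 0 := by
    intro i j h
    obtain ⟨a, ha, e⟩ := hm' i
    obtain ⟨b, hb, e'⟩ := hm' j
    rw [e, e', huu i j h, map_smul, map_smul, LinearMap.smul_apply, cross_self, smul_zero,
      smul_zero]
  have hlP : ∀ e, P.1ᵀ *ᵥ l e ≠ 0 := fun e h => hc.line_ne e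
    (Matrix.eq_zero_of_mulVec_eq_zero (by rw [Matrix.det_transpose, P.2]; exact one_ne_zero) h)
  have hlm : ∀ (e : Pair) i, i ∈ e.1 → (P.1ᵀ *ᵥ l e) ⬝ᵥ veronese (u i) = 0 := by
    intro e i hi
    obtain ⟨a, ha, e'⟩ := hm' i
    have := hc.incident e i hi
    rw [e', dotProduct_smul, smul_eq_mul] at this
    rw [Matrix.mulVec_transpose, ← Matrix.dotProduct_mulVec]
    exact (mul_eq_zero.1 this).resolve_left ha
  have hs : IsStable weight26 (spanPoints Six (Fin 2) ⟨fun e => u e.1 e.2, hu0⟩) := by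
    refine isStable_weight26_iff.2 fun i j k h1 h2 h3 ⟨h4, h5⟩ => hc.not_triple i j k h1 h2 h3
      ⟨hcr _ _ ((mk_eq_mk_iff_bracket _ _).1 h4), hcr _ _ ((mk_eq_mk_iff_bracket _ _).1 h5)⟩
  refine ⟨P, ⟨fun e => u e.1 e.2, hu0, hs⟩, hm', fun i j h => ?_⟩
  change ∃ a : ℂ, a ≠ 0 ∧ P.1ᵀ *ᵥ l (pairOf h) = a • joinVec (u i) (u j)
  have hj0 := joinVec_ne_zero (hu0 i) (hu0 j)
  by_cases h0 : bracket (u i) (u j) = 0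
  · obtain ⟨r, hr⟩ := eq_smul_of_cross_eq_zero (hc.line_ne _) (htan i j h (hcr i j h0))
    obtain ⟨a, ha, e⟩ := hm' i
    have h1 : r • P.1ᵀ *ᵥ l (pairOf h) = (a * c) • joinVec (u i) (u j) := by
      rw [← Matrix.mulVec_smul, ← hr, e, Matrix.mulVec_smul, Matrix.mulVec_smul,
        Matrix.mulVec_mulVec, Matrix.mulVec_mulVec, hP, Matrix.smul_mulVec,
        standardConic_veronese, smul_smul, huu i j h0]
    have hr0 : r ≠ 0 := by
      rintro rfl
      rw [zero_smul] at h1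
      exact smul_ne_zero (mul_ne_zero ha hc0) hj0 h1.symm
    refine ⟨r⁻¹ * (a * c), mul_ne_zero (inv_ne_zero hr0) (mul_ne_zero ha hc0), ?_⟩
    rw [mul_smul, ← h1, smul_smul, inv_mul_cancel₀ hr0, one_smul]
  · obtain ⟨b, hb⟩ := cross_eq_smul (hlP (pairOf h)) (hlm _ i (Sym2.mem_mk_left _ _))
      (hlm _ j (Sym2.mem_mk_right _ _))
    rw [veronese_cross] at hb
    have hb0 : b ≠ 0 := by
      rintro rfl
      rw [zero_smul] at hb
      exact smul_ne_zero h0 hj0 hb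
    refine ⟨b⁻¹ * bracket (u i) (u j), mul_ne_zero (inv_ne_zero hb0) h0, ?_⟩
    rw [mul_smul, hb, smul_smul, inv_mul_cancel₀ hb0, one_smul]

/-- The action of a matrix on the symmetric square of the plane, in the coordinates of
`veronese`. -/
def symSquare (G : Matrix (Fin 2) (Fin 2) ℂ) : Matrix (Fin 3) (Fin 3) ℂ :=
  !![G 0 0 ^ 2, 2 * (G 0 0 * G 0 1), G 0 1 ^ 2;
    G 0 0 * G 1 0, G 0 0 * G 1 1 + G 0 1 * G 1 0, G 0 1 * G 1 1;
    G 1 0 ^ 2, 2 * (G 1 0 * G 1 1), G 1 1 ^ 2]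

theorem symSquare_det (G : Matrix (Fin 2) (Fin 2) ℂ) : (symSquare G).det = G.det ^ 3 := by
  rw [Matrix.det_fin_three, Matrix.det_fin_two]
  simp [symSquare]
  ring

theorem symSquare_veronese (G : Matrix (Fin 2) (Fin 2) ℂ) (u : Fin 2 → ℂ) :
    symSquare G *ᵥ veronese u = veronese (G *ᵥ u) := by
  funext k
  fin_cases k <;>
    simp [symSquare, veronese, Matrix.mulVec, dotProduct, Fin.sum_univ_three] <;> ring

theorem symSquare_transpose_joinVec (G : Matrix (Fin 2) (Fin 2) ℂ) (u v : Fin 2 → ℂ) :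
    (symSquare G)ᵀ *ᵥ joinVec (G *ᵥ u) (G *ᵥ v) = G.det ^ 2 • joinVec u v := by
  rw [Matrix.det_fin_two]
  funext k
  fin_cases k <;>
    simp [symSquare, joinVec, Matrix.mulVec, dotProduct, Fin.sum_univ_three] <;> ring

/-- Projectivities of the line extend to projectivities of the plane that preserve the standard
conic. -/
theorem ofVec_conicVec_eq {s t : VecTuple (κ := Fin 2) (IsStable weight26)}
    (h : DM.ofVec _ s = DM.ofVec _ t) : ConfigModuli.ofVec _ ⟨_, conicVec_isDeltaQ s⟩ =
      ConfigModuli.ofVec _ ⟨_, conicVec_isDeltaQ t⟩ := by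
  obtain ⟨g, a, ha, e⟩ := DM.exists_of_ofVec_eq h
  obtain ⟨P, hP⟩ : ∃ P : Matrix.SpecialLinearGroup (Fin 3) ℂ, P.1 = symSquare g.1 :=
    ⟨⟨symSquare g.1, (symSquare_det g.1).trans (by rw [g.2, one_pow])⟩, rfl⟩
  refine ConfigModuli.ofVec_eq_iff.2 ⟨P, fun i => ⟨a i ^ 2, pow_ne_zero 2 (ha i), ?_⟩, fun x => ?_⟩
  · change veronese (fun k => t.1 (i, k)) = a i ^ 2 • P.1 *ᵥ veronese fun k => s.1 (i, k)
    rw [e, veronese_smul, hP, symSquare_veronese]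
  · obtain ⟨i, j, h, rfl⟩ := exists_pairOf x
    refine ⟨a i * a j, mul_ne_zero (ha i) (ha j), ?_⟩
    change P.1ᵀ *ᵥ joinVec (fun k => t.1 (i, k)) (fun k => t.1 (j, k)) =
      (a i * a j) • joinVec (fun k => s.1 (i, k)) fun k => s.1 (j, k)
    rw [e, e, joinVec_smul, Matrix.mulVec_smul, hP, symSquare_transpose_joinVec, g.2, one_pow,
      one_smul]

/-- The map `DM(2⁶) → Δ_Q` that regards the line as a conic. -/
noncomputable def DM.toDeltaQ (x : DM weight26) : DeltaQ :=
  ConfigModuli.ofVec _ ⟨_, conicVec_isDeltaQ (DM.ofVec_surjective _ x).choose⟩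

theorem DM.toDeltaQ_ofVec (t : VecTuple (κ := Fin 2) (IsStable weight26)) :
    DM.toDeltaQ (DM.ofVec _ t) = ConfigModuli.ofVec _ ⟨_, conicVec_isDeltaQ t⟩ :=
  ofVec_conicVec_eq (DM.ofVec_surjective _ (DM.ofVec _ t)).choose_spec

theorem DM.toDeltaQ_surjective : Function.Surjective DM.toDeltaQ := by
  intro x
  obtain ⟨w, rfl⟩ := ConfigModuli.ofVec_surjective _ x
  obtain ⟨hc, A, hA, hon, htan⟩ := (isDeltaQ_spanPoints w.2.1).1 w.2.2
  obtain ⟨g, t, h⟩ := exists_isOnConic hc hA hon htan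
  refine ⟨DM.ofVec _ t, ?_⟩
  rw [DM.toDeltaQ_ofVec]
  refine ConfigModuli.ofVec_eq_iff.2 ⟨g, h.point, fun e => ?_⟩
  obtain ⟨i, j, hij, rfl⟩ := exists_pairOf e
  exact h.line i j hij

theorem DM.toDeltaQ_isMorphism :
    (DM.space weight26).IsMorphism (ConfigModuli.space Config.IsDeltaQ) DM.toDeltaQ := by
  rw [DM.space_eq, FunctionSpace.isMorphism_coinduced_iff, ConfigModuli.space_eq]
  refine FunctionSpace.IsMorphismOn.isMorphism (FunctionSpace.isMorphismOn_coinduced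
    ((FunctionSpace.isLocal_affineSpace _).induced _) fun v _ => ?_)
  obtain ⟨S, hS⟩ : ∃ S, S = (affineSpace (Six × Fin 2)).induced
    (Subtype.val : VecTuple (κ := Fin 2) (IsStable weight26) → _) := ⟨_, rfl⟩
  have hc : ∀ e, S.IsRegular Set.univ fun t => t.1 e := fun e => by
    rw [hS]
    exact FunctionSpace.regular_coord_induced _ _ e
  rw [← hS]
  refine ⟨Set.univ, fun t => conicVec t.1, FunctionSpace.isOpen_univ _, trivial,
    subset_rfl, ?_, fun t _ => ⟨⟨_, conicVec_isDeltaQ t⟩, rfl, (DM.toDeltaQ_ofVec t).symm⟩⟩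
  have hmul := fun a b => S.regular_mul _ _ _ (hc a) (hc b)
  rintro ⟨i | e, k⟩
  · fin_cases k
    · simpa [conicVec, veronese, pow_two] using hmul (i, 0) (i, 0)
    · exact hmul (i, 0) (i, 1)
    · simpa [conicVec, veronese, pow_two] using hmul (i, 1) (i, 1)
  · obtain ⟨i, j, h, rfl⟩ := exists_pairOf e
    fin_cases k
    · exact hmul (i, 1) (j, 1)
    · exact S.regular_neg (S.regular_add _ _ _ (hmul (i, 0) (j, 1)) (hmul (i, 1) (j, 0)))
    · exact hmul (i, 0) (j, 0)

/-! ### The extension of `phi67` -/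

/-- In the generic case the conic exists by `exists_isProjection`, the tangency conditions being
vacuous. -/
theorem isAdmissible_of_isExtended (w : VecTuple (κ := Fin 3) Config.IsExtended) :
    IsAdmissible (pointVec w.1) (lineVec w.1) ∧
      ∃ A, IsFiveConic (pointVec w.1) (lineVec w.1) A := by
  rcases w.2.2 with ⟨hi, hg⟩ | h
  · have hne : ∀ i j, i ≠ j → pointVec w.1 i ⨯₃ pointVec w.1 j ≠ 0 := fun i j hij h =>
      hg.ne hij ((point_eq_iff_cross w.2.1 i j).2 h)
    refine ⟨⟨fun i => w.2.1 _, fun e => w.2.1 _, (isIncident_spanPoints w.2.1).1 hi,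
      fun i j k h _ _ h' => hne i j h h'.1⟩, ?_⟩
    obtain ⟨p, A, t, π, h⟩ := exists_isProjection hg
    exact ⟨A, h.conic, fun i => (onConic_mk (w.2.1 (Sum.inl (Sum.inl i)))).1 (h.onConic i),
      fun i j hij h' => absurd h' (hne _ _ (inl_ne_inl hij))⟩
  · obtain ⟨hc, A, hA, hon, htan⟩ := (isDeltaQ_spanPoints w.2.1).1 h
    exact ⟨hc, A, hA, fun i => hon _, fun i j h => htan _ _ (inl_ne_inl h)⟩

theorem exists_isTangentProjection (w : VecTuple (κ := Fin 3) Config.IsExtended) :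
    ∃ A π v, IsTangentProjection (pointVec w.1) (lineVec w.1) A π v := by
  obtain ⟨hc, A, hA⟩ := isAdmissible_of_isExtended w
  exact ⟨A, hA.exists_isTangentProjection hc⟩

/-- The point of `DM_{ℤ/2}(2⁵,1²)` obtained by projection from the sixth point depends only on the
class of the configuration. -/
theorem exists_class_eq (x : ExtendedModuli) : ∃ z : DMZ2,
    ∀ w : VecTuple (κ := Fin 3) Config.IsExtended, ConfigModuli.ofVec _ w = x →
      ∀ A π v, IsTangentProjection (pointVec w.1) (lineVec w.1) A π v →
        ∃ hv, DMZ2.ofVec ⟨v, hv⟩ = z := by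
  by_cases H : ∃ (w : VecTuple (κ := Fin 3) Config.IsExtended)
      (g : Matrix.SpecialLinearGroup (Fin 3) ℂ) (t : VecTuple (κ := Fin 2) (IsStable weight26)),
      ConfigModuli.ofVec _ w = x ∧
        IsOnConic (pointVec w.1) (lineVec w.1) g fun i k => t.1 (i, k)
  · obtain ⟨w, g, t, rfl, ht⟩ := H
    refine ⟨descend (DM.ofVec _ t), fun w' hw' A π v h => ?_⟩
    obtain ⟨g', ht'⟩ := ht.of_ofVec_eq hw'.symm
    exact h.ofVec_eq_descend (isAdmissible_of_isExtended w').1 ht'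
  · -- All representatives are generic.
    have hgen : ∀ w : VecTuple (κ := Fin 3) Config.IsExtended, ConfigModuli.ofVec _ w = x →
        IsGeneric fun i => .mk ℂ (pointVec w.1 i) (w.2.1 (Sum.inl i)) := by
      intro w hw
      rcases w.2.2 with h | h
      · exact h.2
      · obtain ⟨hc, A, hA, hon, htan⟩ := (isDeltaQ_spanPoints w.2.1).1 h
        obtain ⟨g, t, ht⟩ := exists_isOnConic hc hA hon htan
        exact absurd ⟨w, g, t, hw, ht⟩ H
    obtain ⟨w, hw⟩ := ConfigModuli.ofVec_surjective _ x
    refine ⟨sevenPoints ⟨_, hgen w hw⟩, fun w' hw' A π v h => ?_⟩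
    obtain ⟨hv, e⟩ := h.ofVec_eq_sevenPoints (isAdmissible_of_isExtended w').1 (hgen w' hw')
    refine ⟨hv, e.trans ?_⟩
    obtain ⟨g, hg⟩ := Quotient.exact (hw'.trans hw.symm)
    have : (Quotient.mk planeSetoid ⟨_, hgen w' hw'⟩ : MSm) =
        Quotient.mk planeSetoid ⟨_, hgen w hw⟩ :=
      Quotient.sound ⟨g, fun i => congrFun hg (Sum.inl i)⟩
    exact congrArg phi67 this

/-- The extension of `phi67` to `M^sm ∪ Δ_Q`. -/
noncomputable def extension (x : ExtendedModuli) : DMZ2 := (exists_class_eq x).choose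

theorem extension_ofVec (w : VecTuple (κ := Fin 3) Config.IsExtended)
    {A : Matrix (Fin 3) (Fin 3) ℂ} {π : (Fin 3 → ℂ) →ₗ[ℂ] (Fin 2 → ℂ)} {v : Seven × Fin 2 → ℂ}
    (h : IsTangentProjection (pointVec w.1) (lineVec w.1) A π v) :
    ∃ hv, DMZ2.ofVec ⟨v, hv⟩ = extension (ConfigModuli.ofVec _ w) :=
  (exists_class_eq (ConfigModuli.ofVec _ w)).choose_spec w rfl A π v h

theorem extension_incl (x : MSm) : extension x.incl = phi67 x := by
  induction x using Quotient.inductionOn with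
  | h m =>
    obtain ⟨w, hw⟩ := VecTuple.exists_span_eq (S := Config.IsExtended)
      ⟨Sum.elim m.1 (joins m.1), Or.inl ⟨joins_incident m.2, m.2⟩⟩
    have hw' : (fun i => Projectivization.mk ℂ (pointVec w.1 i) (w.2.1 (Sum.inl i))) = m.1 :=
      funext fun i => congrFun (congrArg Subtype.val hw) (Sum.inl i)
    obtain ⟨A, π, v, h⟩ := exists_isTangentProjection w
    obtain ⟨hv, e⟩ := extension_ofVec w h
    obtain ⟨hv', e'⟩ := h.ofVec_eq_sevenPoints (isAdmissible_of_isExtended w).1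
      (by rw [hw']; exact m.2)
    have h1 : ConfigModuli.ofVec _ w = MSm.incl (Quotient.mk planeSetoid m) :=
      congrArg (Quotient.mk (configSetoid _)) hw
    rw [← h1, ← e, e']
    exact congrArg sevenPoints (Subtype.ext hw')

theorem extension_incl_toDeltaQ (x : DM weight26) :
    extension (DeltaQ.incl (DM.toDeltaQ x)) = descend x := by
  obtain ⟨t, rfl⟩ := DM.ofVec_surjective _ x
  obtain ⟨w, hw, hw'⟩ : ∃ w : VecTuple (κ := Fin 3) Config.IsExtended, w.1 = conicVec t.1 ∧
      ConfigModuli.ofVec _ w = DeltaQ.incl (DM.toDeltaQ (DM.ofVec _ t)) := by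
    obtain ⟨h, h'⟩ := conicVec_isDeltaQ t
    exact ⟨⟨_, h, Or.inr h'⟩, rfl, by rw [DM.toDeltaQ_ofVec]; rfl⟩
  obtain ⟨A, π, v, h⟩ := exists_isTangentProjection w
  obtain ⟨hv, e⟩ := extension_ofVec w h
  obtain ⟨hv', e'⟩ := h.ofVec_eq_descend (isAdmissible_of_isExtended w).1
    (hw ▸ isOnConic_conicVec t.1)
  rw [← hw', ← e, e']

theorem IsTangentProjection.relabel {m : Six → Fin 3 → ℂ} {l : Pair → Fin 3 → ℂ}
    {A : Matrix (Fin 3) (Fin 3) ℂ} {π : (Fin 3 → ℂ) →ₗ[ℂ] (Fin 2 → ℂ)} {v : Seven × Fin 2 → ℂ}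
    (h : IsTangentProjection m l A π v) (σ : Equiv.Perm (Fin 5)) :
    IsTangentProjection (fun i => m (permSix σ i)) (fun e => l (permPair (permSix σ) e)) A π
      fun e => v (permSeven σ e.1, e.2) where
  five := ⟨h.five.conic, fun i => h.five.on (σ i),
    fun i j hij => h.five.tangent (σ i) (σ j) (σ.injective.ne hij)⟩
  surj := h.surj
  ker := h.ker
  line i := h.line (σ i)
  quad := h.quad

theorem extension_perm (σ : Equiv.Perm (Fin 5)) (x : ExtendedModuli) :
    extension (ExtendedModuli.perm σ x) = DMZ2.perm σ (extension x) := by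
  obtain ⟨w, rfl⟩ := ConfigModuli.ofVec_surjective _ x
  obtain ⟨A, π, v, h⟩ := exists_isTangentProjection w
  obtain ⟨hv, e⟩ := extension_ofVec w h
  obtain ⟨w', hw', e'⟩ : ∃ w' : VecTuple (κ := Fin 3) Config.IsExtended,
      w'.1 = (fun e => w.1 (Sum.map (permSix σ⁻¹) (permPair (permSix σ⁻¹)) e.1, e.2)) ∧
        ConfigModuli.ofVec _ w' = ExtendedModuli.perm σ (ConfigModuli.ofVec _ w) := by
    have hc : ∀ h, spanPoints (Six ⊕ Pair) (Fin 3) ⟨fun e =>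
        w.1 (Sum.map (permSix σ⁻¹) (permPair (permSix σ⁻¹)) e.1, e.2), h⟩ =
          Config.relabel (permSix σ)⁻¹ (VecTuple.span w).1 := by
      intro h
      funext i
      rcases i with i | i <;> rfl
    refine ⟨⟨fun e => w.1 (Sum.map (permSix σ⁻¹) (permPair (permSix σ⁻¹)) e.1, e.2),
      fun i => w.2.1 (Sum.map (permSix σ⁻¹) (permPair (permSix σ⁻¹)) i), ?_⟩, rfl, ?_⟩
    · rw [hc]
      exact (VecTuple.span w).2.relabel _
    · exact congrArg (Quotient.mk (configSetoid _)) (Subtype.ext (hc _))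
  have h' : IsTangentProjection (pointVec w'.1) (lineVec w'.1) A π
      fun e => v (permSeven σ⁻¹ e.1, e.2) := by
    rw [hw']
    exact h.relabel σ⁻¹
  obtain ⟨hv', e''⟩ := extension_ofVec w' h'
  rw [← e', ← e'', ← e]
  rfl

theorem extension_isMorphism :
    (ConfigModuli.space Config.IsExtended).IsMorphism DMZ2.space extension := by
  rw [ConfigModuli.space_eq, FunctionSpace.isMorphism_coinduced_iff]
  obtain ⟨S, hS⟩ : ∃ S, S = (affineSpace ((Six ⊕ Pair) × Fin 3)).induced
    (Subtype.val : VecTuple (κ := Fin 3) Config.IsExtended → _) := ⟨_, rfl⟩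
  have hloc : S.IsLocal := by
    rw [hS]
    exact (FunctionSpace.isLocal_affineSpace _).induced _
  have hcoord : ∀ e, S.IsRegular Set.univ fun w => w.1 e := fun e => by
    rw [hS]
    exact FunctionSpace.regular_coord_induced _ _ e
  rw [← hS]
  refine DMZ2.isMorphism_of_roots hloc fun w₀ => ?_
  have hc := fun w => (isAdmissible_of_isExtended w).1
  obtain ⟨U, A, hU, hwU, hAreg, hA⟩ := exists_regular_conic hloc
    (m := fun w => pointVec w.1) (l := fun w => lineVec w.1) (fun i k => hcoord (Sum.inl i, k))
    (fun e k => hcoord (Sum.inr e, k)) hc (fun w => (isAdmissible_of_isExtended w).2) w₀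
  obtain ⟨y, z, hy, hz⟩ := exists_frame (hA w₀ hwU).conic ((hc w₀).point_ne (Sum.inr 0))
  have hr : ∀ {V : Set (VecTuple (κ := Fin 3) Config.IsExtended)} e,
      S.IsRegular V fun w => w.1 e := fun e =>
    S.regular_restrict _ _ _ (Set.subset_univ _) (hcoord e)
  have hm : ∀ k, S.IsRegular U fun w => pointVec w.1 (Sum.inr 0) k := fun k => hr _
  have hconst : ∀ (u : Fin 3 → ℂ) k, S.IsRegular U fun _ => u k := fun u k => S.regular_const _ _
  have hform : ∀ {u v : VecTuple (κ := Fin 3) Config.IsExtended → Fin 3 → ℂ},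
      (∀ k, S.IsRegular U fun w => u w k) → (∀ k, S.IsRegular U fun w => v w k) →
        S.IsRegular U fun w => u w ⬝ᵥ A w *ᵥ v w := fun hu hv =>
    S.regular_dotProduct hu (S.regular_mulVec hAreg hv)
  have hbil : ∀ y z : Fin 3 → ℂ, S.IsRegular U fun w =>
      tangentBilin (A w) (pointVec w.1 (Sum.inr 0)) y z := fun y z =>
    S.regular_sub (S.regular_mul _ _ _ (hform hm hm) (hform (hconst y) (hconst z)))
      (S.regular_mul _ _ _ (hform hm (hconst y)) (hform hm (hconst z)))
  have htan : ∀ y : Fin 3 → ℂ, S.IsRegular U fun w =>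
      tangentForm (A w) (pointVec w.1 (Sum.inr 0)) y := fun y => by
    simpa only [tangentForm, tangentBilin, pow_two] using hbil y y
  have hdet : S.IsRegular U fun w => (pointVec w.1 (Sum.inr 0) ⨯₃ y) ⬝ᵥ z := by
    refine S.regular_dotProduct (fun k => ?_) (hconst z)
    have h2 : ∀ i j : Fin 3, S.IsRegular U fun w => pointVec w.1 (Sum.inr 0) i * y j -
        pointVec w.1 (Sum.inr 0) j * y i := fun i j =>
      S.regular_sub (S.regular_mul _ _ _ (hm i) (hconst y j))
        (S.regular_mul _ _ _ (hm j) (hconst y i))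
    fin_cases k
    · simpa [cross_apply] using h2 1 2
    · simpa [cross_apply] using h2 2 0
    · simpa [cross_apply] using h2 0 1
  have hprod := S.regular_mul _ _ _ (htan y) hdet
  have hO := hloc.isOpen_ne U _ hU hprod
  refine ⟨_, fun w i => ![lineVec w.1 (pairOf (inl_ne_inr i)) ⬝ᵥ y,
      lineVec w.1 (pairOf (inl_ne_inr i)) ⬝ᵥ z],
    fun w => 2 * tangentBilin (A w) (pointVec w.1 (Sum.inr 0)) y z /
      tangentForm (A w) (pointVec w.1 (Sum.inr 0)) y,
    fun w => tangentForm (A w) (pointVec w.1 (Sum.inr 0)) z /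
      tangentForm (A w) (pointVec w.1 (Sum.inr 0)) y, hO, ⟨hwU, mul_ne_zero hy hz⟩, ?_, ?_, ?_, ?_⟩
  · intro i k
    have h : ∀ u : Fin 3 → ℂ, S.IsRegular (U ∩ {w | tangentForm (A w) (pointVec w.1 (Sum.inr 0)) y *
        (pointVec w.1 (Sum.inr 0) ⨯₃ y) ⬝ᵥ z ≠ 0}) fun w =>
          lineVec w.1 (pairOf (inl_ne_inr i)) ⬝ᵥ u := fun u =>
      S.regular_dotProduct (fun k => hr _) fun k => S.regular_const _ _
    fin_cases k
    · exact h y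
    · exact h z
  · exact hloc.div (S.regular_mul _ _ _ (S.regular_const _ 2)
      (S.regular_restrict _ _ _ Set.inter_subset_left (hbil y z)))
      (S.regular_restrict _ _ _ Set.inter_subset_left (htan y))
      fun w hw => left_ne_zero_of_mul hw.2
  · exact hloc.div (S.regular_restrict _ _ _ Set.inter_subset_left (htan z))
      (S.regular_restrict _ _ _ Set.inter_subset_left (htan y))
      fun w hw => left_ne_zero_of_mul hw.2
  · rintro w ⟨hwU, hw⟩ a b hab hab'
    exact extension_ofVec w (isTangentProjection_frame (hc w) (hA w hwU)
      (left_ne_zero_of_mul hw) (right_ne_zero_of_mul hw) hab hab')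

theorem DeltaQ.incl_isMorphism : (ConfigModuli.space Config.IsDeltaQ).IsMorphism
    (ConfigModuli.space Config.IsExtended) DeltaQ.incl := by
  rw [ConfigModuli.space_eq, ConfigModuli.space_eq, FunctionSpace.isMorphism_coinduced_iff]
  refine FunctionSpace.IsMorphismOn.isMorphism (FunctionSpace.isMorphismOn_coinduced
    ((FunctionSpace.isLocal_affineSpace _).induced _) fun v _ => ?_)
  exact ⟨Set.univ, fun w => w.1, FunctionSpace.isOpen_univ _, trivial, subset_rfl,
    fun _ => FunctionSpace.regular_coord_induced _ _ _,
    fun w _ => ⟨⟨w.1, w.2.1, Or.inr w.2.2⟩, rfl, rfl⟩⟩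

/-- The composite of `extension` with the surjection `DM(2⁶) → Δ_Q` is the embedding `descend`, so
the restriction of `extension` to `Δ_Q` is an embedding, too. -/
theorem extension_incl_isEmb : (ConfigModuli.space Config.IsDeltaQ).IsEmb DMZ2.space
    (extension ∘ DeltaQ.incl) := by
  refine FunctionSpace.IsEmb.of_comp ?_ DM.toDeltaQ_isMorphism DM.toDeltaQ_surjective ?_
  · rw [show (extension ∘ DeltaQ.incl) ∘ DM.toDeltaQ = descend from
      funext extension_incl_toDeltaQ]
    exact descend_isEmb
  · exact ⟨fun V hV => DeltaQ.incl_isMorphism.1 _ (extension_isMorphism.1 V hV),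
      fun V h hV hh => DeltaQ.incl_isMorphism.2 _ _ (extension_isMorphism.1 V hV)
        (extension_isMorphism.2 V h hV hh)⟩

theorem range_extension_incl : Set.range (extension ∘ DeltaQ.incl) = Set.range descend := by
  rw [← DM.toDeltaQ_surjective.range_comp, Function.comp_assoc]
  exact congrArg Set.range (funext extension_incl_toDeltaQ)

end SixPoints

open SixPoints in
/-- The map `φ⁶₇ : M^sm → DM_{ℤ/2}(2⁵,1²)` extends to an `S₅`-equivariant morphism `Φ` on
`M^sm ∪ Δ_Q`; its restriction to `Δ_Q` is an isomorphism onto its image, which is the sublocus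
`DM(2⁶)`, embedded in `DM_{ℤ/2}(2⁵,1²)` by `descend`. -/
theorem mainTheorem5 :
    ∃ Φ : ExtendedModuli → DMZ2,
      (ConfigModuli.space Config.IsExtended).IsMorphism DMZ2.space Φ ∧
      (∀ x : MSm, Φ x.incl = phi67 x) ∧
      (∀ (σ : Equiv.Perm (Fin 5)) (x : ExtendedModuli),
        Φ (ExtendedModuli.perm σ x) = DMZ2.perm σ (Φ x)) ∧
      Set.range (Φ ∘ DeltaQ.incl) = Set.range descend ∧
      (ConfigModuli.space Config.IsDeltaQ).IsIsomorphismOntoImage DMZ2.space (Φ ∘ DeltaQ.incl) ∧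
      (DM.space weight26).IsIsomorphismOntoImage DMZ2.space descend := by
  exact ⟨extension, extension_isMorphism, extension_incl, extension_perm, range_extension_incl,
    extension_incl_isEmb.isIsomorphismOntoImage, descend_isEmb.isIsomorphismOntoImage⟩
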